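/- Let $d\ge 3$. Let $\mathbb B^d$ be the set of nonoriented nearest-neighbour bonds $\{x,x+e_i\}$ of $\mathbb Z^d$ ($x\in\mathbb Z^d$, $1\le i\le d$). For $u:\mathbb Z^d\to\mathbb R$ set $\nabla u(\{x,x+e_i\})=u(x+e_i)-u(x)$, and for $F:\mathbb B^d\to\mathbb R$ set $\nabla^*F(x)=\sum_{i=1}^d\bigl(F(\{x-e_i,x\})-F(\{x,x+e_i\})\bigr)$. For $y\in\mathbb Z^d$ and $n\in\{1,2,\dots\}$ let $B(y,n)=y+([-n,n]\cap\mathbb Z)^d$. For a nonempty finite set $A$ and $F:A\to\mathbb R$ let $\|F\|_{\underline L^p(A)}=\bigl(\frac1{|A|}\sum_{a\in A}|F(a)|^p\bigr)^{1/p}$ for $0<p<\infty$ and $\|F\|_{\underline L^\infty(A)}=\max_{a\in A}|F(a)|$. For $\omega:\mathbb B^d\to(0,\infty)$, $p,q\in(1,\infty]$ and a finite $S\subset\mathbb Z^d$ containing both endpoints of at least one bond, set $$\Lambda^\omega(S)=\|\omega\|_{\underline L^p(S_{\mathbb B})}\,\|\omega^{-1}\|_{\underline L^q(S_{\mathbb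 B})},$$ where $S_{\mathbb B}$ is the set of bonds with both endpoints in $S$. **Theorem.** Let $d\ge3$ and let $p,q\in(1,\infty]$ satisfy $\frac1p+\frac1q<\frac2{d-1}$ (with $\frac1\infty=0$). Put $\delta=\frac1{d-1}-\frac1{2p}-\frac1{2q}$ and $p'=\frac p{p-1}$ (with $p'=1$ if $p=\infty$). Then $\delta>0$, and there is a constant $c=c(d,p,q)\in[1,\infty)$ such that for every $\omega:\mathbb B^d\to(0,\infty)$, every $u:\mathbb Z^d\to\mathbb R$ with $\nabla^*(\omega\nabla u)=0$ on $\mathbb Z^d$, every $y\in\mathbb Z^d$ and every integer $n\ge1$, $$\max_{x\in B(y,n)}|u(x)|\le c\,\Lambda^\omega(B(y,2n))^{p'\frac{\delta+1}{\delta}}\,\|u\|_{\underline L^1(B(y,2n))}.$$ -/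

import Mathlib

open scoped ENNReal

/-- The vertex set `ℤ^d`. -/
abbrev LatticePt (d : ℕ) : Type := Fin d → ℤ

/-- The set `𝔹^d` of nonoriented nearest-neighbour bonds. Every such bond is `{x, x + e_i}` for
exactly one vertex `x` and one direction `i` (proved below in `Bond.toSym2_injective` and
`Bond.range_toSym2`), and it is represented by this pair `(x, i)`. -/
abbrev Bond (d : ℕ) : Type := LatticePt d × Fin d

namespace Bond

/-- The endpoint `x` of the bond `{x, x + e_i}`. -/
def lower {d : ℕ} (b : Bond d) : LatticePt d := b.1

/-- The endpoint `x + e_i` of the bond `{x, x + e_i}`. -/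
def upper {d : ℕ} (b : Bond d) : LatticePt d := b.1 + Pi.single b.2 1

/-- The bond as an unordered pair of vertices. -/
def toSym2 {d : ℕ} (b : Bond d) : Sym2 (LatticePt d) := s(b.lower, b.upper)

theorem toSym2_injective {d : ℕ} : Function.Injective (toSym2 (d := d)) := by
  rintro ⟨x, i⟩ ⟨y, j⟩ h
  simp only [toSym2, lower, upper, Sym2.eq_iff] at h
  rcases h with ⟨rfl, h⟩ | ⟨h1, h2⟩
  · have h' := congrFun (add_left_cancel h) i
    by_cases hij : i = j
    · rw [hij]
    · simp [hij] at h'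
  · rw [h1, add_assoc] at h2
    have h3 := congrFun (left_eq_add.mp h2.symm) i
    have h4 : (0 : ℤ) ≤ (Pi.single j 1 : LatticePt d) i := by
      by_cases hij : i = j <;> simp [hij]
    simp only [Pi.add_apply, Pi.single_eq_same, Pi.zero_apply] at h3
    omega

/-- The bonds are exactly the unordered pairs of vertices at Euclidean distance `1`. -/
theorem range_toSym2 {d : ℕ} :
    Set.range (toSym2 (d := d)) = {e | ∃ x y : LatticePt d, e = s(x, y) ∧ ∑ i, (x i - y i) ^ 2 = 1} := by
  ext e
  constructor
  · rintro ⟨⟨x, i⟩, rfl⟩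
    refine ⟨x, x + Pi.single i 1, rfl, ?_⟩
    rw [Finset.sum_eq_single i]
    · simp
    · intro j _ hj
      simp [hj]
    · simp
  · rintro ⟨x, y, rfl, h⟩
    have hex : ∃ i, x i - y i ≠ 0 := by
      by_contra hcon
      push Not at hcon
      simp [hcon] at h
    obtain ⟨i, hi⟩ := hex
    rw [← Finset.add_sum_erase _ _ (Finset.mem_univ i)] at h
    have hnn : ∀ j ∈ Finset.univ.erase i, 0 ≤ (x j - y j) ^ 2 := fun j _ => sq_nonneg _
    have hs := Finset.sum_nonneg hnn
    have hpos : 0 < (x i - y i) ^ 2 := by positivity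
    have h1 : (x i - y i) ^ 2 = 1 := by omega
    have h0 : ∑ j ∈ Finset.univ.erase i, (x j - y j) ^ 2 = 0 := by omega
    have hz : ∀ j, j ≠ i → x j = y j := by
      intro j hj
      have hj' := (Finset.sum_eq_zero_iff_of_nonneg hnn).mp h0 j (by simp [hj])
      have := pow_eq_zero_iff (two_ne_zero) |>.mp hj'
      omega
    have h2 : x i - y i = 1 ∨ x i - y i = -1 := by simpa using h1
    rcases h2 with h2 | h2
    · refine ⟨(y, i), ?_⟩
      have : y + Pi.single i 1 = x := by
        ext j
        by_cases hj : j = i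
        · subst hj; simp; omega
        · simp [hj, hz j hj]
      simp only [toSym2, lower, upper, this]
      exact Sym2.eq_swap
    · refine ⟨(x, i), ?_⟩
      have : x + Pi.single i 1 = y := by
        ext j
        by_cases hj : j = i
        · subst hj; simp; omega
        · simp [hj, hz j hj]
      simp only [toSym2, lower, upper, this]

end Bond

/-- The box `B(y,n) = y + ([-n,n] ∩ ℤ)^d`. -/
noncomputable def box {d : ℕ} (y : LatticePt d) (n : ℕ) : Finset (LatticePt d) :=
  Finset.Icc (fun i => y i - (n : ℤ)) (fun i => y i + (n : ℤ))

theorem mem_box {d : ℕ} (y x : LatticePt d) (n : ℕ) :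
    x ∈ box y n ↔ ∀ i, |x i - y i| ≤ n := by
  simp only [box, Finset.mem_Icc, Pi.le_def, ← forall_and, abs_le]
  exact forall_congr' fun i => by omega

/-- The set of bonds with both endpoints in `S`. -/
def bondsIn {d : ℕ} (S : Finset (LatticePt d)) : Finset (Bond d) :=
  (S ×ˢ (Finset.univ : Finset (Fin d))).filter (fun b => Bond.upper b ∈ S)

theorem mem_bondsIn {d : ℕ} (S : Finset (LatticePt d)) (b : Bond d) :
    b ∈ bondsIn S ↔ b.lower ∈ S ∧ b.upper ∈ S := by
  simp [bondsIn, Bond.lower]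

/-- The normalized (averaged) `L^p` norm of `F` on a finite set `S`, for `p ∈ (0,∞]`:
`(|S|⁻¹ ∑_{a ∈ S} |F a|^p)^(1/p)` if `p < ∞`, and `sup_{a ∈ S} |F a|` if `p = ∞`. -/
noncomputable def avgNorm {α : Type*} (p : ℝ≥0∞) (S : Finset α) (F : α → ℝ) : ℝ :=
  if p = ∞ then ⨆ a : S, |F a|
  else ((S.card : ℝ)⁻¹ * ∑ a ∈ S, |F a| ^ p.toReal) ^ (1 / p.toReal)

/-- The discrete derivative `∇u({x, x + e_i}) = u(x + e_i) - u(x)`. -/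
def grad {d : ℕ} (u : LatticePt d → ℝ) (b : Bond d) : ℝ :=
  u b.upper - u b.lower

/-- The discrete divergence
`∇^*F(x) = ∑_i (F({x - e_i, x}) - F({x, x + e_i}))`. -/
def divStar {d : ℕ} (F : Bond d → ℝ) (x : LatticePt d) : ℝ :=
  ∑ i : Fin d, (F (x - Pi.single i 1, i) - F (x, i))

/-- `Λ^ω(S) = ‖ω‖_{L^p(S)} ‖ω⁻¹‖_{L^q(S)}`, with averaged norms over the bonds of `S`. -/
noncomputable def Lam {d : ℕ} (p q : ℝ≥0∞) (ω : Bond d → ℝ) (S : Finset (LatticePt d)) : ℝ :=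
  avgNorm p (bondsIn S) ω * avgNorm q (bondsIn S) (fun b => (ω b)⁻¹)

/-- The dual exponent `p' = p / (p - 1)` of `p ∈ (1,∞]`, with `p' = 1` for `p = ∞`. -/
noncomputable def dualExp (p : ℝ≥0∞) : ℝ :=
  if p = ∞ then 1 else p.toReal / (p.toReal - 1)

/-- `δ = 1/(d-1) - 1/(2p) - 1/(2q)`, with `1/∞ = 0`. -/
noncomputable def delta (d : ℕ) (p q : ℝ≥0∞) : ℝ :=
  1 / ((d : ℝ) - 1) - p⁻¹.toReal / 2 - q⁻¹.toReal / 2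

/-! Write `P = 1/p`, `Q = 1/q` and `t = 2/(1+Q)`, and let `s` be the exponent whose Sobolev
conjugate in dimension `d - 1` is `2p' = 2/(1-P)`. Then `1/s - 1/t = δ`, so the hypothesis on `p`
and `q` says exactly that `s < t`.

The function `w = |u|` is a nonnegative subsolution, and Moser's iteration is run on its powers `v =
w ^ α`. Testing with `η² w ^ (2α-1)` bounds the weighted energy of `v` by `∑ ω (∇η)² v(x) v(x')`.
The point is to choose `η` after `w`: it is a product of one-dimensional profiles whose jumps are
spread evenly over good hyperplanes, those on which the mass of the weight and the `s`-energy of `v`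
are at most three times their averages over the annulus. By Markov's inequality at least a third of
the hyperplanes are good (`exists_good_subset`). On each of them, Hölder with `ω ∈ L^p` leaves `v`
in `L^(2p')` (`crossSum_le`), which the Sobolev inequality on the slice bounds by the `s`-energy
(`exists_slice_sobolev`). Using Sobolev in dimension `d - 1` rather than `d` is what produces the
threshold `2/(d-1)`. The outcome is `exists_bondEnergy_le`.

Hölder with `ω⁻¹ ∈ L^q` converts weighted energy into `t`-energy. The gap `δ` pays for a higher
power: `∇(v^(1+δ))` is of size `v^δ ∇v`, with `v^δ` in `L^(1/δ)` and `∇v` in `L^t`, so the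
`s`-energy of `v^(1+δ)` is controlled by the `t`-energy `E(v)`. Altogether
(`exists_scaledEnergy_step`) `E(v^(1+δ)) ≤ C Λ^(t/2) (n/(σ-ρ))^κ E(v)^(1+δ)` between boxes of radii
`ρ < σ`.

Iterating along `α = (1+δ)^k` bounds the maximum by `Λ^((1+δ)/(2δ))` times the `L^(2p')` average
(`exists_le_sum_rpow`). Interpolating this average between `L^1` and the maximum on a larger box,
and iterating over radii, multiplies the exponent of `Λ` by `2p'` (`exists_le_sum`), which gives
`p'(δ+1)/δ`. Both iterations are finite: on the lattice they stop once the radii cannot be halved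
further, and the factor `n^d` lost there in comparing a point value with a sum is absorbed by the
geometrically growing constants. -/

/-! ### Hölder's inequality and convexity of powers -/

/-- Hölder's inequality for sums, in the form with exponents `α + β = 1`. -/
theorem sum_rpow_mul_rpow_le {κ : Type*} (S : Finset κ) (f g : κ → ℝ) {α β : ℝ}
    (hf : ∀ i ∈ S, 0 ≤ f i) (hg : ∀ i ∈ S, 0 ≤ g i) (hα : 0 ≤ α) (hβ : 0 ≤ β) (h : α + β = 1) :
    ∑ i ∈ S, f i ^ α * g i ^ β ≤ (∑ i ∈ S, f i) ^ α * (∑ i ∈ S, g i) ^ β := by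
  rcases hα.eq_or_lt with rfl | hα
  · obtain rfl : β = 1 := by linarith
    simp
  rcases hβ.eq_or_lt with rfl | hβ
  · obtain rfl : α = 1 := by linarith
    simp
  have hc : Real.HolderConjugate (1 / α) (1 / β) := by
    rw [Real.holderConjugate_iff]
    refine ⟨?_, by simpa using h⟩
    rw [lt_div_iff₀ hα]; linarith
  have := Real.inner_le_Lp_mul_Lq_of_nonneg S hc (f := fun i => f i ^ α) (g := fun i => g i ^ β)
    (fun i hi => Real.rpow_nonneg (hf i hi) _) (fun i hi => Real.rpow_nonneg (hg i hi) _)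
  refine this.trans (le_of_eq ?_)
  rw [one_div_one_div, one_div_one_div]
  congr 2
  · refine Finset.sum_congr rfl fun i hi => ?_
    rw [← Real.rpow_mul (hf i hi), mul_one_div_cancel hα.ne', Real.rpow_one]
  · refine Finset.sum_congr rfl fun i hi => ?_
    rw [← Real.rpow_mul (hg i hi), mul_one_div_cancel hβ.ne', Real.rpow_one]

/-- Power means: the sum of `f ^ α`, `α ≤ 1`, is controlled by the sum of `f`. -/
theorem sum_rpow_le_card_rpow_mul {κ : Type*} (S : Finset κ) (f : κ → ℝ) {α : ℝ}
    (hf : ∀ i ∈ S, 0 ≤ f i) (hα : 0 ≤ α) (hα1 : α ≤ 1) :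
    ∑ i ∈ S, f i ^ α ≤ (S.card : ℝ) ^ (1 - α) * (∑ i ∈ S, f i) ^ α := by
  have := sum_rpow_mul_rpow_le S (fun _ => 1) f (fun _ _ => zero_le_one) hf
    (sub_nonneg.2 hα1) hα (by ring)
  simpa using this

/-- Tangent line bound for `x ↦ x ^ γ`. -/
theorem mul_rpow_sub_one_mul_sub_le {a b γ : ℝ} (ha : 0 ≤ a) (hb : 0 ≤ b) (hγ : 1 ≤ γ) :
    γ * b ^ (γ - 1) * (a - b) ≤ a ^ γ - b ^ γ := by
  rcases hγ.eq_or_lt with rfl | hγ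
  · simp
  rcases hb.eq_or_lt with rfl | hb
  · rw [Real.zero_rpow (by linarith), Real.zero_rpow (by linarith)]
    simpa using Real.rpow_nonneg ha γ
  have h := one_add_mul_self_le_rpow_one_add (s := a / b - 1)
    (by have := div_nonneg ha hb.le; linarith) hγ.le
  rw [add_sub_cancel, Real.div_rpow ha hb.le, le_div_iff₀ (Real.rpow_pos_of_pos hb _)] at h
  have e : b ^ γ = b ^ (γ - 1) * b := by
    rw [← Real.rpow_add_one hb.ne']; ring_nf
  rw [e] at h ⊢
  have : (1 + γ * (a / b - 1)) * (b ^ (γ - 1) * b)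
      = b ^ (γ - 1) * b + γ * b ^ (γ - 1) * (a - b) := by
    field_simp
  linarith

theorem abs_rpow_sub_rpow_le {a b γ : ℝ} (ha : 0 ≤ a) (hb : 0 ≤ b) (hγ : 1 ≤ γ) :
    |a ^ γ - b ^ γ| ≤ γ * max a b ^ (γ - 1) * |a - b| := by
  wlog hab : b ≤ a generalizing a b
  · rw [abs_sub_comm, abs_sub_comm a, max_comm]
    exact this hb ha (le_of_not_ge hab)
  rw [max_eq_left hab, abs_of_nonneg (sub_nonneg.2 hab),
    abs_of_nonneg (sub_nonneg.2 (Real.rpow_le_rpow hb hab (by linarith)))]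
  have := mul_rpow_sub_one_mul_sub_le hb ha hγ
  linarith

/-! ### The Sobolev inequality on lattice boxes -/

/-- A nonnegative function on an integer interval is bounded by its average plus its variation. -/
theorem le_sum_abs_sub_add_average (φ : ℤ → ℝ) (a b : ℤ) (x : ℤ) (hφ : ∀ z, 0 ≤ φ z)
    (hx : x ∈ Finset.Icc a b) {l : ℝ} (hl : 0 < l) (hlb : l ≤ b - a + 1) :
    φ x ≤ ∑ z ∈ Finset.Icc a b, ((if z + 1 ∈ Finset.Icc a b then |φ (z + 1) - φ z| else 0)
      + φ z / l) := by
  have tv : ∀ c e : ℤ, a ≤ c → c ≤ e → e ≤ b → |φ e - φ c| ≤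
      ∑ z ∈ Finset.Icc a b, (if z + 1 ∈ Finset.Icc a b then |φ (z + 1) - φ z| else 0) := by
    intro c e hc hce he
    have h1 : |φ e - φ c| ≤ ∑ z ∈ Finset.Ico c e, |φ (z + 1) - φ z| := by
      induction e, hce using Int.leInduction with
      | base => simp
      | succ e hce ih =>
        have hi : Finset.Ico c (e + 1) = insert e (Finset.Ico c e) := by
          ext z; simp; omega
        rw [hi, Finset.sum_insert (by simp)]
        have := ih (by omega)
        have h2 := abs_sub_le (φ (e + 1)) (φ e) (φ c)
        linarith
    refine h1.trans ?_
    refine (Finset.sum_le_sum (g := fun z => if z + 1 ∈ Finset.Icc a b then |φ (z + 1) - φ z| else 0)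
      fun z hz => ?_).trans (Finset.sum_le_sum_of_subset_of_nonneg ?_ fun z _ _ => by positivity)
    · rw [Finset.mem_Ico] at hz
      rw [if_pos (by rw [Finset.mem_Icc]; omega)]
    · intro z hz
      rw [Finset.mem_Ico] at hz
      rw [Finset.mem_Icc]; omega
  have hne : (Finset.Icc a b).Nonempty := ⟨x, hx⟩
  obtain ⟨z0, hz0, hmin⟩ := Finset.exists_min_image _ φ hne
  have hab : a ≤ b := (Finset.mem_Icc.1 hx).1.trans (Finset.mem_Icc.1 hx).2
  have havg : φ z0 ≤ ∑ z ∈ Finset.Icc a b, φ z / l := by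
    rw [← Finset.sum_div, le_div_iff₀ hl]
    have h1 := Finset.card_nsmul_le_sum _ φ _ hmin
    have h2 : (((Finset.Icc a b).card : ℕ) : ℝ) = b - a + 1 := by
      rw [Int.card_Icc]
      have : (((b + 1 - a).toNat : ℤ) : ℝ) = ((b + 1 - a : ℤ) : ℝ) := by
        rw [Int.toNat_of_nonneg (by omega)]
      push_cast at this
      rw [this]; ring
    rw [nsmul_eq_mul, h2] at h1
    refine le_trans ?_ h1
    rw [mul_comm]
    exact mul_le_mul_of_nonneg_right hlb (hφ _)
  rw [Finset.sum_add_distrib]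
  rw [Finset.mem_Icc] at hx hz0
  have : |φ x - φ z0| ≤
      ∑ z ∈ Finset.Icc a b, (if z + 1 ∈ Finset.Icc a b then |φ (z + 1) - φ z| else 0) := by
    rcases le_total z0 x with h | h
    · exact tv _ _ hz0.1 h hx.2
    · rw [abs_sub_comm]; exact tv _ _ hx.1 h hz0.2
  have := (le_abs_self _).trans this
  linarith

open MeasureTheory in
/-- A discrete Loomis–Whitney type inequality on a lattice box. -/
theorem sum_rpow_le_of_le_sum_line {ι : Type*} [Fintype ι] [DecidableEq ι] {m' : ℝ}
    (hm : Real.HolderConjugate (Fintype.card ι) m') (a b : ι → ℤ) (F g : (ι → ℤ) → ℝ)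
    (hF : ∀ x, 0 ≤ F x) (hg : ∀ x, 0 ≤ g x)
    (h : ∀ x ∈ Finset.Icc a b, ∀ j, F x ≤ ∑ z ∈ Finset.Icc (a j) (b j), g (Function.update x j z)) :
    ∑ x ∈ Finset.Icc a b, F x ^ m' ≤ (∑ x ∈ Finset.Icc a b, g x) ^ m' := by
  set Q := Finset.Icc a b
  -- Extension by zero, so that sums over full lattice lines reduce to the segments inside the box
  -- and the Gagliardo–Nirenberg product inequality for counting measure applies.
  let f : (ι → ℤ) → ℝ≥0∞ := fun x => if x ∈ Q then ENNReal.ofReal (g x) else 0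
  have key := lintegral_prod_lintegral_pow_le (fun _ : ι => (Measure.count : Measure ℤ)) hm
    (f := f) (measurable_of_countable _)
  have hcard : (1 : ℝ) < Fintype.card ι := hm.lt
  simp only [lintegral_countable', Measure.pi_singleton, Measure.count_singleton,
    Finset.prod_const_one, mul_one] at key
  have hR : ∑' x, f x = ENNReal.ofReal (∑ x ∈ Q, g x) := by
    rw [ENNReal.ofReal_sum_of_nonneg fun x _ => hg x, tsum_eq_sum (s := Q)]
    · exact Finset.sum_congr rfl fun x hx => by simp [f, hx]
    · intro x hx; simp [f, hx]
  have hL : ENNReal.ofReal (∑ x ∈ Q, F x ^ m') ≤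
      ∑' x, ∏ i, (∑' z, f (Function.update x i z)) ^ (1 / ((Fintype.card ι : ℝ) - 1)) := by
    rw [ENNReal.ofReal_sum_of_nonneg fun x _ => Real.rpow_nonneg (hF x) _]
    refine le_trans (Finset.sum_le_sum fun x hx => ?_) (ENNReal.sum_le_tsum Q)
    have h1 : ∀ i, ENNReal.ofReal (F x) ≤ ∑' z, f (Function.update x i z) := by
      intro i
      refine (ENNReal.ofReal_le_ofReal (h x hx i)).trans ?_
      rw [ENNReal.ofReal_sum_of_nonneg fun x _ => hg _]
      refine le_trans (Finset.sum_le_sum fun z hz => ?_)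
        (ENNReal.sum_le_tsum (Finset.Icc (a i) (b i)))
      have : Function.update x i z ∈ Q := by
        simp only [Q, Finset.mem_Icc, Pi.le_def] at hx hz ⊢
        constructor <;> intro j <;> by_cases hj : j = i
        · subst hj; simpa using hz.1
        · simpa [hj] using hx.1 j
        · subst hj; simpa using hz.2
        · simpa [hj] using hx.2 j
      simp [f, this]
    calc ENNReal.ofReal (F x ^ m') = ENNReal.ofReal (F x) ^ m' := by
          rw [ENNReal.ofReal_rpow_of_nonneg (hF x) hm.symm.nonneg]
      -- The conjugate exponent of the dimension `m` is `m / (m - 1)`, so one factor of exponent `1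
      -- / (m - 1)` is available for each coordinate line through `x`.
      _ = ∏ _i : ι, ENNReal.ofReal (F x) ^ (1 / ((Fintype.card ι : ℝ) - 1)) := by
          rw [Finset.prod_const, Finset.card_univ, ← ENNReal.rpow_natCast, ← ENNReal.rpow_mul]
          congr 1
          rw [hm.conjugate_eq]; ring
      _ ≤ _ := by
          refine Finset.prod_le_prod' fun i _ => ENNReal.rpow_le_rpow (h1 i) ?_
          have : 0 < (Fintype.card ι : ℝ) - 1 := by linarith
          positivity
  have h3 := hL.trans key
  rw [hR, ENNReal.ofReal_rpow_of_nonneg (Finset.sum_nonneg fun x _ => hg x) hm.symm.nonneg] at h3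
  exact (ENNReal.ofReal_le_ofReal_iff (Real.rpow_nonneg (Finset.sum_nonneg fun x _ => hg x) _)).1 h3

/-- The discrete Sobolev energy `∑ |∇f|^s + ∑ |f / l|^s` of a nonnegative function on `Q`. -/
noncomputable def sobEnergy {ι : Type*} [Fintype ι] [DecidableEq ι] (s l : ℝ)
    (Q : Finset (ι → ℤ)) (f : (ι → ℤ) → ℝ) : ℝ :=
  ∑ x ∈ Q, (∑ j, (if x + Pi.single j 1 ∈ Q then |f (x + Pi.single j 1) - f x| ^ s else 0)
    + (f x / l) ^ s)

section Sobolev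

variable {ι : Type*} [Fintype ι] [DecidableEq ι]

theorem sobEnergy_eq (s l : ℝ) (Q : Finset (ι → ℤ)) (f : (ι → ℤ) → ℝ) :
    sobEnergy s l Q f = ∑ b ∈ Q ×ˢ (Finset.univ : Finset ι),
      (if b.1 + Pi.single b.2 1 ∈ Q then |f (b.1 + Pi.single b.2 1) - f b.1| ^ s else 0)
      + ∑ x ∈ Q, (f x / l) ^ s := by
  rw [sobEnergy, Finset.sum_add_distrib, Finset.sum_product]

theorem sobEnergy_term_nonneg {s l : ℝ} (hl : 0 ≤ l) {f : (ι → ℤ) → ℝ} (hf : ∀ x, 0 ≤ f x)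
    (Q : Finset (ι → ℤ)) (x : ι → ℤ) :
    0 ≤ ∑ j, (if x + Pi.single j 1 ∈ Q then |f (x + Pi.single j 1) - f x| ^ s else 0)
      + (f x / l) ^ s := by
  have := div_nonneg (hf x) hl
  refine add_nonneg (Finset.sum_nonneg fun j _ => ?_) (by positivity)
  split_ifs <;> positivity

theorem sobEnergy_nonneg {s l : ℝ} (hl : 0 ≤ l) {f : (ι → ℤ) → ℝ} (hf : ∀ x, 0 ≤ f x)
    (Q : Finset (ι → ℤ)) : 0 ≤ sobEnergy s l Q f :=
  Finset.sum_nonneg fun x _ => sobEnergy_term_nonneg hl hf Q x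

theorem sum_div_rpow_le_sobEnergy {s l : ℝ} {f : (ι → ℤ) → ℝ}
    (Q : Finset (ι → ℤ)) : ∑ x ∈ Q, (f x / l) ^ s ≤ sobEnergy s l Q f := by
  rw [sobEnergy_eq]
  refine le_add_of_nonneg_left (Finset.sum_nonneg fun b _ => ?_)
  split_ifs <;> positivity

theorem sum_grad_le_sobEnergy {s l : ℝ} (hl : 0 ≤ l) {f : (ι → ℤ) → ℝ} (hf : ∀ x, 0 ≤ f x)
    (Q : Finset (ι → ℤ)) : ∑ b ∈ Q ×ˢ (Finset.univ : Finset ι),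
      (if b.1 + Pi.single b.2 1 ∈ Q then |f (b.1 + Pi.single b.2 1) - f b.1| ^ s else 0)
      ≤ sobEnergy s l Q f := by
  rw [sobEnergy_eq]
  refine le_add_of_nonneg_right (Finset.sum_nonneg fun b _ => ?_)
  have := div_nonneg (hf b) hl
  positivity

/-- Summing a nonnegative function over the upper endpoints of bonds in `Q`. -/
theorem sum_upper_le (Q : Finset (ι → ℤ)) {F : (ι → ℤ) → ℝ} (hF : ∀ x, 0 ≤ F x) (j : ι) :
    ∑ x ∈ Q, (if x + Pi.single j 1 ∈ Q then F (x + Pi.single j 1) else 0) ≤ ∑ x ∈ Q, F x := by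
  rw [← Finset.sum_filter]
  refine (Finset.sum_image (f := F) (s := Q.filter fun x => x + Pi.single j 1 ∈ Q)
    (g := fun x => x + Pi.single j 1) (fun _ _ _ _ h => by simpa using h)).ge.trans ?_
  refine Finset.sum_le_sum_of_subset_of_nonneg ?_ fun x _ _ => hF x
  intro x hx
  simp only [Finset.mem_image, Finset.mem_filter] at hx
  obtain ⟨z, hz, rfl⟩ := hx
  exact hz.2

/-- Each vertex is an endpoint of at most `2 * card ι` bonds, and a maximum of nonnegative numbers
is at most their sum. -/
theorem sum_max_le (Q : Finset (ι → ℤ)) {F : (ι → ℤ) → ℝ} (hF : ∀ x, 0 ≤ F x) :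
    ∑ b ∈ Q ×ˢ (Finset.univ : Finset ι),
      (if b.1 + Pi.single b.2 1 ∈ Q then max (F (b.1 + Pi.single b.2 1)) (F b.1) else 0)
      ≤ 2 * Fintype.card ι * ∑ x ∈ Q, F x := by
  rw [Finset.sum_product_right]
  have : ∀ j ∈ (Finset.univ : Finset ι), ∑ x ∈ Q,
      (if x + Pi.single j 1 ∈ Q then max (F (x + Pi.single j 1)) (F x) else 0)
      ≤ 2 * ∑ x ∈ Q, F x := by
    intro j _
    rw [two_mul]
    refine le_trans ?_ (add_le_add_left (sum_upper_le Q hF j) _)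
    rw [← Finset.sum_add_distrib]
    refine Finset.sum_le_sum fun x _ => ?_
    have h1 := hF x
    have h2 := hF (x + Pi.single j 1)
    split_ifs
    · exact max_le_add_of_nonneg h2 h1
    · linarith
  refine (Finset.sum_le_sum this).trans (le_of_eq ?_)
  rw [Finset.sum_const, Finset.card_univ, nsmul_eq_mul]; ring

/-- The energy of a power of `f`, estimated by Hölder's inequality. -/
theorem sobEnergy_rpow_le {s t r γ θ l : ℝ} (hl : 0 < l) (hs : 0 ≤ s) (hγ : 1 ≤ γ) (hr : 0 < r)
    (hθ : 0 ≤ θ) (hθ1 : θ ≤ 1) (h1 : s * (γ - 1) = r * (1 - θ)) (h2 : s = t * θ)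
    (Q : Finset (ι → ℤ)) {f : (ι → ℤ) → ℝ} (hf : ∀ x, 0 ≤ f x) :
    sobEnergy s l Q (fun x => f x ^ γ) ≤
      (γ ^ s * (2 * Fintype.card ι + 1) + 1) * (∑ x ∈ Q, f x ^ r) ^ (1 - θ) *
        sobEnergy t l Q f ^ θ := by
  have hT := sobEnergy_nonneg (s := t) hl.le hf Q
  have hZ : 0 ≤ ∑ x ∈ Q, f x ^ r := Finset.sum_nonneg fun x _ => Real.rpow_nonneg (hf x) _
  have hγs : 0 ≤ γ ^ s := by positivity
  rw [sobEnergy_eq]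
  have A : ∑ x ∈ Q, (f x ^ γ / l) ^ s ≤ (∑ x ∈ Q, f x ^ r) ^ (1 - θ) * sobEnergy t l Q f ^ θ := by
    calc ∑ x ∈ Q, (f x ^ γ / l) ^ s
        = ∑ x ∈ Q, (f x ^ r) ^ (1 - θ) * ((f x / l) ^ t) ^ θ := by
          refine Finset.sum_congr rfl fun x _ => ?_
          have hx := hf x
          rw [← Real.rpow_mul hx, ← Real.rpow_mul (div_nonneg hx hl.le), ← h1, ← h2, mul_comm s,
            Real.rpow_mul hx, ← Real.mul_rpow (Real.rpow_nonneg hx _) (div_nonneg hx hl.le)]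
          congr 1
          rw [mul_div_assoc']
          congr 1
          rw [← Real.rpow_add_one' hx (by linarith)]
          ring_nf
      _ ≤ _ := sum_rpow_mul_rpow_le Q _ _ (fun x _ => Real.rpow_nonneg (hf x) _)
          (fun x _ => Real.rpow_nonneg (div_nonneg (hf x) hl.le) _) (by linarith) hθ (by ring)
      _ ≤ _ := by
          refine mul_le_mul_of_nonneg_left ?_ (Real.rpow_nonneg hZ _)
          exact Real.rpow_le_rpow (Finset.sum_nonneg fun x _ =>
            Real.rpow_nonneg (div_nonneg (hf x) hl.le) _) (sum_div_rpow_le_sobEnergy Q) hθ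
  have B : ∑ b ∈ Q ×ˢ (Finset.univ : Finset ι), (if b.1 + Pi.single b.2 1 ∈ Q then
      |f (b.1 + Pi.single b.2 1) ^ γ - f b.1 ^ γ| ^ s else 0) ≤
      γ ^ s * (2 * Fintype.card ι + 1) * ((∑ x ∈ Q, f x ^ r) ^ (1 - θ) * sobEnergy t l Q f ^ θ) := by
    -- Discrete chain rule: the difference of `γ`-th powers is at most `γ * max ^ (γ - 1)` times the
    -- difference. The maximum over the two endpoints is paid for by `sum_max_le`.
    calc _ ≤ ∑ b ∈ Q ×ˢ (Finset.univ : Finset ι), γ ^ s *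
          ((if b.1 + Pi.single b.2 1 ∈ Q then
            max (f (b.1 + Pi.single b.2 1) ^ r) (f b.1 ^ r) else 0) ^ (1 - θ) *
          (if b.1 + Pi.single b.2 1 ∈ Q then
            |f (b.1 + Pi.single b.2 1) - f b.1| ^ t else 0) ^ θ) := by
          refine Finset.sum_le_sum fun b _ => ?_
          split_ifs with hb
          · set p := f (b.1 + Pi.single b.2 1)
            have hp : 0 ≤ p := hf _
            set q := f b.1
            have hq : 0 ≤ q := hf _
            have hmax : max (p ^ r) (q ^ r) = max p q ^ r := by
              rcases le_total p q with h | h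
              · rw [max_eq_right h, max_eq_right (Real.rpow_le_rpow hp h hr.le)]
              · rw [max_eq_left h, max_eq_left (Real.rpow_le_rpow hq h hr.le)]
            have hm : 0 ≤ max p q := le_max_of_le_left hp
            rw [hmax, ← Real.rpow_mul hm, ← Real.rpow_mul (abs_nonneg _), ← h1, ← h2]
            calc |p ^ γ - q ^ γ| ^ s ≤ (γ * max p q ^ (γ - 1) * |p - q|) ^ s :=
                  Real.rpow_le_rpow (abs_nonneg _) (abs_rpow_sub_rpow_le hp hq hγ) hs
              _ = _ := by
                  rw [Real.mul_rpow (by positivity) (abs_nonneg _), Real.mul_rpow (by linarith)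
                    (by positivity), ← Real.rpow_mul hm, mul_comm s, mul_assoc]
          · exact mul_nonneg hγs (mul_nonneg (Real.rpow_nonneg le_rfl _)
              (Real.rpow_nonneg le_rfl _))
      _ = γ ^ s * _ := by rw [Finset.mul_sum]
      _ ≤ γ ^ s * ((2 * Fintype.card ι * ∑ x ∈ Q, f x ^ r) ^ (1 - θ) * sobEnergy t l Q f ^ θ) := by
          refine mul_le_mul_of_nonneg_left ?_ hγs
          refine (sum_rpow_mul_rpow_le _ _ _ ?_ ?_ (by linarith) hθ (by ring)).trans ?_
          · intro b _
            split_ifs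
            · exact le_max_of_le_left (Real.rpow_nonneg (hf _) _)
            · exact le_rfl
          · intro b _
            split_ifs <;> positivity
          · refine mul_le_mul (Real.rpow_le_rpow ?_ (sum_max_le Q (F := fun x => f x ^ r)
              fun x => Real.rpow_nonneg (hf x) _) (by linarith))
              (Real.rpow_le_rpow ?_ (sum_grad_le_sobEnergy hl.le hf Q) hθ) ?_ ?_
            · refine Finset.sum_nonneg fun b _ => ?_
              split_ifs
              · exact le_max_of_le_left (Real.rpow_nonneg (hf _) _)
              · exact le_rfl
            · refine Finset.sum_nonneg fun b _ => ?_
              split_ifs <;> positivity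
            · refine Real.rpow_nonneg (Finset.sum_nonneg fun b _ => ?_) _
              split_ifs <;> positivity
            · positivity
      _ ≤ γ ^ s * ((2 * Fintype.card ι + 1) *
            ((∑ x ∈ Q, f x ^ r) ^ (1 - θ) * sobEnergy t l Q f ^ θ)) := by
          refine mul_le_mul_of_nonneg_left ?_ hγs
          rw [Real.mul_rpow (by positivity) hZ, mul_assoc]
          refine mul_le_mul_of_nonneg_right ?_ (by positivity)
          have hc : (0 : ℝ) ≤ 2 * Fintype.card ι := by positivity
          calc (2 * Fintype.card ι : ℝ) ^ (1 - θ) ≤ (2 * Fintype.card ι + 1 : ℝ) ^ (1 - θ) :=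
                Real.rpow_le_rpow hc (by linarith) (by linarith)
            _ ≤ (2 * Fintype.card ι + 1 : ℝ) ^ (1 : ℝ) :=
                Real.rpow_le_rpow_of_exponent_le (by linarith) (by linarith)
            _ = _ := Real.rpow_one _
      _ = _ := by ring
  calc _ ≤ _ := add_le_add B A
    _ = _ := by ring

/-- The endpoint case with exponent `1`: on each coordinate line a value is at most the average plus
the total variation, and the Loomis–Whitney type inequality combines the lines. The zeroth order
term of the energy replaces a boundary condition. -/
theorem sum_rpow_le_sobEnergy_one {m' : ℝ}
    (hm : Real.HolderConjugate (Fintype.card ι) m') {a b : ι → ℤ} {l : ℝ} (hl : 0 < l)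
    (hab : ∀ j, l ≤ b j - a j + 1) {h : (ι → ℤ) → ℝ} (hh : ∀ x, 0 ≤ h x) :
    ∑ x ∈ Finset.Icc a b, h x ^ m' ≤ sobEnergy 1 l (Finset.Icc a b) h ^ m' := by
  unfold sobEnergy
  refine sum_rpow_le_of_le_sum_line hm a b h _ hh
    (fun x => sobEnergy_term_nonneg hl.le hh _ x) fun x hx j => ?_
  have h1 := le_sum_abs_sub_add_average (fun z => h (Function.update x j z)) (a j) (b j) (x j)
    (fun z => hh _) (by rw [Finset.mem_Icc] at hx ⊢; exact ⟨hx.1 j, hx.2 j⟩) hl (hab j)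
  simp only [Function.update_eq_self] at h1
  refine h1.trans (Finset.sum_le_sum fun z hz => ?_)
  rw [Real.rpow_one]
  refine add_le_add_left ?_ _
  have hup : Function.update x j z + Pi.single j 1 = Function.update x j (z + 1) := by
    ext i; by_cases hi : i = j
    · subst hi; simp
    · simp [hi]
  refine le_trans (le_of_eq ?_) (Finset.single_le_sum (f := fun i =>
    if Function.update x j z + Pi.single i 1 ∈ Finset.Icc a b then
      |h (Function.update x j z + Pi.single i 1) - h (Function.update x j z)| ^ (1 : ℝ) else 0)
    (fun i _ => by split_ifs <;> positivity) (Finset.mem_univ j))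
  simp only [hup, Real.rpow_one]
  have hiff : z + 1 ∈ Finset.Icc (a j) (b j) ↔ Function.update x j (z + 1) ∈ Finset.Icc a b := by
    simp only [Finset.mem_Icc, Pi.le_def] at hx ⊢
    constructor
    · intro hz
      constructor <;> intro i <;> by_cases hi : i = j
      · subst hi; simpa using hz.1
      · simpa [hi] using hx.1 i
      · subst hi; simpa using hz.2
      · simpa [hi] using hx.2 i
    · intro hz
      simpa using And.intro (hz.1 j) (hz.2 j)
  simp only [hiff]

/-- The Sobolev inequality on lattice boxes whose sides are at least `l`. -/
theorem exists_sum_rpow_le_sobEnergy (ι : Type*) [Fintype ι] [DecidableEq ι]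
    (hι : 2 ≤ Fintype.card ι) {s r : ℝ} (hs : 1 ≤ s) (hsm : s < Fintype.card ι)
    (hr : r = s * Fintype.card ι / (Fintype.card ι - s)) :
    ∃ C : ℝ, 0 < C ∧ ∀ (a b : ι → ℤ) (l : ℝ), 0 < l → (∀ j, l ≤ b j - a j + 1) →
      ∀ f : (ι → ℤ) → ℝ, (∀ x, 0 ≤ f x) →
      ∑ x ∈ Finset.Icc a b, f x ^ r ≤ C * sobEnergy s l (Finset.Icc a b) f ^ (r / s) := by
  set m : ℝ := (Fintype.card ι : ℝ) with hm
  have hm2 : (2 : ℝ) ≤ m := by rw [hm]; exact_mod_cast hι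
  have hms : 0 < m - s := by linarith
  -- The power for which the endpoint inequality, applied to `f ^ γ`, has `f ^ r` on the left (`γ *
  -- m' = r`), while Hölder on the right produces the same sum of `f ^ r` (`γ - 1 = r * (1 - 1 /
  -- s)`).
  set γ : ℝ := s * (m - 1) / (m - s) with hγ
  have hγ1 : 1 ≤ γ := by rw [hγ, le_div_iff₀ hms]; nlinarith
  have hr0 : 0 < r := by rw [hr]; exact div_pos (by nlinarith) hms
  set m' : ℝ := m / (m - 1) with hm'
  have hm'0 : 0 < m' := div_pos (by linarith) (by linarith)
  have hconj : Real.HolderConjugate m m' := by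
    rw [Real.holderConjugate_iff]
    refine ⟨by linarith, ?_⟩
    rw [hm']
    have : m - 1 ≠ 0 := by linarith
    have : m ≠ 0 := by linarith
    field_simp
    ring
  set K : ℝ := γ ^ (1 : ℝ) * (2 * m + 1) + 1 with hK
  have hK0 : 0 < K := by
    rw [hK, Real.rpow_one]
    have : 0 ≤ γ * (2 * m + 1) := mul_nonneg (by linarith) (by linarith)
    linarith
  have hs0 : s ≠ 0 := by linarith
  refine ⟨K ^ r, by positivity, fun a b l hl hab f hf => ?_⟩
  set Q := Finset.Icc a b
  set Z := ∑ x ∈ Q, f x ^ r with hZ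
  have hZ0 : 0 ≤ Z := Finset.sum_nonneg fun x _ => Real.rpow_nonneg (hf x) _
  have hT := sobEnergy_nonneg (s := s) hl.le hf Q
  set T := sobEnergy s l Q f with hTdef
  -- The sum `Z` reappears on the right with exponent `1 - 1 / s` and is divided out, so `Z = 0` is
  -- treated apart.
  rcases hZ0.eq_or_lt with h0 | hZpos
  · rw [← h0]; positivity
  have e1 : (1 : ℝ) * (γ - 1) = r * (1 - 1 / s) := by
    rw [hγ, hr]; field_simp; ring
  have hsi : 1 / s ≤ 1 := by rw [div_le_one (by linarith)]; exact hs
  have h1 := sobEnergy_rpow_le (s := 1) (t := s) (r := r) (θ := 1 / s) hl zero_le_one hγ1 hr0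
    (by positivity) hsi e1 (by field_simp) Q hf
  have h2 := sum_rpow_le_sobEnergy_one hconj hl hab (h := fun x => f x ^ γ)
    (fun x => Real.rpow_nonneg (hf x) _)
  have e2 : γ * m' = r := by
    rw [hγ, hr, hm']
    have : m - 1 ≠ 0 := by linarith
    field_simp
  have e3 : ∑ x ∈ Q, (f x ^ γ) ^ m' = Z := by
    refine Finset.sum_congr rfl fun x _ => ?_
    rw [← Real.rpow_mul (hf x), e2]
  rw [e3] at h2
  have h3 : Z ≤ (K * Z ^ (1 - 1 / s) * T ^ (1 / s)) ^ m' :=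
    h2.trans (Real.rpow_le_rpow (sobEnergy_nonneg hl.le (fun x => Real.rpow_nonneg (hf x) _) _)
      h1 hm'0.le)
  have h4 : Z ^ (1 / m') ≤ K * Z ^ (1 - 1 / s) * T ^ (1 / s) := by
    have h5 := Real.rpow_le_rpow hZ0 h3 (by positivity : 0 ≤ 1 / m')
    rwa [← Real.rpow_mul (by positivity), mul_one_div_cancel hm'0.ne', Real.rpow_one] at h5
  have e4 : 1 / m' = 1 / r + (1 - 1 / s) := by
    rw [hm', hr]
    have : m ≠ 0 := by linarith
    field_simp
    ring
  rw [e4, Real.rpow_add hZpos] at h4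
  have h5 : Z ^ (1 / r) ≤ K * T ^ (1 / s) := by
    have : 0 < Z ^ (1 - 1 / s) := Real.rpow_pos_of_pos hZpos _
    refine le_of_mul_le_mul_right (a := Z ^ (1 - 1 / s)) ?_ this
    linarith
  have h6 := Real.rpow_le_rpow (by positivity) h5 hr0.le
  rw [← Real.rpow_mul hZ0, one_div_mul_cancel hr0.ne', Real.rpow_one,
    Real.mul_rpow hK0.le (by positivity), ← Real.rpow_mul hT] at h6
  rwa [one_div_mul_eq_div] at h6

end Sobolev

/-! ### The Caccioppoli inequality for powers of subsolutions -/

/-- The pointwise inequality behind the Caccioppoli estimate for powers. -/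
theorem caccioppoli_pointwise {a b ξ ζ α : ℝ} (ha : 0 ≤ a) (hb : 0 ≤ b) (hξ : 0 ≤ ξ) (hζ : 0 ≤ ζ)
    (hα : 1 ≤ α) :
    1 / α * (min ξ ζ ^ 2 * (a ^ α - b ^ α) ^ 2 / 2 - 3 * ((ξ - ζ) ^ 2 * (a ^ α * b ^ α))) ≤
      (a - b) * (ξ ^ 2 * a ^ (2 * α - 1) - ζ ^ 2 * b ^ (2 * α - 1)) := by
  wlog hab : b ≤ a generalizing a b ξ ζ
  · have := this hb ha hζ hξ (le_of_not_ge hab)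
    rw [min_comm] at this
    linarith
  have hα0 : 0 < α := by linarith
  have e : ∀ c : ℝ, 0 ≤ c → c ^ (2 * α - 1) = c ^ (α - 1) * c ^ α := by
    intro c hc
    rcases hα.eq_or_lt with rfl | hα
    · norm_num
    · rw [← Real.rpow_add' hc (by linarith)]
      ring_nf
  rw [e a ha, e b hb]
  have h1 := mul_rpow_sub_one_mul_sub_le hb ha hα
  have h2 := mul_rpow_sub_one_mul_sub_le ha hb hα
  have hA : b ^ (α - 1) ≤ a ^ (α - 1) := Real.rpow_le_rpow hb hab (by linarith)
  have hpq : b ^ α ≤ a ^ α := Real.rpow_le_rpow hb hab (by linarith)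
  have hB0 : 0 ≤ b ^ (α - 1) := Real.rpow_nonneg hb _
  have hq0 : 0 ≤ b ^ α := Real.rpow_nonneg hb _
  generalize a ^ (α - 1) = A at *
  generalize b ^ (α - 1) = B at *
  generalize a ^ α = p at *
  generalize b ^ α = q at *
  have hmin : min ξ ζ ^ 2 ≤ ξ ^ 2 := by
    have : 0 ≤ min ξ ζ := le_min hξ hζ
    exact pow_le_pow_left₀ this (min_le_left _ _) 2
  have hmD : min ξ ζ ^ 2 * (p - q) ^ 2 ≤ ξ ^ 2 * (p - q) ^ 2 :=
    mul_le_mul_of_nonneg_right hmin (sq_nonneg _)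
  rw [one_div, inv_mul_le_iff₀ hα0]
  have hD : 0 ≤ p - q := sub_nonneg.2 hpq
  -- the good term
  have g1 : (p - q) ^ 2 ≤ α * ((a - b) * (A * p - B * q)) := by
    have : (p - q) * (p - q) ≤ (α * A * (a - b)) * (p - q) :=
      mul_le_mul_of_nonneg_right (by linarith) hD
    have h3 : 0 ≤ α * (a - b) * ((A - B) * q) :=
      mul_nonneg (mul_nonneg hα0.le (sub_nonneg.2 hab)) (mul_nonneg (sub_nonneg.2 hA) hq0)
    nlinarith
  have g2 : ξ ^ 2 * (p - q) ^ 2 ≤ ξ ^ 2 * (α * ((a - b) * (A * p - B * q))) :=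
    mul_le_mul_of_nonneg_left g1 (sq_nonneg _)
  -- the cutoff term
  have g3 : α * B * (a - b) * q ≤ (p - q) * q := mul_le_mul_of_nonneg_right h2 hq0
  have g3' : 0 ≤ α * B * (a - b) * q :=
    mul_nonneg (mul_nonneg (mul_nonneg hα0.le hB0) (sub_nonneg.2 hab)) hq0
  set X := α * B * (a - b) * q with hX
  set e := |ξ - ζ| with he
  have he0 : 0 ≤ e := abs_nonneg _
  have he2 : (ξ - ζ) ^ 2 = e ^ 2 := (sq_abs _).symm
  have g4 : |ξ ^ 2 - ζ ^ 2| ≤ e * (2 * ξ + e) := by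
    have : ξ ^ 2 - ζ ^ 2 = (ξ - ζ) * (ξ + ζ) := by ring
    rw [this, abs_mul, abs_of_nonneg (add_nonneg hξ hζ)]
    refine mul_le_mul_of_nonneg_left ?_ he0
    have := neg_abs_le (ξ - ζ)
    linarith
  have g5 : -(e * (2 * ξ + e) * ((p - q) * q)) ≤ (ξ ^ 2 - ζ ^ 2) * X := by
    have h5 : |(ξ ^ 2 - ζ ^ 2) * X| ≤ e * (2 * ξ + e) * ((p - q) * q) := by
      rw [abs_mul, abs_of_nonneg g3']
      exact mul_le_mul g4 g3 g3' (by positivity)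
    have := neg_abs_le ((ξ ^ 2 - ζ ^ 2) * X)
    linarith
  -- The difference of the cutoffs is made to multiply only the smaller value `b`; the tangent line
  -- at `b` then bounds `X` by `(p - q) * q`, and Young's inequality (`g7`) absorbs half of the good
  -- term. Since `q ≤ p`, what remains is at most `3 * e ^ 2 * (p * q)`.
  have g6 : α * ((a - b) * (ξ ^ 2 * (A * p) - ζ ^ 2 * (B * q))) =
      ξ ^ 2 * (α * ((a - b) * (A * p - B * q))) + (ξ ^ 2 - ζ ^ 2) * X := by
    rw [hX]; ring
  rw [g6, he2]
  have g7 : 0 ≤ (ξ * (p - q) - 2 * (e * q)) ^ 2 := sq_nonneg _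
  have g8 : 0 ≤ e ^ 2 * (q * (2 * p - q)) :=
    mul_nonneg (sq_nonneg _) (mul_nonneg hq0 (by linarith))
  nlinarith

/-- Discrete integration by parts. -/
theorem sum_mul_sub_eq_sum_divStar {d : ℕ} (F : Bond d → ℝ) (ψ : LatticePt d → ℝ)
    (S : Finset (LatticePt d)) (h : ∀ x, ψ x ≠ 0 → x ∈ S ∧ ∀ j, x - Pi.single j 1 ∈ S) :
    ∑ b ∈ S ×ˢ (Finset.univ : Finset (Fin d)), F b * (ψ (b.1 + Pi.single b.2 1) - ψ b.1) =
      ∑ x ∈ S, divStar F x * ψ x := by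
  rw [Finset.sum_product_right]
  simp only [divStar, Finset.sum_mul]
  rw [Finset.sum_comm (s := S)]
  refine Finset.sum_congr rfl fun j _ => ?_
  simp only [mul_sub, sub_mul, Finset.sum_sub_distrib]
  congr 1
  -- Both sums become sums over all of `ℤ^d`, where the shift by `e_j` is a bijection; the support
  -- condition on `ψ` ensures that nothing is lost outside `S`.
  rw [← finsum_eq_sum_of_support_subset, ← finsum_eq_sum_of_support_subset]
  · refine Eq.trans (finsum_congr fun i => ?_)
      (finsum_comp_equiv (Equiv.addRight (Pi.single j 1 : LatticePt d))
        (f := fun x => F (x - Pi.single j 1, j) * ψ x))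
    simp only [Equiv.coe_addRight]
    rw [add_sub_cancel_right]
  · intro x hx
    exact (h x (right_ne_zero_of_mul hx)).1
  · intro x hx
    simpa using (h _ (right_ne_zero_of_mul hx)).2 j

/-- The Caccioppoli inequality for powers of nonnegative subsolutions. -/
theorem caccioppoli {d : ℕ} {ω : Bond d → ℝ} (hω : ∀ b, 0 ≤ ω b) {w : LatticePt d → ℝ}
    (hw : ∀ x, 0 ≤ w x) (hsub : ∀ x, divStar (fun b => ω b * grad w b) x ≤ 0)
    {α : ℝ} (hα : 1 ≤ α) {η : LatticePt d → ℝ} (hη : ∀ x, 0 ≤ η x) (S : Finset (LatticePt d))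
    (h : ∀ x, η x ≠ 0 → x ∈ S ∧ ∀ j, x - Pi.single j 1 ∈ S) :
    ∑ b ∈ S ×ˢ (Finset.univ : Finset (Fin d)), ω b *
      (min (η (b.1 + Pi.single b.2 1)) (η b.1) ^ 2 *
        (w (b.1 + Pi.single b.2 1) ^ α - w b.1 ^ α) ^ 2) ≤
    6 * ∑ b ∈ S ×ˢ (Finset.univ : Finset (Fin d)), ω b *
      ((η (b.1 + Pi.single b.2 1) - η b.1) ^ 2 *
        (w (b.1 + Pi.single b.2 1) ^ α * w b.1 ^ α)) := by
  have hα0 : 0 < α := by linarith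
  have h1 := sum_mul_sub_eq_sum_divStar (fun b => ω b * grad w b)
    (fun x => η x ^ 2 * w x ^ (2 * α - 1)) S
    (fun x hx => h x fun h0 => hx (by simp [h0]))
  have h2 : ∑ x ∈ S, divStar (fun b => ω b * grad w b) x * (η x ^ 2 * w x ^ (2 * α - 1)) ≤ 0 :=
    Finset.sum_nonpos fun x _ => mul_nonpos_of_nonpos_of_nonneg (hsub x)
      (mul_nonneg (sq_nonneg _) (Real.rpow_nonneg (hw x) _))
  rw [← h1] at h2
  have h3 := Finset.sum_le_sum (s := S ×ˢ (Finset.univ : Finset (Fin d))) fun b _ =>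
    mul_le_mul_of_nonneg_left (caccioppoli_pointwise (hw (b.1 + Pi.single b.2 1)) (hw b.1)
      (hη (b.1 + Pi.single b.2 1)) (hη b.1) hα) (hω b)
  have h4 := h3.trans ((le_of_eq (Finset.sum_congr rfl fun b _ => by
    simp only [grad, Bond.upper, Bond.lower]; ring)).trans h2)
  have h5 : ∑ b ∈ S ×ˢ (Finset.univ : Finset (Fin d)), ω b * (1 / α *
      (min (η (b.1 + Pi.single b.2 1)) (η b.1) ^ 2 *
        (w (b.1 + Pi.single b.2 1) ^ α - w b.1 ^ α) ^ 2 / 2 -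
      3 * ((η (b.1 + Pi.single b.2 1) - η b.1) ^ 2 *
        (w (b.1 + Pi.single b.2 1) ^ α * w b.1 ^ α)))) =
      1 / α * ((∑ b ∈ S ×ˢ (Finset.univ : Finset (Fin d)), ω b *
      (min (η (b.1 + Pi.single b.2 1)) (η b.1) ^ 2 *
        (w (b.1 + Pi.single b.2 1) ^ α - w b.1 ^ α) ^ 2)) / 2 -
      3 * ∑ b ∈ S ×ˢ (Finset.univ : Finset (Fin d)), ω b *
      ((η (b.1 + Pi.single b.2 1) - η b.1) ^ 2 *
        (w (b.1 + Pi.single b.2 1) ^ α * w b.1 ^ α))) := by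
    rw [Finset.mul_sum, Finset.sum_div, ← Finset.sum_sub_distrib, Finset.mul_sum]
    refine Finset.sum_congr rfl fun b _ => by ring
  rw [h5] at h4
  have h6 := nonpos_of_mul_nonpos_right h4 (by positivity)
  linarith

/-- The absolute value of a harmonic function is subharmonic. -/
theorem divStar_grad_abs_nonpos {d : ℕ} {ω : Bond d → ℝ} (hω : ∀ b, 0 ≤ ω b) {u : LatticePt d → ℝ}
    {x : LatticePt d} (hu : divStar (fun b => ω b * grad u b) x = 0) :
    divStar (fun b => ω b * grad (fun z => |u z|) b) x ≤ 0 := by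
  -- With `s` a sign of `u x`, the function `s * u` equals `|u|` at `x` and lies below it at the
  -- neighbours, whose values enter `divStar` of the gradient with nonpositive coefficients.
  obtain ⟨s, hs, hsx⟩ : ∃ s : ℝ, |s| ≤ 1 ∧ |u x| = s * u x := by
    rcases le_total 0 (u x) with h | h
    · exact ⟨1, by simp, by simp [abs_of_nonneg h]⟩
    · exact ⟨-1, by simp, by simp [abs_of_nonpos h]⟩
  have hs' : ∀ z, s * u z ≤ |u z| := fun z => by
    refine (le_abs_self _).trans ?_
    rw [abs_mul]
    exact mul_le_of_le_one_left (abs_nonneg _) hs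
  have : s * divStar (fun b => ω b * grad u b) x = 0 := by rw [hu, mul_zero]
  rw [← this]
  unfold divStar
  rw [Finset.mul_sum]
  refine Finset.sum_le_sum fun j _ => ?_
  simp only [grad, Bond.upper, Bond.lower, sub_add_cancel]
  have h1 := mul_le_mul_of_nonneg_left (hs' (x - Pi.single j 1)) (hω (x - Pi.single j 1, j))
  have h2 := mul_le_mul_of_nonneg_left (hs' (x + Pi.single j 1)) (hω (x, j))
  rw [hsx]
  linarith

/-! ### Cutoffs that jump only across prescribed hyperplanes -/

/-- The fraction of points of `G` lying strictly below `z`. -/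
noncomputable def cutRatio (G : Finset ℤ) (z : ℤ) : ℝ :=
  ((G.filter (· < z)).card : ℝ) / G.card

theorem cutRatio_nonneg (G : Finset ℤ) (z : ℤ) : 0 ≤ cutRatio G z := by
  unfold cutRatio; positivity

theorem cutRatio_le_one (G : Finset ℤ) (z : ℤ) : cutRatio G z ≤ 1 :=
  div_le_one_of_le₀ (by exact_mod_cast Finset.card_filter_le _ _) (by positivity)

theorem cutRatio_eq_one {G : Finset ℤ} (hG : G.Nonempty) {z : ℤ} (h : ∀ g ∈ G, g < z) :
    cutRatio G z = 1 := by
  rw [cutRatio, Finset.filter_true_of_mem h, div_self]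
  exact_mod_cast hG.card_pos.ne'

theorem cutRatio_eq_zero {G : Finset ℤ} {z : ℤ} (h : ∀ g ∈ G, z ≤ g) : cutRatio G z = 0 := by
  rw [cutRatio, Finset.filter_false_of_mem fun g hg => not_lt.2 (h g hg)]
  simp

theorem cutRatio_add_one_sub (G : Finset ℤ) (z : ℤ) :
    cutRatio G (z + 1) - cutRatio G z = if z ∈ G then (G.card : ℝ)⁻¹ else 0 := by
  have h : G.filter (· < z + 1) = G.filter (· < z) ∪ G.filter (· = z) := by
    ext g; simp only [Finset.mem_filter, Finset.mem_union, Int.lt_add_one_iff, le_iff_lt_or_eq]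
    tauto
  rw [cutRatio, cutRatio, h, Finset.card_union_of_disjoint, Finset.filter_eq']
  · split_ifs <;> simp [add_div]
  · rw [Finset.disjoint_filter]
    intro g _ h1 h2
    omega

/-- A one-dimensional cutoff function, equal to `1` near `0`, whose jumps are spread evenly over
`Gm` on the negative side and over `Gp` on the positive side. -/
noncomputable def cutProfile (Gm Gp : Finset ℤ) (z : ℤ) : ℝ := cutRatio Gm z - cutRatio Gp z

section cutProfile

variable {Gm Gp : Finset ℤ} {ρ σ : ℕ}

theorem cutProfile_eq_one (hm : Gm.Nonempty) (hGm : Gm ⊆ Finset.Ico (-(σ : ℤ)) (-ρ))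
    (hGp : Gp ⊆ Finset.Ico (ρ : ℤ) σ) {z : ℤ} (hz : |z| ≤ ρ) : cutProfile Gm Gp z = 1 := by
  rw [abs_le] at hz
  rw [cutProfile, cutRatio_eq_one hm, cutRatio_eq_zero, sub_zero]
  · intro g hg
    have := Finset.mem_Ico.1 (hGp hg)
    omega
  · intro g hg
    have := Finset.mem_Ico.1 (hGm hg)
    omega

theorem cutProfile_eq_zero (hm : Gm.Nonempty) (hp : Gp.Nonempty)
    (hGm : Gm ⊆ Finset.Ico (-(σ : ℤ)) (-ρ))
    (hGp : Gp ⊆ Finset.Ico (ρ : ℤ) σ) {z : ℤ} (hz : (σ : ℤ) ≤ |z|) : cutProfile Gm Gp z = 0 := by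
  rw [cutProfile]
  rcases le_abs.1 hz with h | h
  · rw [cutRatio_eq_one hm, cutRatio_eq_one hp, sub_self]
    · intro g hg
      have := Finset.mem_Ico.1 (hGp hg)
      omega
    · intro g hg
      have := Finset.mem_Ico.1 (hGm hg)
      omega
  · rw [cutRatio_eq_zero, cutRatio_eq_zero, sub_self]
    · intro g hg
      have := Finset.mem_Ico.1 (hGp hg)
      omega
    · intro g hg
      have := Finset.mem_Ico.1 (hGm hg)
      omega

theorem cutProfile_mem (hm : Gm.Nonempty) (hGm : Gm ⊆ Finset.Ico (-(σ : ℤ)) (-ρ))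
    (hGp : Gp ⊆ Finset.Ico (ρ : ℤ) σ) (z : ℤ) :
    0 ≤ cutProfile Gm Gp z ∧ cutProfile Gm Gp z ≤ 1 := by
  have h1 := cutRatio_le_one Gm z
  have h2 := cutRatio_nonneg Gm z
  have h3 := cutRatio_le_one Gp z
  have h4 := cutRatio_nonneg Gp z
  rw [cutProfile]
  refine ⟨?_, by linarith⟩
  rcases le_total z ρ with h | h
  · rw [cutRatio_eq_zero (G := Gp)]
    · linarith
    · intro g hg
      have := Finset.mem_Ico.1 (hGp hg)
      omega
  · rw [cutRatio_eq_one hm]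
    · linarith
    · intro g hg
      have := Finset.mem_Ico.1 (hGm hg)
      omega

/-- The profile changes by `1 / card` exactly when passing from a selected point to its successor.
Summed against a function bounded by `K` on the selected set, the squared jumps therefore cost `K /
card`. -/
theorem cutProfile_sub_sq_le (Gm Gp : Finset ℤ) (z : ℤ) :
    (cutProfile Gm Gp (z + 1) - cutProfile Gm Gp z) ^ 2 ≤
      2 * ((if z ∈ Gm then ((Gm.card : ℝ) ^ 2)⁻¹ else 0) +
        (if z ∈ Gp then ((Gp.card : ℝ) ^ 2)⁻¹ else 0)) := by
  have h : cutProfile Gm Gp (z + 1) - cutProfile Gm Gp z =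
      (if z ∈ Gm then (Gm.card : ℝ)⁻¹ else 0) - (if z ∈ Gp then (Gp.card : ℝ)⁻¹ else 0) := by
    rw [← cutRatio_add_one_sub, ← cutRatio_add_one_sub, cutProfile, cutProfile]; ring
  have e : ∀ G : Finset ℤ, (if z ∈ G then ((G.card : ℝ) ^ 2)⁻¹ else 0) =
      (if z ∈ G then (G.card : ℝ)⁻¹ else 0) ^ 2 := by
    intro G; split_ifs <;> simp
  rw [h, e, e]
  nlinarith [sq_nonneg ((if z ∈ Gm then (Gm.card : ℝ)⁻¹ else 0) +
    (if z ∈ Gp then (Gp.card : ℝ)⁻¹ else 0))]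

end cutProfile

/-- The interaction `∑ ω v(x) v(x + e_j)` over the bonds of `S` in direction `j` that cross from
`x j = r` to `x j = r + 1`. -/
noncomputable def crossSum {d : ℕ} (ω : Bond d → ℝ) (v : LatticePt d → ℝ)
    (S : Finset (LatticePt d)) (j : Fin d) (r : ℤ) : ℝ :=
  ∑ x ∈ S, if x j = r then
    (if x + Pi.single j 1 ∈ S then ω (x, j) * (v x * v (x + Pi.single j 1)) else 0) else 0

theorem mem_box_add_single {d : ℕ} {y x : LatticePt d} {n : ℕ} {j : Fin d} (hx : x ∈ box y n)
    (h : x j - y j < n) : x + Pi.single j 1 ∈ box y n := by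
  rw [mem_box] at hx ⊢
  intro i
  have := hx i
  rw [abs_le] at this ⊢
  by_cases hi : i = j
  · subst hi; simp; omega
  · simpa [hi] using this

theorem sum_slices_le {d : ℕ} (S : Finset (LatticePt d)) (j : Fin d) (G : Finset ℤ) (c : ℤ)
    {F : LatticePt d → ℝ} (hF : ∀ x ∈ S, 0 ≤ F x) :
    ∑ r ∈ G, ∑ x ∈ S, (if x j = c + r then F x else 0) ≤ ∑ x ∈ S, F x := by
  rw [Finset.sum_comm]
  refine Finset.sum_le_sum fun x hx => ?_
  have : ∀ r, (if x j = c + r then F x else 0) = if x j - c = r then F x else 0 := by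
    intro r
    congr 1
    exact propext ⟨fun h => by omega, fun h => by omega⟩
  simp only [this, Finset.sum_ite_eq]
  split_ifs
  · exact le_rfl
  · exact hF x hx

theorem sum_slices_eq {d : ℕ} (S : Finset (LatticePt d)) (j : Fin d) (G : Finset ℤ) (c : ℤ)
    (F : LatticePt d → ℝ) :
    ∑ r ∈ G, ∑ x ∈ S, (if x j = c + r then F x else 0) =
      ∑ x ∈ S, if x j - c ∈ G then F x else 0 := by
  rw [Finset.sum_comm]
  refine Finset.sum_congr rfl fun x hx => ?_
  have : ∀ r, (if x j = c + r then F x else 0) = if x j - c = r then F x else 0 := by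
    intro r
    congr 1
    exact propext ⟨fun h => by omega, fun h => by omega⟩
  simp only [this, Finset.sum_ite_eq]

/-- The Caccioppoli inequality with a product cutoff, the jumps of which are spread evenly over
prescribed sets of hyperplanes. -/
theorem caccioppoli_cut {d : ℕ} {ω : Bond d → ℝ} (hω : ∀ b, 0 ≤ ω b) {w : LatticePt d → ℝ}
    (hw : ∀ x, 0 ≤ w x) (hsub : ∀ x, divStar (fun b => ω b * grad w b) x ≤ 0)
    {α : ℝ} (hα : 1 ≤ α) (y : LatticePt d) (ρ σ : ℕ) (hρσ : ρ ≤ σ) (Gm Gp : Fin d → Finset ℤ)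
    (hm : ∀ j, (Gm j).Nonempty) (hp : ∀ j, (Gp j).Nonempty)
    (hGm : ∀ j, Gm j ⊆ Finset.Ico (-(σ : ℤ)) (-ρ)) (hGp : ∀ j, Gp j ⊆ Finset.Ico (ρ : ℤ) σ) :
    ∑ b ∈ box y ρ ×ˢ (Finset.univ : Finset (Fin d)), (if b.1 + Pi.single b.2 1 ∈ box y ρ then
      ω b * (w (b.1 + Pi.single b.2 1) ^ α - w b.1 ^ α) ^ 2 else 0) ≤
    12 * ∑ j, (((Gm j).card : ℝ)⁻¹ ^ 2 *
        ∑ r ∈ Gm j, crossSum ω (fun x => w x ^ α) (box y σ) j (y j + r) +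
      ((Gp j).card : ℝ)⁻¹ ^ 2 *
        ∑ r ∈ Gp j, crossSum ω (fun x => w x ^ α) (box y σ) j (y j + r)) := by
  set φ : Fin d → ℤ → ℝ := fun j => cutProfile (Gm j) (Gp j)
  set η : LatticePt d → ℝ := fun x => ∏ j, φ j (x j - y j) with hη
  have hφ0 : ∀ j z, 0 ≤ φ j z := fun j z => (cutProfile_mem (hm j) (hGm j) (hGp j) z).1
  have hφ1 : ∀ j z, φ j z ≤ 1 := fun j z => (cutProfile_mem (hm j) (hGm j) (hGp j) z).2
  have hη0 : ∀ x, 0 ≤ η x := fun x => Finset.prod_nonneg fun j _ => hφ0 _ _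
  have hηone : ∀ x ∈ box y ρ, η x = 1 := fun x hx => Finset.prod_eq_one fun j _ =>
    cutProfile_eq_one (hm j) (hGm j) (hGp j) ((mem_box y x ρ).1 hx j)
  have hvan : ∀ j z, (σ : ℤ) ≤ |z| → φ j z = 0 := fun j z hz =>
    cutProfile_eq_zero (hm j) (hp j) (hGm j) (hGp j) hz
  have hsupp : ∀ x, η x ≠ 0 → x ∈ box y σ ∧ ∀ j, x - Pi.single j 1 ∈ box y σ := by
    intro x hx
    have h1 : ∀ j, |x j - y j| < σ := by
      intro j
      by_contra hcon
      exact hx (Finset.prod_eq_zero (Finset.mem_univ j) (hvan j _ (not_lt.1 hcon)))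
    refine ⟨(mem_box _ _ _).2 fun i => (h1 i).le, fun j => (mem_box _ _ _).2 fun i => ?_⟩
    have := h1 i
    rw [abs_lt] at this
    rw [abs_le]
    by_cases hi : i = j
    · subst hi; simp; omega
    · simp [hi]; omega
  -- A step in direction `j` alters only the `j`-th factor of the product, and the other factors lie
  -- in `[0, 1]`.
  have hdiff : ∀ x j, (η (x + Pi.single j 1) - η x) ^ 2 ≤
      (φ j (x j - y j + 1) - φ j (x j - y j)) ^ 2 := by
    intro x j
    have e1 : η x = φ j (x j - y j) * ∏ i ∈ Finset.univ.erase j, φ i (x i - y i) :=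
      (Finset.mul_prod_erase _ _ (Finset.mem_univ j)).symm
    have e2 : η (x + Pi.single j 1) =
        φ j (x j - y j + 1) * ∏ i ∈ Finset.univ.erase j, φ i (x i - y i) := by
      rw [hη]
      simp only
      rw [← Finset.mul_prod_erase _ _ (Finset.mem_univ j)]
      congr 1
      · simp only [Pi.add_apply, Pi.single_eq_same]
        congr 1; ring
      · refine Finset.prod_congr rfl fun i hi => ?_
        simp [Finset.ne_of_mem_erase hi]
    rw [e1, e2, ← sub_mul, mul_pow]
    refine mul_le_of_le_one_right (sq_nonneg _) (pow_le_one₀ ?_ ?_)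
    · exact Finset.prod_nonneg fun i _ => hφ0 _ _
    · exact Finset.prod_le_one (fun i _ => hφ0 _ _) fun i _ => hφ1 _ _
  have hv : ∀ x, 0 ≤ w x ^ α := fun x => Real.rpow_nonneg (hw x) _
  have main := caccioppoli hω hw hsub hα hη0 (box y σ) hsupp
  have hsubset : box y ρ ⊆ box y σ := by
    intro x hx
    rw [mem_box] at hx ⊢
    exact fun i => (hx i).trans (by exact_mod_cast hρσ)
  refine le_trans ?_ (main.trans ?_)
  · refine (Finset.sum_le_sum fun b hb1 => ?_).trans (Finset.sum_le_sum_of_subset_of_nonneg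
      (Finset.product_subset_product_left hsubset) fun b _ _ =>
        mul_nonneg (hω b) (mul_nonneg (sq_nonneg _) (sq_nonneg _)))
    split_ifs with hb
    · rw [hηone _ hb, hηone _ (Finset.mem_product.1 hb1).1]; simp
    · exact mul_nonneg (hω b) (mul_nonneg (sq_nonneg _) (sq_nonneg _))
  · rw [show (12 : ℝ) = 6 * 2 by norm_num, mul_assoc]
    refine mul_le_mul_of_nonneg_left ?_ (by norm_num)
    rw [Finset.sum_product_right, Finset.mul_sum]
    refine Finset.sum_le_sum fun j _ => ?_
    unfold crossSum
    rw [sum_slices_eq, sum_slices_eq, Finset.mul_sum, Finset.mul_sum, ← Finset.sum_add_distrib,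
      Finset.mul_sum]
    refine Finset.sum_le_sum fun x hx => ?_
    by_cases hxj : x + Pi.single j 1 ∈ box y σ
    · have h0 : 0 ≤ ω (x, j) * (w x ^ α * w (x + Pi.single j 1) ^ α) :=
        mul_nonneg (hω _) (mul_nonneg (hv _) (hv _))
      have h1 := (hdiff x j).trans (cutProfile_sub_sq_le (Gm j) (Gp j) (x j - y j))
      have h2 := mul_le_mul_of_nonneg_left h1 h0
      rw [if_pos hxj]
      refine (le_of_eq (by ring)).trans (h2.trans (le_of_eq ?_))
      split_ifs <;> ring
    -- A bond leaving the large box is not counted by `crossSum`; it starts on the outer face, where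
    -- the cutoff vanishes at both ends.
    · have hge : (σ : ℤ) ≤ x j - y j := by
        by_contra hcon
        exact hxj (mem_box_add_single hx (not_le.1 hcon))
      have h1 : φ j (x j - y j) = 0 := hvan j _ (hge.trans (le_abs_self _))
      have h2 : φ j (x j - y j + 1) = 0 :=
        hvan j _ (le_trans (by omega) (le_abs_self _))
      have h3 := hdiff x j
      rw [h1, h2, sub_zero] at h3
      have h4 : (η (x + Pi.single j 1) - η x) ^ 2 = 0 :=
        le_antisymm (by simpa using h3) (sq_nonneg _)
      simp [hxj, h4]

/-! ### The Sobolev inequality on hyperplane slices -/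

/-- The density of `sobEnergy`. -/
noncomputable def sobDensity {ι : Type*} [Fintype ι] [DecidableEq ι] (s l : ℝ)
    (Q : Finset (ι → ℤ)) (f : (ι → ℤ) → ℝ) (x : ι → ℤ) : ℝ :=
  ∑ j, (if x + Pi.single j 1 ∈ Q then |f (x + Pi.single j 1) - f x| ^ s else 0) + (f x / l) ^ s

theorem sum_sobDensity {ι : Type*} [Fintype ι] [DecidableEq ι] (s l : ℝ)
    (Q : Finset (ι → ℤ)) (f : (ι → ℤ) → ℝ) : ∑ x ∈ Q, sobDensity s l Q f x = sobEnergy s l Q f :=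
  rfl

theorem sobDensity_nonneg {ι : Type*} [Fintype ι] [DecidableEq ι] {s l : ℝ} (hl : 0 ≤ l)
    {f : (ι → ℤ) → ℝ} (hf : ∀ x, 0 ≤ f x) (Q : Finset (ι → ℤ)) (x : ι → ℤ) :
    0 ≤ sobDensity s l Q f x :=
  sobEnergy_term_nonneg hl hf Q x

/-- The point with `j`-th coordinate `r` and the other coordinates given by `x`. -/
def insertCoord {d : ℕ} (j : Fin d) (r : ℤ) (x : {i : Fin d // i ≠ j} → ℤ) : LatticePt d :=
  fun i => if h : i = j then r else x ⟨i, h⟩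

theorem insertCoord_mem_box {d : ℕ} {j : Fin d} {r : ℤ} {y : LatticePt d} {σ : ℕ}
    (hr : |r - y j| ≤ σ) (x : {i : Fin d // i ≠ j} → ℤ) :
    insertCoord j r x ∈ box y σ ↔
      x ∈ Finset.Icc (fun i => y i.1 - (σ : ℤ)) (fun i => y i.1 + (σ : ℤ)) := by
  rw [mem_box, Finset.mem_Icc, Pi.le_def, Pi.le_def, ← forall_and]
  constructor
  · intro h i
    have := h i.1
    rw [insertCoord, dif_neg i.2, abs_le, Subtype.coe_eta] at this
    constructor <;> simp <;> omega
  · intro h i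
    rw [insertCoord]
    split_ifs with hi
    · subst hi; exact hr
    · have := h ⟨i, hi⟩
      simp only at this
      rw [abs_le]
      omega

theorem insertCoord_add_single {d : ℕ} {j : Fin d} {r : ℤ} (x : {i : Fin d // i ≠ j} → ℤ)
    (i : {i : Fin d // i ≠ j}) :
    insertCoord j r (x + Pi.single i 1) = insertCoord j r x + Pi.single i.1 1 := by
  ext k
  simp only [insertCoord, Pi.add_apply]
  by_cases hk : k = j
  · subst hk
    simp [i.2.symm]
  · rw [dif_neg hk, dif_neg hk]
    by_cases hki : k = i.1
    · subst hki; simp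
    · have : (⟨k, hk⟩ : {i : Fin d // i ≠ j}) ≠ i := fun h => hki (congrArg Subtype.val h)
      simp [hki, this]

theorem sum_slice_eq {d : ℕ} {j : Fin d} {r : ℤ} {y : LatticePt d} {σ : ℕ}
    (hr : |r - y j| ≤ σ) (F : LatticePt d → ℝ) :
    ∑ x ∈ box y σ, (if x j = r then F x else 0) =
      ∑ x ∈ Finset.Icc (fun i : {i : Fin d // i ≠ j} => y i.1 - (σ : ℤ))
        (fun i => y i.1 + (σ : ℤ)), F (insertCoord j r x) := by
  have hinv : ∀ x : LatticePt d, x j = r → insertCoord j r (fun i => x i.1) = x := by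
    intro x hx
    ext i
    rw [insertCoord]
    split_ifs with h
    · rw [h, hx]
    · rfl
  rw [← Finset.sum_filter]
  refine Finset.sum_nbij' (fun x i => x i.1) (insertCoord j r) ?_ ?_ ?_ ?_ ?_
  · intro x hx
    rw [Finset.mem_filter] at hx
    rw [← insertCoord_mem_box hr, hinv x hx.2]
    exact hx.1
  · intro x hx
    rw [Finset.mem_filter]
    exact ⟨(insertCoord_mem_box hr x).2 hx, by simp [insertCoord]⟩
  · intro x hx
    exact hinv x (Finset.mem_filter.1 hx).2
  · intro x hx
    ext i
    simp [insertCoord, i.2]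
  · intro x hx
    rw [hinv x (Finset.mem_filter.1 hx).2]

/-- The Sobolev inequality on the slices of a box, with the exponent of dimension `d - 1`. -/
theorem exists_slice_sobolev {d : ℕ} (hd : 3 ≤ d) {s r : ℝ} (hs : 1 ≤ s) (hsm : s < (d : ℝ) - 1)
    (hr : r = s * ((d : ℝ) - 1) / ((d : ℝ) - 1 - s)) :
    ∃ C : ℝ, 0 < C ∧ ∀ (y : LatticePt d) (σ : ℕ) (l : ℝ), 0 < l → l ≤ 2 * σ + 1 →
      ∀ f : LatticePt d → ℝ, (∀ x, 0 ≤ f x) → ∀ (j : Fin d) (k : ℤ),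
      ∑ x ∈ box y σ, (if x j = k then f x ^ r else 0) ≤
        C * (∑ x ∈ box y σ, if x j = k then sobDensity s l (box y σ) f x else 0) ^ (r / s) := by
  have hr0 : 0 < r := by
    rw [hr]; exact div_pos (mul_pos (by linarith) (by linarith)) (by linarith)
  have hcard : ∀ j : Fin d, Fintype.card {i : Fin d // i ≠ j} = d - 1 := by
    intro j
    rw [Fintype.card_subtype_compl]
    simp
  have hcardR : ∀ j : Fin d, (Fintype.card {i : Fin d // i ≠ j} : ℝ) = (d : ℝ) - 1 := by
    intro j
    rw [hcard, Nat.cast_sub (by omega)]; simp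
  have H : ∀ j : Fin d, _ := fun j => exists_sum_rpow_le_sobEnergy {i : Fin d // i ≠ j}
    (by rw [hcard]; omega) (s := s) (r := r) hs (by rw [hcardR]; exact hsm)
    (by rw [hcardR]; exact hr)
  choose C hC0 hC using H
  have hd0 : Nonempty (Fin d) := ⟨⟨0, by omega⟩⟩
  -- The slices orthogonal to different directions are indexed by different types, each with its own
  -- constant; the sum dominates them all.
  refine ⟨∑ j, C j, Finset.sum_pos (fun j _ => hC0 j) Finset.univ_nonempty, ?_⟩
  intro y σ l hl hlσ f hf j k
  have hD : 0 ≤ ∑ x ∈ box y σ, if x j = k then sobDensity s l (box y σ) f x else 0 :=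
    Finset.sum_nonneg fun x _ => by
      split_ifs
      · exact sobDensity_nonneg hl.le hf _ x
      · exact le_rfl
  by_cases hk : |k - y j| ≤ σ
  · rw [sum_slice_eq hk, sum_slice_eq hk]
    rw [sum_slice_eq hk] at hD
    have h1 := hC j (fun i => y i.1 - (σ : ℤ)) (fun i => y i.1 + (σ : ℤ)) l hl
      (fun i => by push_cast; linarith) (fun x => f (insertCoord j k x)) (fun x => hf _)
    refine h1.trans (mul_le_mul (Finset.single_le_sum (fun j _ => (hC0 j).le) (Finset.mem_univ j))
      (Real.rpow_le_rpow (sobEnergy_nonneg hl.le (fun x => hf _) _) ?_ (by positivity))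
      (Real.rpow_nonneg (sobEnergy_nonneg hl.le (fun x => hf _) _) _)
      (Finset.sum_nonneg fun j _ => (hC0 j).le))
    refine Finset.sum_le_sum fun x _ => ?_
    unfold sobDensity
    refine add_le_add_left ?_ _
    simp only [← insertCoord_mem_box hk, insertCoord_add_single]
    refine (Finset.sum_map Finset.univ (Function.Embedding.subtype fun i => i ≠ j)
      (fun i => if insertCoord j k x + Pi.single i 1 ∈ box y σ then
        |f (insertCoord j k x + Pi.single i 1) - f (insertCoord j k x)| ^ s else 0)).ge.trans ?_
    refine Finset.sum_le_sum_of_subset_of_nonneg (Finset.subset_univ _) fun i _ _ => ?_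
    split_ifs <;> positivity
  · rw [Finset.sum_eq_zero]
    · exact mul_nonneg (Finset.sum_nonneg fun j _ => (hC0 j).le) (Real.rpow_nonneg hD _)
    · intro x hx
      rw [if_neg]
      rintro rfl
      exact hk ((mem_box _ _ _).1 hx j)

/-! ### The cutoff adapted to the weight and the subsolution -/

/-- Hölder on a single layer of bonds with exponents `P + (1 - P) = 1`. The product of `v` at the
two ends is at most the square of the larger value, so both bounding hyperplanes, `r` and `r + 1`,
appear. -/
theorem crossSum_le {d : ℕ} {ω a : Bond d → ℝ} {v : LatticePt d → ℝ} (hv : ∀ x, 0 ≤ v x)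
    (ha : ∀ b, 0 ≤ a b) {A P : ℝ} (hA : 0 ≤ A) (hP : 0 ≤ P) (hP1 : P < 1)
    (S : Finset (LatticePt d))
    (hω : ∀ b : Bond d, b.1 ∈ S → b.1 + Pi.single b.2 1 ∈ S → ω b ≤ A * a b ^ P)
    (j : Fin d) (r : ℤ) :
    crossSum ω v S j r ≤ A * (∑ x ∈ S, if x j = r then
        (if x + Pi.single j 1 ∈ S then a (x, j) else 0) else 0) ^ P *
      (∑ x ∈ S, (if x j = r then v x ^ (2 / (1 - P)) else 0) +
        ∑ x ∈ S, (if x j = r + 1 then v x ^ (2 / (1 - P)) else 0)) ^ (1 - P) := by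
  have hP' : 0 < 1 - P := by linarith
  set S' := (S.filter fun x => x j = r).filter fun x => x + Pi.single j 1 ∈ S with hS'
  have hmem : ∀ x ∈ S', x ∈ S ∧ x j = r ∧ x + Pi.single j 1 ∈ S := by
    intro x hx
    simp only [hS', Finset.mem_filter] at hx
    exact ⟨hx.1.1, hx.1.2, hx.2⟩
  have e1 : ∀ F : LatticePt d → ℝ, (∑ x ∈ S, if x j = r then
      (if x + Pi.single j 1 ∈ S then F x else 0) else 0) = ∑ x ∈ S', F x := by
    intro F
    rw [hS', Finset.sum_filter, Finset.sum_filter]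
  unfold crossSum
  rw [e1, e1 fun x => a (x, j)]
  have hvv : ∀ x, 0 ≤ v x * v (x + Pi.single j 1) := fun x => mul_nonneg (hv _) (hv _)
  calc ∑ x ∈ S', ω (x, j) * (v x * v (x + Pi.single j 1))
      ≤ ∑ x ∈ S', A * (a (x, j) ^ P *
          ((v x * v (x + Pi.single j 1)) ^ (1 / (1 - P))) ^ (1 - P)) := by
        refine Finset.sum_le_sum fun x hx => ?_
        obtain ⟨h1, -, h3⟩ := hmem x hx
        rw [← Real.rpow_mul (hvv x), one_div_mul_cancel hP'.ne', Real.rpow_one, ← mul_assoc A]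
        exact mul_le_mul_of_nonneg_right (hω (x, j) h1 h3) (hvv x)
    _ = A * ∑ x ∈ S', a (x, j) ^ P *
          ((v x * v (x + Pi.single j 1)) ^ (1 / (1 - P))) ^ (1 - P) := by rw [Finset.mul_sum]
    _ ≤ A * ((∑ x ∈ S', a (x, j)) ^ P *
          (∑ x ∈ S', (v x * v (x + Pi.single j 1)) ^ (1 / (1 - P))) ^ (1 - P)) :=
        mul_le_mul_of_nonneg_left (sum_rpow_mul_rpow_le S' _ _ (fun x _ => ha _)
          (fun x _ => Real.rpow_nonneg (hvv x) _) hP hP'.le (by ring)) hA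
    _ ≤ _ := by
        rw [← mul_assoc]
        refine mul_le_mul_of_nonneg_left (Real.rpow_le_rpow (Finset.sum_nonneg fun x _ =>
          Real.rpow_nonneg (hvv x) _) ?_ hP'.le)
          (mul_nonneg hA (Real.rpow_nonneg (Finset.sum_nonneg fun x _ => ha _) _))
        have hpt : ∀ x, (v x * v (x + Pi.single j 1)) ^ (1 / (1 - P)) ≤
            v x ^ (2 / (1 - P)) + v (x + Pi.single j 1) ^ (2 / (1 - P)) := by
          intro x
          have e : ∀ c : ℝ, 0 ≤ c → (c * c) ^ (1 / (1 - P)) = c ^ (2 / (1 - P)) := by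
            intro c hc
            rw [← sq, ← Real.rpow_natCast, ← Real.rpow_mul hc]
            congr 1; push_cast; ring
          have hp0 : 0 ≤ 1 / (1 - P) := by positivity
          have i1 : 0 ≤ v x ^ (2 / (1 - P)) := Real.rpow_nonneg (hv _) _
          have i2 : 0 ≤ v (x + Pi.single j 1) ^ (2 / (1 - P)) := Real.rpow_nonneg (hv _) _
          rcases le_total (v x) (v (x + Pi.single j 1)) with h | h
          · have := Real.rpow_le_rpow (hvv x) (mul_le_mul_of_nonneg_right h (hv _)) hp0
            rw [e _ (hv _)] at this
            linarith
          · have := Real.rpow_le_rpow (hvv x) (mul_le_mul_of_nonneg_left h (hv _)) hp0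
            rw [e _ (hv _)] at this
            linarith
        refine (Finset.sum_le_sum fun x _ => hpt x).trans ?_
        rw [Finset.sum_add_distrib]
        refine add_le_add ?_ ?_
        · rw [← Finset.sum_filter]
          exact Finset.sum_le_sum_of_subset_of_nonneg (Finset.filter_subset _ _)
            fun x _ _ => Real.rpow_nonneg (hv _) _
        · have h1 := sum_upper_le S (F := fun x => if x j = r + 1 then v x ^ (2 / (1 - P)) else 0)
            (fun x => by split_ifs; exacts [Real.rpow_nonneg (hv _) _, le_rfl]) j
          refine le_trans (le_of_eq ?_) h1
          rw [← e1]
          refine Finset.sum_congr rfl fun x _ => ?_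
          simp only [Pi.add_apply, Pi.single_eq_same, add_left_inj]
          split_ifs <;> rfl

/-- Two nonnegative functions are simultaneously at most three times their averages on at least
a third of the points. -/
theorem exists_good_subset (I : Finset ℤ) (hI : I.Nonempty) {f g : ℤ → ℝ}
    (hf : ∀ r, 0 ≤ f r) (hg : ∀ r, 0 ≤ g r) {Sf Sg : ℝ} (hSf : ∑ r ∈ I, f r ≤ Sf)
    (hSg : ∑ r ∈ I, g r ≤ Sg) :
    ∃ G ⊆ I, G.Nonempty ∧ (I.card : ℝ) ≤ 3 * G.card ∧
      ∀ r ∈ G, f r ≤ 3 * Sf / I.card ∧ g r ≤ 3 * Sg / I.card := by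
  have hc : (0 : ℝ) < I.card := by exact_mod_cast hI.card_pos
  -- Markov's inequality: each function exceeds three times its average on at most a third of `I`,
  -- so two such exceptional sets leave at least a third.
  have bad : ∀ (f : ℤ → ℝ) (S : ℝ), (∀ r, 0 ≤ f r) → ∑ r ∈ I, f r ≤ S →
      3 * ((I.filter fun r => ¬ f r ≤ 3 * S / I.card).card : ℝ) ≤ I.card := by
    intro f S hf hS
    set B := I.filter fun r => ¬ f r ≤ 3 * S / I.card with hB
    have hB0 : ∑ r ∈ B, f r ≤ S :=
      (Finset.sum_le_sum_of_subset_of_nonneg (Finset.filter_subset _ _) fun r _ _ => hf r).trans hS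
    have h1 : ∀ r ∈ B, 3 * S / I.card < f r := fun r hr => not_le.1 (Finset.mem_filter.1 hr).2
    have hS0 : 0 ≤ S := (Finset.sum_nonneg fun r _ => hf r).trans hS
    by_contra hcon
    rw [not_le] at hcon
    have hBne : B.Nonempty := by
      rw [← Finset.card_pos]
      by_contra h0
      have : B.card = 0 := by omega
      rw [this] at hcon
      simp at hcon
      linarith
    have h2 : ∑ r ∈ B, 3 * S / (I.card : ℝ) < ∑ r ∈ B, f r :=
      Finset.sum_lt_sum_of_nonempty hBne h1
    rw [Finset.sum_const, nsmul_eq_mul] at h2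
    have h3 : S ≤ B.card * (3 * S / I.card) := by
      rw [mul_div_assoc', le_div_iff₀ hc]
      nlinarith
    linarith
  have b1 := bad f Sf hf hSf
  have b2 := bad g Sg hg hSg
  set G := I.filter fun r => f r ≤ 3 * Sf / I.card ∧ g r ≤ 3 * Sg / I.card with hG
  have hcard : (I.card : ℝ) ≤ 3 * G.card := by
    have hsub : I ⊆ G ∪ ((I.filter fun r => ¬ f r ≤ 3 * Sf / I.card) ∪
        (I.filter fun r => ¬ g r ≤ 3 * Sg / I.card)) := by
      intro r hr
      simp only [hG, Finset.mem_union, Finset.mem_filter]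
      tauto
    have h1 := (Finset.card_le_card hsub).trans ((Finset.card_union_le _ _).trans
      (Nat.add_le_add_left (Finset.card_union_le _ _) _))
    have h2 : (I.card : ℝ) ≤ _ := Nat.cast_le.2 h1
    push_cast at h2
    linarith
  refine ⟨G, Finset.filter_subset _ _, ?_, hcard, fun r hr => (Finset.mem_filter.1 hr).2⟩
  rw [← Finset.card_pos]
  by_contra h0
  have : G.card = 0 := by omega
  rw [this] at hcard
  simp at hcard
  rw [hcard] at hI
  exact Finset.not_nonempty_empty hI

/-- The Dirichlet energy `∑ ω |∇v|²` over the bonds of `S`. -/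
noncomputable def bondEnergy {d : ℕ} (ω : Bond d → ℝ) (S : Finset (LatticePt d))
    (v : LatticePt d → ℝ) : ℝ :=
  ∑ b ∈ S ×ˢ (Finset.univ : Finset (Fin d)),
    if b.1 + Pi.single b.2 1 ∈ S then ω b * (v (b.1 + Pi.single b.2 1) - v b.1) ^ 2 else 0

/-- The sum of `a` over the bonds of `S`. -/
noncomputable def bondMass {d : ℕ} (a : Bond d → ℝ) (S : Finset (LatticePt d)) : ℝ :=
  ∑ b ∈ S ×ˢ (Finset.univ : Finset (Fin d)), if b.1 + Pi.single b.2 1 ∈ S then a b else 0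

theorem bondEnergy_nonneg {d : ℕ} {ω : Bond d → ℝ} (hω : ∀ b, 0 ≤ ω b) (S : Finset (LatticePt d))
    (v : LatticePt d → ℝ) : 0 ≤ bondEnergy ω S v :=
  Finset.sum_nonneg fun b _ => by
    split_ifs
    · exact mul_nonneg (hω b) (sq_nonneg _)
    · exact le_rfl

theorem bondMass_nonneg {d : ℕ} {a : Bond d → ℝ} (ha : ∀ b, 0 ≤ a b) (S : Finset (LatticePt d)) :
    0 ≤ bondMass a S :=
  Finset.sum_nonneg fun b _ => by
    split_ifs
    · exact ha b
    · exact le_rfl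

theorem bondMass_mono {d : ℕ} {a : Bond d → ℝ} (ha : ∀ b, 0 ≤ a b) {S S' : Finset (LatticePt d)}
    (h : S ⊆ S') : bondMass a S ≤ bondMass a S' := by
  refine (Finset.sum_le_sum fun b _ => ?_).trans (Finset.sum_le_sum_of_subset_of_nonneg
    (Finset.product_subset_product_left h) fun b _ _ => ?_)
  · split_ifs with h1 h2 h2
    · exact le_rfl
    · exact absurd (h h1) h2
    · exact ha b
    · exact le_rfl
  · split_ifs
    · exact ha b
    · exact le_rfl

theorem sum_slices_bond_le {d : ℕ} {a : Bond d → ℝ} (ha : ∀ b, 0 ≤ a b)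
    (S : Finset (LatticePt d)) (j : Fin d) (G : Finset ℤ) (c : ℤ) :
    ∑ r ∈ G, ∑ x ∈ S, (if x j = c + r then
      (if x + Pi.single j 1 ∈ S then a (x, j) else 0) else 0) ≤ bondMass a S := by
  have h0 : ∀ (x : LatticePt d) (j : Fin d),
      0 ≤ (if x + Pi.single j 1 ∈ S then a (x, j) else 0) := by
    intro x j
    split_ifs
    · exact ha _
    · exact le_rfl
  refine (sum_slices_le S j G c (F := fun x => if x + Pi.single j 1 ∈ S then a (x, j) else 0)
    fun x _ => h0 x j).trans ?_
  rw [bondMass, Finset.sum_product_right]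
  exact Finset.single_le_sum
    (f := fun j => ∑ x ∈ S, if x + Pi.single j 1 ∈ S then a (x, j) else 0)
    (fun j _ => Finset.sum_nonneg fun x _ => h0 x j) (Finset.mem_univ j)

theorem sum_two_slices_le {d : ℕ} (S : Finset (LatticePt d)) (j : Fin d) (G : Finset ℤ) (c : ℤ)
    {F : LatticePt d → ℝ} (hF : ∀ x ∈ S, 0 ≤ F x) :
    ∑ r ∈ G, (∑ x ∈ S, (if x j = c + r then F x else 0) +
      ∑ x ∈ S, (if x j = c + r + 1 then F x else 0)) ≤ 2 * ∑ x ∈ S, F x := by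
  have h1 := sum_slices_le S j G c hF
  have h2 := sum_slices_le S j G (c + 1) hF
  rw [Finset.sum_add_distrib, two_mul]
  refine add_le_add h1 (le_trans (le_of_eq ?_) h2)
  simp only [add_right_comm c]

/-- The Caccioppoli inequality with a cutoff adapted to the subsolution: the weight enters through
`A` and the mass of `a`, and the subsolution through its Sobolev energy with exponent `s < 2`. -/
theorem exists_bondEnergy_le {d : ℕ} (hd : 3 ≤ d) {P s : ℝ} (hP : 0 ≤ P) (hP1 : P < 1)
    (hs : 1 ≤ s) (hsm : s < (d : ℝ) - 1)
    (hr : 2 / (1 - P) = s * ((d : ℝ) - 1) / ((d : ℝ) - 1 - s)) :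
    ∃ C : ℝ, 0 < C ∧ ∀ (ω a : Bond d → ℝ), (∀ b, 0 ≤ ω b) → (∀ b, 0 ≤ a b) →
      ∀ w : LatticePt d → ℝ, (∀ x, 0 ≤ w x) →
      (∀ x, divStar (fun b => ω b * grad w b) x ≤ 0) →
      ∀ (α : ℝ), 1 ≤ α → ∀ (y : LatticePt d) (ρ σ : ℕ), ρ < σ →
      ∀ (l A : ℝ), 0 < l → l ≤ 2 * σ + 1 → 0 ≤ A →
      (∀ b : Bond d, b.1 ∈ box y σ → b.1 + Pi.single b.2 1 ∈ box y σ → ω b ≤ A * a b ^ P) →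
      bondEnergy ω (box y ρ) (fun x => w x ^ α) ≤
        C * (A * (bondMass a (box y σ) / ((σ : ℝ) - ρ)) ^ P *
          (sobEnergy s l (box y σ) (fun x => w x ^ α) / ((σ : ℝ) - ρ)) ^ (2 / s) /
            ((σ : ℝ) - ρ)) := by
  obtain ⟨C, hC0, hC⟩ := exists_slice_sobolev hd hs hsm hr
  have hP' : 0 < 1 - P := by linarith
  -- `72 * d` is the `12` of `caccioppoli_cut` times `3 + 3` for the two sides in each of the `d`
  -- directions. The `3 ^ P` and `6 ^ (2 / s)` come from the threshold of three averages, the energy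
  -- being counted on two adjacent slices, and `2 * C` from Sobolev on these two slices.
  refine ⟨72 * d * (3 ^ P * ((2 * C) ^ (1 - P) * 6 ^ (2 / s))), by positivity, ?_⟩
  intro ω a hω ha w hw hsub α hα y ρ σ hρσ l A hl hlσ hA hωA
  set S := box y σ with hS
  set v : LatticePt d → ℝ := fun x => w x ^ α with hvdef
  have hv : ∀ x, 0 ≤ v x := fun x => Real.rpow_nonneg (hw x) _
  set L : ℝ := (σ : ℝ) - ρ with hLdef
  have hL : 0 < L := by rw [hLdef, sub_pos]; exact_mod_cast hρσ
  set M := bondMass a S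
  have hM : 0 ≤ M := bondMass_nonneg ha S
  set T := sobEnergy s l S v
  have hT : 0 ≤ T := sobEnergy_nonneg hl.le hv S
  set K : ℝ := A * (3 * M / L) ^ P * (2 * C * (3 * (2 * T) / L) ^ (2 / (1 - P) / s)) ^ (1 - P)
    with hK
  have hK0 : 0 ≤ K := by positivity
  have good : ∀ (j : Fin d) (I : Finset ℤ), (I.card : ℝ) = L → ∃ G ⊆ I, G.Nonempty ∧
      ((G.card : ℝ)⁻¹ ^ 2 * ∑ r ∈ G, crossSum ω v S j (y j + r) ≤ 3 * K / L) := by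
    intro j I hI
    have hIne : I.Nonempty := by
      rw [← Finset.card_pos]
      have : (0 : ℝ) < I.card := by rw [hI]; exact hL
      exact_mod_cast this
    have hD : ∀ k, 0 ≤ ∑ x ∈ S, if x j = k then sobDensity s l S v x else 0 := fun k =>
      Finset.sum_nonneg fun x _ => by
        split_ifs
        · exact sobDensity_nonneg hl.le hv _ x
        · exact le_rfl
    have hm : ∀ k, 0 ≤ ∑ x ∈ S, if x j = k then
        (if x + Pi.single j 1 ∈ S then a (x, j) else 0) else 0 := fun k =>
      Finset.sum_nonneg fun x _ => by
        split_ifs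
        · exact ha _
        · exact le_rfl
        · exact le_rfl
    -- A layer is good when the weight mass of its bonds and the Sobolev energy on its two faces are
    -- both small. This choice depends on `w` and on `α` through `v`.
    obtain ⟨G, hGI, hGne, hGc, hG⟩ := exists_good_subset I hIne
      (fun r => hm (y j + r)) (fun r => add_nonneg (hD (y j + r)) (hD (y j + r + 1)))
      (sum_slices_bond_le ha S j I (y j))
      (sum_two_slices_le S j I (y j) (F := sobDensity s l S v)
        fun x _ => sobDensity_nonneg hl.le hv _ x)
    refine ⟨G, hGI, hGne, ?_⟩
    rw [hI] at hGc hG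
    have hGpos : (0 : ℝ) < G.card := by exact_mod_cast hGne.card_pos
    have hcross : ∀ r ∈ G, crossSum ω v S j (y j + r) ≤ K := by
      intro r hrG
      obtain ⟨g1, g2⟩ := hG r hrG
      rw [sum_sobDensity] at g2
      refine (crossSum_le hv ha hA hP hP1 S hωA j (y j + r)).trans ?_
      have hq : 0 ≤ 2 / (1 - P) / s := by positivity
      have hV : ∀ k, 0 ≤ ∑ x ∈ S, if x j = k then v x ^ (2 / (1 - P)) else 0 := fun k =>
        Finset.sum_nonneg fun x _ => by
          split_ifs
          · exact Real.rpow_nonneg (hv _) _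
          · exact le_rfl
      refine mul_le_mul (mul_le_mul_of_nonneg_left (Real.rpow_le_rpow (hm _) g1 hP) hA)
        (Real.rpow_le_rpow (add_nonneg (hV _) (hV _)) ?_ hP'.le)
        (Real.rpow_nonneg (add_nonneg (hV _) (hV _)) _) (by positivity)
      have hsum0 := add_nonneg (hD (y j + r)) (hD (y j + r + 1))
      have i1 := hC y σ l hl hlσ v hv j (y j + r)
      have i2 := hC y σ l hl hlσ v hv j (y j + r + 1)
      rw [← hS] at i1 i2
      have i3 := Real.rpow_le_rpow (hD (y j + r))
        ((le_add_of_nonneg_right (hD (y j + r + 1))).trans g2) hq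
      have i4 := Real.rpow_le_rpow (hD (y j + r + 1))
        ((le_add_of_nonneg_left (hD (y j + r))).trans g2) hq
      have i5 := mul_le_mul_of_nonneg_left i3 hC0.le
      have i6 := mul_le_mul_of_nonneg_left i4 hC0.le
      linarith
    calc (G.card : ℝ)⁻¹ ^ 2 * ∑ r ∈ G, crossSum ω v S j (y j + r)
        ≤ (G.card : ℝ)⁻¹ ^ 2 * (G.card * K) := by
          refine mul_le_mul_of_nonneg_left ?_ (by positivity)
          rw [← nsmul_eq_mul]
          exact Finset.sum_le_card_nsmul _ _ _ hcross
      _ = K / G.card := by field_simp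
      _ ≤ 3 * K / L := by
          rw [div_le_div_iff₀ hGpos hL]
          nlinarith
  have hcm : (((Finset.Ico (-(σ : ℤ)) (-ρ)).card : ℕ) : ℝ) = L := by
    rw [Int.card_Ico, hLdef, show (-(ρ : ℤ) - -(σ : ℤ)).toNat = σ - ρ by omega,
      Nat.cast_sub hρσ.le]
  have hcp : (((Finset.Ico (ρ : ℤ) σ).card : ℕ) : ℝ) = L := by
    rw [Int.card_Ico, hLdef, show ((σ : ℤ) - ρ).toNat = σ - ρ by omega, Nat.cast_sub hρσ.le]
  choose Gm hGm hGmne hGmb using fun j => good j _ hcm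
  choose Gp hGp hGpne hGpb using fun j => good j _ hcp
  have main := caccioppoli_cut hω hw hsub hα y ρ σ hρσ.le Gm Gp hGmne hGpne hGm hGp
  refine main.trans ?_
  have h1 : ∑ j, ((((Gm j).card : ℝ)⁻¹ ^ 2 * ∑ r ∈ Gm j, crossSum ω v S j (y j + r)) +
      (((Gp j).card : ℝ)⁻¹ ^ 2 * ∑ r ∈ Gp j, crossSum ω v S j (y j + r))) ≤
      d * (6 * K / L) := by
    refine (Finset.sum_le_card_nsmul _ _ (6 * K / L) fun j _ => ?_).trans (le_of_eq ?_)
    · have := add_le_add (hGmb j) (hGpb j)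
      refine this.trans (le_of_eq (by ring))
    · simp
  refine (mul_le_mul_of_nonneg_left h1 (by norm_num)).trans (le_of_eq ?_)
  have hK' : K = A * (3 ^ P * (M / L) ^ P) *
      ((2 * C) ^ (1 - P) * (6 ^ (2 / s) * (T / L) ^ (2 / s))) := by
    rw [hK, mul_div_assoc, Real.mul_rpow (by norm_num) (by positivity),
      Real.mul_rpow (x := 2 * C) (by positivity) (by positivity), ← Real.rpow_mul (by positivity),
      show 2 / (1 - P) / s * (1 - P) = 2 / s by field_simp,
      show 3 * (2 * T) / L = 6 * (T / L) by ring, Real.mul_rpow (x := 6) (by norm_num) (by positivity)]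
  rw [hK']
  ring

/-- The Caccioppoli inequality with an affine cutoff. -/
theorem bondEnergy_le_of_sum_rpow {d : ℕ} {P : ℝ} (hP : 0 ≤ P) (hP1 : P < 1)
    {ω a : Bond d → ℝ} (hω : ∀ b, 0 ≤ ω b) (ha : ∀ b, 0 ≤ a b)
    {w : LatticePt d → ℝ} (hw : ∀ x, 0 ≤ w x)
    (hsub : ∀ x, divStar (fun b => ω b * grad w b) x ≤ 0) (y : LatticePt d) {ρ σ : ℕ}
    (hρσ : ρ < σ) {A : ℝ} (hA : 0 ≤ A)
    (hωA : ∀ b : Bond d, b.1 ∈ box y σ → b.1 + Pi.single b.2 1 ∈ box y σ → ω b ≤ A * a b ^ P) :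
    bondEnergy ω (box y ρ) w ≤ 48 * d * (A * bondMass a (box y σ) ^ P *
      (∑ x ∈ box y σ, w x ^ (2 / (1 - P))) ^ (1 - P) / ((σ : ℝ) - ρ) ^ 2) := by
  have hP' : 0 < 1 - P := by linarith
  set S := box y σ with hS
  set L : ℝ := (σ : ℝ) - ρ with hLdef
  have hL : 0 < L := by rw [hLdef, sub_pos]; exact_mod_cast hρσ
  set M := bondMass a S
  have hM : 0 ≤ M := bondMass_nonneg ha S
  have hw' : ∀ x, 0 ≤ w x ^ (2 / (1 - P)) := fun x => Real.rpow_nonneg (hw x) _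
  set Y := ∑ x ∈ S, w x ^ (2 / (1 - P))
  have hY : 0 ≤ Y := Finset.sum_nonneg fun x _ => hw' x
  have hV : ∀ (j : Fin d) k, 0 ≤ ∑ x ∈ S, if x j = k then w x ^ (2 / (1 - P)) else 0 := fun j k =>
    Finset.sum_nonneg fun x _ => by
      split_ifs
      · exact hw' x
      · exact le_rfl
  have hm : ∀ (j : Fin d) k, 0 ≤ ∑ x ∈ S, if x j = k then
      (if x + Pi.single j 1 ∈ S then a (x, j) else 0) else 0 := fun j k =>
    Finset.sum_nonneg fun x _ => by
      split_ifs
      · exact ha _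
      · exact le_rfl
      · exact le_rfl
  have hsumV : ∀ (j : Fin d) (G : Finset ℤ),
      ∑ r ∈ G, crossSum ω w S j (y j + r) ≤ 2 * (A * M ^ P * Y ^ (1 - P)) := by
    intro j G
    calc _ ≤ ∑ r ∈ G, _ :=
          Finset.sum_le_sum fun r _ => crossSum_le hw ha hA hP hP1 S hωA j (y j + r)
      _ = A * ∑ r ∈ G, _ := by
          rw [Finset.mul_sum]
          exact Finset.sum_congr rfl fun r _ => mul_assoc _ _ _
      -- With jumps on all hyperplanes of the annulus no selection is made: a second Hölder
      -- inequality, now over the layers, reassembles the full sums.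
      _ ≤ A * (M ^ P * (2 * Y) ^ (1 - P)) := by
          refine mul_le_mul_of_nonneg_left ?_ hA
          refine (sum_rpow_mul_rpow_le G _ _ (fun r _ => hm j _)
            (fun r _ => add_nonneg (hV j _) (hV j _)) hP hP'.le (by ring)).trans ?_
          exact mul_le_mul (Real.rpow_le_rpow (Finset.sum_nonneg fun r _ => hm j _)
            (sum_slices_bond_le ha S j G (y j)) hP)
            (Real.rpow_le_rpow (Finset.sum_nonneg fun r _ => add_nonneg (hV j _) (hV j _))
            (sum_two_slices_le S j G (y j) fun x _ => hw' x) hP'.le)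
            (Real.rpow_nonneg (Finset.sum_nonneg fun r _ => add_nonneg (hV j _) (hV j _)) _)
            (by positivity)
      _ ≤ A * (M ^ P * (2 * Y ^ (1 - P))) := by
          rw [Real.mul_rpow (by norm_num) hY]
          have : (2 : ℝ) ^ (1 - P) ≤ 2 ^ (1 : ℝ) :=
            Real.rpow_le_rpow_of_exponent_le (by norm_num) (by linarith)
          rw [Real.rpow_one] at this
          gcongr
      _ = _ := by ring
  have hcm : (((Finset.Ico (-(σ : ℤ)) (-ρ)).card : ℕ) : ℝ) = L := by
    rw [Int.card_Ico, hLdef, show (-(ρ : ℤ) - -(σ : ℤ)).toNat = σ - ρ by omega,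
      Nat.cast_sub hρσ.le]
  have hcp : (((Finset.Ico (ρ : ℤ) σ).card : ℕ) : ℝ) = L := by
    rw [Int.card_Ico, hLdef, show ((σ : ℤ) - ρ).toNat = σ - ρ by omega, Nat.cast_sub hρσ.le]
  have main := caccioppoli_cut hω hw hsub le_rfl y ρ σ hρσ.le
    (fun _ => Finset.Ico (-(σ : ℤ)) (-ρ)) (fun _ => Finset.Ico (ρ : ℤ) σ)
    (fun _ => ⟨-σ, by simp; omega⟩) (fun _ => ⟨ρ, by simp; omega⟩)
    (fun _ => subset_rfl) (fun _ => subset_rfl)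
  simp only [Real.rpow_one, hcm, hcp] at main
  refine main.trans ?_
  have h1 : ∑ j : Fin d, (L⁻¹ ^ 2 * ∑ r ∈ Finset.Ico (-(σ : ℤ)) (-ρ), crossSum ω w S j (y j + r) +
      L⁻¹ ^ 2 * ∑ r ∈ Finset.Ico (ρ : ℤ) σ, crossSum ω w S j (y j + r)) ≤
      d * (L⁻¹ ^ 2 * (4 * (A * M ^ P * Y ^ (1 - P)))) := by
    refine (Finset.sum_le_card_nsmul _ _ (L⁻¹ ^ 2 * (4 * (A * M ^ P * Y ^ (1 - P))))
      fun j _ => ?_).trans (le_of_eq ?_)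
    · rw [← mul_add]
      refine mul_le_mul_of_nonneg_left ?_ (by positivity)
      have := add_le_add (hsumV j (Finset.Ico (-(σ : ℤ)) (-ρ))) (hsumV j (Finset.Ico (ρ : ℤ) σ))
      refine this.trans (le_of_eq (by ring))
    · simp
  refine (mul_le_mul_of_nonneg_left h1 (by norm_num)).trans (le_of_eq ?_)
  rw [inv_pow]
  ring

/-! ### Scale invariant energies and weight bounds -/

theorem mul_rpow_mul_rpow_rpow {c N E : ℝ} (hc : 0 ≤ c) (hN : 0 ≤ N) (hE : 0 ≤ E) (e f g : ℝ) :
    (c * N ^ e * E ^ f) ^ g = c ^ g * N ^ (e * g) * E ^ (f * g) := by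
  rw [Real.mul_rpow (mul_nonneg hc (Real.rpow_nonneg hN _)) (Real.rpow_nonneg hE _),
    Real.mul_rpow hc (Real.rpow_nonneg hN _), ← Real.rpow_mul hN, ← Real.rpow_mul hE]

/-- The scale invariant version of `sobEnergy` at scale `n`. -/
noncomputable def scaledEnergy {d : ℕ} (t : ℝ) (n : ℕ) (S : Finset (LatticePt d))
    (v : LatticePt d → ℝ) : ℝ :=
  (n : ℝ) ^ (t - (d : ℝ)) * sobEnergy t n S v

theorem scaledEnergy_nonneg {d : ℕ} {t : ℝ} {n : ℕ} (S : Finset (LatticePt d))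
    {v : LatticePt d → ℝ} (hv : ∀ x, 0 ≤ v x) : 0 ≤ scaledEnergy t n S v :=
  mul_nonneg (by positivity) (sobEnergy_nonneg (by positivity) hv S)

theorem sobEnergy_eq_mul_scaledEnergy {d : ℕ} (t : ℝ) {n : ℕ} (hn : 1 ≤ n)
    (S : Finset (LatticePt d)) (v : LatticePt d → ℝ) :
    sobEnergy t n S v = (n : ℝ) ^ ((d : ℝ) - t) * scaledEnergy t n S v := by
  have hN : (0 : ℝ) < n := by exact_mod_cast hn
  rw [scaledEnergy, ← mul_assoc, ← Real.rpow_add hN]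
  simp

theorem card_box_le {d : ℕ} (y : LatticePt d) {n σ : ℕ} (hn : 1 ≤ n) (hσ : σ ≤ 2 * n) :
    ((box y σ).card : ℝ) ≤ 5 ^ d * (n : ℝ) ^ (d : ℝ) := by
  -- A side has `2σ + 1 ≤ 4n + 1 ≤ 5n` points because `n ≥ 1`.
  have h1 : (box y σ).card ≤ (5 * n) ^ d := by
    rw [box, Pi.card_Icc]
    refine (Finset.prod_le_pow_card _ _ (5 * n) fun i _ => ?_).trans (by simp)
    rw [Int.card_Icc]
    omega
  have h2 : ((box y σ).card : ℝ) ≤ (((5 * n) ^ d : ℕ) : ℝ) := by exact_mod_cast h1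
  refine h2.trans (le_of_eq ?_)
  rw [Real.rpow_natCast]
  push_cast
  rw [mul_pow]

theorem box_subset_box {d : ℕ} (y : LatticePt d) {ρ σ : ℕ} (h : ρ ≤ σ) : box y ρ ⊆ box y σ := by
  intro x hx
  rw [mem_box] at hx ⊢
  exact fun i => (hx i).trans (by exact_mod_cast h)

theorem sum_rpow_le_scaledEnergy {d : ℕ} (t : ℝ) {n : ℕ} (hn : 1 ≤ n)
    (S : Finset (LatticePt d)) {v : LatticePt d → ℝ} (hv : ∀ x, 0 ≤ v x) :
    ∑ x ∈ S, v x ^ t ≤ (n : ℝ) ^ (d : ℝ) * scaledEnergy t n S v := by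
  have hN : (0 : ℝ) < n := by exact_mod_cast hn
  have h := sum_div_rpow_le_sobEnergy (s := t) (l := n) (f := v) S
  rw [sobEnergy_eq_mul_scaledEnergy t hn] at h
  have e : ∑ x ∈ S, v x ^ t = (n : ℝ) ^ t * ∑ x ∈ S, (v x / n) ^ t := by
    rw [Finset.mul_sum]
    refine Finset.sum_congr rfl fun x _ => ?_
    rw [Real.div_rpow (hv x) hN.le, mul_div_cancel₀]
    positivity
  rw [e]
  refine (mul_le_mul_of_nonneg_left h (by positivity)).trans (le_of_eq ?_)
  rw [← mul_assoc, ← Real.rpow_add hN]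
  ring_nf

theorem sum_le_scaledEnergy {d : ℕ} {t : ℝ} (ht : 1 ≤ t) (y : LatticePt d) {n σ : ℕ} (hn : 1 ≤ n)
    (hσ : σ ≤ 2 * n) {v : LatticePt d → ℝ} (hv : ∀ x, 0 ≤ v x) :
    ∑ x ∈ box y σ, v x ≤ 5 ^ d * (n : ℝ) ^ (d : ℝ) * scaledEnergy t n (box y σ) v ^ (1 / t) := by
  have hN : (0 : ℝ) < n := by exact_mod_cast hn
  have ht0 : 0 < t := by linarith
  have ht1 : 1 / t ≤ 1 := by rw [div_le_one ht0]; exact ht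
  have hE := scaledEnergy_nonneg (t := t) (n := n) (box y σ) hv
  have h1 := sum_rpow_le_card_rpow_mul (box y σ) (fun x => v x ^ t) (α := 1 / t)
    (fun x _ => Real.rpow_nonneg (hv x) _) (by positivity) ht1
  have e1 : ∀ x, (v x ^ t) ^ (1 / t) = v x := fun x => by
    rw [← Real.rpow_mul (hv x), mul_one_div_cancel ht0.ne', Real.rpow_one]
  simp only [e1] at h1
  refine h1.trans ((mul_le_mul (Real.rpow_le_rpow (by positivity) (card_box_le y hn hσ)
    (by linarith)) (Real.rpow_le_rpow (Finset.sum_nonneg fun x _ => Real.rpow_nonneg (hv x) _)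
    (sum_rpow_le_scaledEnergy t hn (box y σ) hv) (by positivity))
    (Real.rpow_nonneg (Finset.sum_nonneg fun x _ => Real.rpow_nonneg (hv x) _) _)
    (by positivity)).trans ?_)
  rw [Real.mul_rpow (by positivity) (by positivity), Real.mul_rpow (by positivity) hE]
  have e2 : ((n : ℝ) ^ (d : ℝ)) ^ (1 - 1 / t) * ((n : ℝ) ^ (d : ℝ)) ^ (1 / t) = (n : ℝ) ^ (d : ℝ) := by
    rw [← Real.rpow_add (by positivity)]; simp
  have e3 : ((5 : ℝ) ^ d) ^ (1 - 1 / t) ≤ 5 ^ d := by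
    have h5 : (1 : ℝ) ≤ 5 ^ d := one_le_pow₀ (by norm_num)
    calc _ ≤ ((5 : ℝ) ^ d) ^ (1 : ℝ) :=
          Real.rpow_le_rpow_of_exponent_le h5 (by linarith [one_div_nonneg.2 ht0.le])
      _ = _ := Real.rpow_one _
  calc _ = ((5 : ℝ) ^ d) ^ (1 - 1 / t) * (((n : ℝ) ^ (d : ℝ)) ^ (1 - 1 / t) *
        ((n : ℝ) ^ (d : ℝ)) ^ (1 / t)) * scaledEnergy t n (box y σ) v ^ (1 / t) := by ring
    _ ≤ _ := by
        rw [e2]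
        gcongr

/-- Bounds on the weight `ω` and on `ω⁻¹` over the box of radius `2 n`: with `P = 1/p` and
`Q = 1/q`, the constants `A` and `B` play the role of averaged norms of `ω` in `L^p` and `ω⁻¹` in
`L^q`. -/
structure WeightBound {d : ℕ} (P Q A B : ℝ) (y : LatticePt d) (n : ℕ) (ω a b : Bond d → ℝ) :
    Prop where
  pos : ∀ e, 0 < ω e
  a_nonneg : ∀ e, 0 ≤ a e
  b_nonneg : ∀ e, 0 ≤ b e
  A_pos : 0 < A
  B_pos : 0 < B
  one_le_mul : 1 ≤ A * B
  le_upper : ∀ e : Bond d, e.1 ∈ box y (2 * n) → e.1 + Pi.single e.2 1 ∈ box y (2 * n) →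
    ω e ≤ A * a e ^ P
  inv_le : ∀ e : Bond d, e.1 ∈ box y (2 * n) → e.1 + Pi.single e.2 1 ∈ box y (2 * n) →
    (ω e)⁻¹ ≤ B * b e ^ Q
  mass_a : bondMass a (box y (2 * n)) ≤ d * 5 ^ d * (n : ℝ) ^ (d : ℝ)
  mass_b : bondMass b (box y (2 * n)) ≤ d * 5 ^ d * (n : ℝ) ^ (d : ℝ)

/-- Removing the weight from the Dirichlet energy by Hölder's inequality. -/
theorem sum_grad_rpow_le {d : ℕ} {Q B m t : ℝ} (hQ : 0 ≤ Q) (ht : t = 2 / (1 + Q)) (hB : 0 ≤ B)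
    {ω b : Bond d → ℝ} (hω : ∀ e, 0 < ω e) (hb : ∀ e, 0 ≤ b e) (S : Finset (LatticePt d))
    (hωB : ∀ e : Bond d, e.1 ∈ S → e.1 + Pi.single e.2 1 ∈ S → (ω e)⁻¹ ≤ B * b e ^ Q)
    (hm : bondMass b S ≤ m) (V : LatticePt d → ℝ) :
    ∑ e ∈ S ×ˢ (Finset.univ : Finset (Fin d)), (if e.1 + Pi.single e.2 1 ∈ S then
      |V (e.1 + Pi.single e.2 1) - V e.1| ^ t else 0) ≤
      B ^ (t / 2) * (m ^ (Q * t / 2) * bondEnergy ω S V ^ (t / 2)) := by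
  have ht0 : 0 < t := by rw [ht]; positivity
  -- This choice of `t` makes the exponents of `b` and of the Dirichlet energy add up to `1` when
  -- `|∇V| ^ t` is written as `(ω⁻¹) ^ (t/2) * (ω |∇V|²) ^ (t/2)`.
  have hsum : Q * t / 2 + t / 2 = 1 := by rw [ht]; field_simp; ring
  calc _ ≤ ∑ e ∈ S ×ˢ (Finset.univ : Finset (Fin d)), B ^ (t / 2) *
        ((if e.1 + Pi.single e.2 1 ∈ S then b e else 0) ^ (Q * t / 2) *
        (if e.1 + Pi.single e.2 1 ∈ S then
          ω e * (V (e.1 + Pi.single e.2 1) - V e.1) ^ 2 else 0) ^ (t / 2)) := by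
        refine Finset.sum_le_sum fun e he => ?_
        split_ifs with h
        · set g := V (e.1 + Pi.single e.2 1) - V e.1
          have h1 := hωB e (Finset.mem_product.1 he).1 h
          have hi : 0 < (ω e)⁻¹ := inv_pos.2 (hω e)
          have hwg : 0 ≤ ω e * g ^ 2 := mul_nonneg (hω e).le (sq_nonneg _)
          have e1 : |g| ^ t = (ω e)⁻¹ ^ (t / 2) * (ω e * g ^ 2) ^ (t / 2) := by
            rw [← Real.mul_rpow hi.le hwg, ← mul_assoc, inv_mul_cancel₀ (hω e).ne', one_mul,
              ← sq_abs, ← Real.rpow_natCast, ← Real.rpow_mul (abs_nonneg _)]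
            congr 1; push_cast; ring
          rw [e1, ← mul_assoc]
          refine mul_le_mul_of_nonneg_right ?_ (Real.rpow_nonneg hwg _)
          refine (Real.rpow_le_rpow hi.le h1 (by positivity)).trans (le_of_eq ?_)
          rw [Real.mul_rpow hB (Real.rpow_nonneg (hb e) _), ← Real.rpow_mul (hb e)]
          ring_nf
        · exact mul_nonneg (Real.rpow_nonneg hB _) (mul_nonneg (Real.rpow_nonneg le_rfl _)
            (Real.rpow_nonneg le_rfl _))
    _ = B ^ (t / 2) * _ := by rw [Finset.mul_sum]
    _ ≤ _ := by
        refine mul_le_mul_of_nonneg_left ?_ (Real.rpow_nonneg hB _)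
        refine (sum_rpow_mul_rpow_le _ _ _ (fun e _ => ?_) (fun e _ => ?_) (by positivity)
          (by positivity) hsum).trans ?_
        · split_ifs
          · exact hb e
          · exact le_rfl
        · split_ifs
          · exact mul_nonneg (hω e).le (sq_nonneg _)
          · exact le_rfl
        · exact mul_le_mul_of_nonneg_right (Real.rpow_le_rpow (bondMass_nonneg hb S) hm
            (by positivity)) (Real.rpow_nonneg (bondEnergy_nonneg (fun e => (hω e).le) S V) _)

/-- Here the gap between `s` and `t` is spent. The gradient of `v ^ (1 + δ)` is of size `v ^ δ *
|∇v|`, and `1 / s = δ + 1 / t` is the Hölder relation for `v ^ δ ∈ L^(1/δ)`, that is `v ∈ L^1`, and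
`∇v ∈ L^t`. The `L^1` norm of `v` is in turn controlled by the zeroth order part of the `t`-energy.
-/
theorem exists_sobEnergy_rpow_le_scaledEnergy (d : ℕ) {δ t s : ℝ} (hδ : 0 < δ) (ht : 1 ≤ t)
    (hs : s * (1 / t + δ) = 1) :
    ∃ C : ℝ, 0 < C ∧ ∀ (y : LatticePt d) (n σ : ℕ), 1 ≤ n → σ ≤ 2 * n →
      ∀ v : LatticePt d → ℝ, (∀ x, 0 ≤ v x) →
      sobEnergy s n (box y σ) (fun x => v x ^ (1 + δ)) ≤
        C * (n : ℝ) ^ ((d : ℝ) - s) * scaledEnergy t n (box y σ) v ^ ((1 + δ) * s / t) := by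
  have ht0 : 0 < t := by linarith
  have hs0 : 0 < s := by
    by_contra h
    have : s * (1 / t + δ) ≤ 0 := mul_nonpos_of_nonpos_of_nonneg (not_lt.1 h) (by positivity)
    linarith
  have hst : 1 - s / t = s * δ := by rw [← hs]; field_simp; ring
  refine ⟨((1 + δ) ^ s * (2 * Fintype.card (Fin d) + 1) + 1) * (5 ^ d : ℝ) ^ (s * δ),
    by positivity, ?_⟩
  intro y n σ hn hσ v hv
  have hN : (0 : ℝ) < n := by exact_mod_cast hn
  set E := scaledEnergy t n (box y σ) v with hEdef
  have hE : 0 ≤ E := scaledEnergy_nonneg (box y σ) hv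
  have h1 := sobEnergy_rpow_le (s := s) (t := t) (r := 1) (γ := 1 + δ) (θ := s / t) hN hs0.le
    (by linarith) one_pos (by positivity) (by nlinarith) (by rw [hst]; ring) (by field_simp)
    (box y σ) hv
  simp only [Real.rpow_one] at h1
  rw [hst, sobEnergy_eq_mul_scaledEnergy t hn, ← hEdef] at h1
  refine h1.trans ?_
  have h2 := Real.rpow_le_rpow (Finset.sum_nonneg fun x _ => hv x)
    (sum_le_scaledEnergy ht y hn hσ hv) (by positivity : 0 ≤ s * δ)
  rw [← hEdef, mul_rpow_mul_rpow_rpow (by positivity) hN.le hE] at h2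
  rw [Real.mul_rpow (by positivity) hE, ← Real.rpow_mul hN.le]
  calc _ ≤ ((1 + δ) ^ s * (2 * (Fintype.card (Fin d) : ℝ) + 1) + 1) *
        ((5 ^ d : ℝ) ^ (s * δ) * (n : ℝ) ^ ((d : ℝ) * (s * δ)) * E ^ (1 / t * (s * δ))) *
        ((n : ℝ) ^ (((d : ℝ) - t) * (s / t)) * E ^ (s / t)) := by gcongr
    _ = ((1 + δ) ^ s * (2 * (Fintype.card (Fin d) : ℝ) + 1) + 1) * (5 ^ d : ℝ) ^ (s * δ) *
        ((n : ℝ) ^ ((d : ℝ) * (s * δ)) * (n : ℝ) ^ (((d : ℝ) - t) * (s / t))) *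
        (E ^ (1 / t * (s * δ)) * E ^ (s / t)) := by ring
    _ = _ := by
        rw [← Real.rpow_add hN, ← Real.rpow_add_of_nonneg hE (by positivity) (by positivity)]
        congr 2
        · congr 1
          have : (d : ℝ) * (s * δ) + (d - t) * (s / t) = d * (s * (1 / t + δ)) - s := by
            field_simp; ring
          rw [this, hs]; ring
        · field_simp
          ring

theorem sum_rpow_le_box {d : ℕ} {q r θ : ℝ} (hθ : 0 ≤ θ) (hθ1 : θ ≤ 1) (hq : q = r * θ)
    (y : LatticePt d) {n σ : ℕ} (hn : 1 ≤ n) (hσ : σ ≤ 2 * n) {v : LatticePt d → ℝ}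
    (hv : ∀ x, 0 ≤ v x) :
    ∑ x ∈ box y σ, v x ^ q ≤
      5 ^ d * (n : ℝ) ^ ((d : ℝ) * (1 - θ)) * (∑ x ∈ box y σ, v x ^ r) ^ θ := by
  have h1 := sum_rpow_le_card_rpow_mul (box y σ) (fun x => v x ^ r) (α := θ)
    (fun x _ => Real.rpow_nonneg (hv x) _) hθ hθ1
  have e1 : ∀ x, (v x ^ r) ^ θ = v x ^ q := fun x => by
    rw [← Real.rpow_mul (hv x), hq]
  simp only [e1] at h1
  refine h1.trans (mul_le_mul_of_nonneg_right ?_ (Real.rpow_nonneg (Finset.sum_nonneg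
    fun x _ => Real.rpow_nonneg (hv x) _) _))
  refine (Real.rpow_le_rpow (by positivity) (card_box_le y hn hσ) (by linarith)).trans ?_
  rw [Real.mul_rpow (by positivity) (by positivity), ← Real.rpow_mul (by positivity)]
  refine mul_le_mul_of_nonneg_right ?_ (by positivity)
  have h5 : (1 : ℝ) ≤ 5 ^ d := one_le_pow₀ (by norm_num)
  calc _ ≤ ((5 : ℝ) ^ d) ^ (1 : ℝ) := Real.rpow_le_rpow_of_exponent_le h5 (by linarith)
    _ = _ := Real.rpow_one _

theorem sum_div_rpow_eq {d : ℕ} {t : ℝ} {n : ℕ} (hn : 1 ≤ n) (S : Finset (LatticePt d))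
    {v : LatticePt d → ℝ} (hv : ∀ x, 0 ≤ v x) :
    ∑ x ∈ S, (v x / n) ^ t = (n : ℝ) ^ (-t) * ∑ x ∈ S, v x ^ t := by
  have hN : (0 : ℝ) < n := by exact_mod_cast hn
  rw [Finset.mul_sum]
  refine Finset.sum_congr rfl fun x _ => ?_
  rw [Real.div_rpow (hv x) hN.le, Real.rpow_neg hN.le, div_eq_inv_mul]

/-! ### The exponents and the energy recursion -/

/-- The exponents of the iteration, with `P = 1/p` and `Q = 1/q`. -/
structure IterExponents (d : ℕ) (P Q δ t s : ℝ) : Prop where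
  three_le : 3 ≤ d
  P_nonneg : 0 ≤ P
  P_lt : P < 1
  Q_nonneg : 0 ≤ Q
  Q_lt : Q < 1
  δ_pos : 0 < δ
  δ_eq : δ = 1 / ((d : ℝ) - 1) - P / 2 - Q / 2
  t_eq : t = 2 / (1 + Q)
  s_eq : s = 2 / (1 + Q + 2 * δ)

namespace IterExponents

variable {d : ℕ} {P Q δ t s : ℝ}

theorem three_le_cast (h : IterExponents d P Q δ t s) : (3 : ℝ) ≤ d := by exact_mod_cast h.three_le

theorem one_le_t (h : IterExponents d P Q δ t s) : 1 ≤ t := by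
  have := h.Q_nonneg
  have := h.Q_lt
  rw [h.t_eq, le_div_iff₀ (by linarith)]; linarith

theorem t_le_two (h : IterExponents d P Q δ t s) : t ≤ 2 := by
  have := h.Q_nonneg
  rw [h.t_eq, div_le_iff₀ (by linarith)]; linarith

theorem one_div_t (h : IterExponents d P Q δ t s) : 1 / t = (1 + Q) / 2 := by
  rw [h.t_eq, one_div_div]

theorem one_div_s (h : IterExponents d P Q δ t s) : 1 / s = (1 - P) / 2 + 1 / ((d : ℝ) - 1) := by
  rw [h.s_eq, one_div_div, h.δ_eq]; ring

theorem s_pos (h : IterExponents d P Q δ t s) : 0 < s := by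
  have := h.Q_nonneg
  have := h.δ_pos
  rw [h.s_eq]; positivity

theorem s_mul (h : IterExponents d P Q δ t s) : s * (1 / t + δ) = 1 := by
  have := h.Q_nonneg
  have := h.δ_pos
  rw [h.one_div_t, h.s_eq]; field_simp

/-- From `1 / s = (1 - P) / 2 + 1 / (d - 1)`: each summand is at most `1 / 2`, the second one
because `d ≥ 3`. -/
theorem one_le_s (h : IterExponents d P Q δ t s) : 1 ≤ s := by
  have h1 : 1 / s ≤ 1 := by
    have := h.P_nonneg
    have h2 : 1 / ((d : ℝ) - 1) ≤ 1 / 2 :=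
      one_div_le_one_div_of_le (by norm_num) (by linarith [h.three_le_cast])
    rw [h.one_div_s]; linarith
  rwa [div_le_one h.s_pos] at h1

theorem s_lt (h : IterExponents d P Q δ t s) : s < (d : ℝ) - 1 := by
  have hd := h.three_le_cast
  have h1 : 1 / ((d : ℝ) - 1) < 1 / s := by
    have := h.P_lt
    rw [h.one_div_s]; linarith
  exact (one_div_lt_one_div (by linarith) h.s_pos).1 h1

/-- The defining property of `s`: in dimension `d - 1` its Sobolev conjugate is the exponent left
for `v` after Hölder against `ω ∈ L^p`. -/
theorem conj_exponent (h : IterExponents d P Q δ t s) :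
    2 / (1 - P) = s * ((d : ℝ) - 1) / ((d : ℝ) - 1 - s) := by
  have hd := h.three_le_cast
  have h1 := h.one_div_s
  have h2 := h.s_lt
  have h3 := h.s_pos
  have h4 : 0 < 1 - P := by linarith [h.P_lt]
  have h5 : (d : ℝ) - 1 ≠ 0 := by linarith
  have h6 : (d : ℝ) - 1 - s ≠ 0 := by linarith
  have h7 : 1 - P = 2 * ((d : ℝ) - 1 - s) / (s * ((d : ℝ) - 1)) := by
    have : 1 - P = 2 * (1 / s - 1 / ((d : ℝ) - 1)) := by rw [h1]; ring
    rw [this]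
    field_simp
  rw [h7]
  field_simp

theorem delta_mul_le (h : IterExponents d P Q δ t s) : δ * ((d : ℝ) - 1) ≤ 1 := by
  have hd := h.three_le_cast
  have h5 : (0 : ℝ) < (d : ℝ) - 1 := by linarith
  have : δ ≤ 1 / ((d : ℝ) - 1) := by
    rw [h.δ_eq]; linarith [h.P_nonneg, h.Q_nonneg]
  rwa [le_div_iff₀ h5] at this

/-- Energy estimate for `v ^ (1 + δ)` in terms of the scaled energy of `v`. -/
theorem exists_bondEnergy_le_scaledEnergy (h : IterExponents d P Q δ t s) :
    ∃ C : ℝ, 0 < C ∧ ∀ (A B : ℝ) (y : LatticePt d) (n : ℕ) (ω a b : Bond d → ℝ), 1 ≤ n →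
      WeightBound P Q A B y n ω a b →
      ∀ w : LatticePt d → ℝ, (∀ x, 0 ≤ w x) →
      (∀ x, divStar (fun b => ω b * grad w b) x ≤ 0) →
      ∀ (α : ℝ), 1 ≤ α → ∀ (ρ σ : ℕ), n ≤ ρ → ρ < σ → σ ≤ 2 * n →
      bondEnergy ω (box y ρ) (fun x => (w x ^ α) ^ (1 + δ)) ≤
        C * (A * (n : ℝ) ^ ((d : ℝ) - 2) * ((n : ℝ) / ((σ : ℝ) - ρ)) ^ (2 + 2 / ((d : ℝ) - 1)) *
          scaledEnergy t n (box y σ) (fun x => w x ^ α) ^ (2 * (1 + δ) / t)) := by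
  obtain ⟨C1, hC1, H1⟩ := exists_bondEnergy_le h.three_le h.P_nonneg h.P_lt h.one_le_s h.s_lt
    h.conj_exponent
  obtain ⟨C2, hC2, H2⟩ := exists_sobEnergy_rpow_le_scaledEnergy d h.δ_pos h.one_le_t h.s_mul
  have hd := h.three_le_cast
  refine ⟨C1 * ((d * 5 ^ d : ℝ) ^ P * C2 ^ (2 / s)), by positivity, ?_⟩
  intro A B y n ω a b hn hW w hw hsub α hα ρ σ hnρ hρσ hσ
  have hN : (0 : ℝ) < n := by exact_mod_cast hn
  set L : ℝ := (σ : ℝ) - ρ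
  have hL : 0 < L := sub_pos.2 (by exact_mod_cast hρσ)
  set R : ℝ := (n : ℝ) / L with hR
  have hR0 : 0 < R := div_pos hN hL
  have hLR : L⁻¹ = R * (n : ℝ) ^ (-1 : ℝ) := by
    rw [hR, Real.rpow_neg_one]; field_simp
  have hv : ∀ x, 0 ≤ w x ^ α := fun x => Real.rpow_nonneg (hw x) _
  set E := scaledEnergy t n (box y σ) (fun x => w x ^ α) with hEdef
  have hE : 0 ≤ E := scaledEnergy_nonneg (box y σ) hv
  have hA := hW.A_pos
  have hP := h.P_nonneg
  have hs := h.s_pos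
  have hδ := h.δ_pos
  have ht : 0 < t := by linarith [h.one_le_t]
  have hsub' := box_subset_box y hσ
  -- The Caccioppoli estimate is applied to the original subsolution `w` with the raised power `α *
  -- (1 + δ)`, so powers of `w` need not be shown to be subsolutions.
  have h1 := H1 ω a (fun e => (hW.pos e).le) hW.a_nonneg w hw hsub (α * (1 + δ)) (by nlinarith)
    y ρ σ hρσ n A hN (by
      have : (n : ℝ) ≤ ρ := by exact_mod_cast hnρ
      have : (ρ : ℝ) ≤ σ := by exact_mod_cast hρσ.le
      linarith) hA.le (fun e he1 he2 => hW.le_upper e (hsub' he1) (hsub' he2))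
  have h2 := H2 y n σ hn hσ _ hv
  have e0 : (fun x => w x ^ (α * (1 + δ))) = fun x => (w x ^ α) ^ (1 + δ) :=
    funext fun x => Real.rpow_mul (hw x) _ _
  rw [e0] at h1
  refine h1.trans ?_
  have hM0 := bondMass_nonneg hW.a_nonneg (box y σ)
  have hM : bondMass a (box y σ) / L ≤ (d * 5 ^ d) * (n : ℝ) ^ ((d : ℝ) - 1) * R ^ (1 : ℝ) := by
    rw [div_eq_mul_inv, hLR, Real.rpow_one]
    refine (mul_le_mul_of_nonneg_right ((bondMass_mono hW.a_nonneg hsub').trans hW.mass_a)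
      (by positivity)).trans (le_of_eq ?_)
    rw [sub_eq_add_neg, Real.rpow_add hN]; ring
  have hTs0 : 0 ≤ sobEnergy s n (box y σ) (fun x => (w x ^ α) ^ (1 + δ)) :=
    sobEnergy_nonneg hN.le (fun x => Real.rpow_nonneg (hv x) _) _
  have hT : sobEnergy s n (box y σ) (fun x => (w x ^ α) ^ (1 + δ)) / L ≤
      (C2 * R) * (n : ℝ) ^ ((d : ℝ) - s - 1) * E ^ ((1 + δ) * s / t) := by
    rw [div_eq_mul_inv, hLR]
    refine (mul_le_mul_of_nonneg_right h2 (by positivity)).trans (le_of_eq ?_)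
    rw [sub_eq_add_neg ((d : ℝ) - s), Real.rpow_add hN]; ring
  have hM' := Real.rpow_le_rpow (by positivity) hM hP
  have hT' := Real.rpow_le_rpow (by positivity) hT (by positivity : 0 ≤ 2 / s)
  rw [mul_rpow_mul_rpow_rpow (by positivity) hN.le hR0.le] at hM'
  rw [mul_rpow_mul_rpow_rpow (by positivity) hN.le hE, Real.mul_rpow hC2.le hR0.le] at hT'
  rw [mul_assoc C1]
  refine mul_le_mul_of_nonneg_left ?_ hC1.le
  rw [div_eq_mul_inv _ L, hLR]
  calc _ ≤ A * ((d * 5 ^ d : ℝ) ^ P * (n : ℝ) ^ (((d : ℝ) - 1) * P) * R ^ (1 * P)) *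
        (C2 ^ (2 / s) * R ^ (2 / s) * (n : ℝ) ^ (((d : ℝ) - s - 1) * (2 / s)) *
          E ^ ((1 + δ) * s / t * (2 / s))) * (R * (n : ℝ) ^ (-1 : ℝ)) := by gcongr
    _ = ((d * 5 ^ d : ℝ) ^ P * C2 ^ (2 / s)) * (A * ((n : ℝ) ^ (((d : ℝ) - 1) * P) *
        (n : ℝ) ^ (((d : ℝ) - s - 1) * (2 / s)) * (n : ℝ) ^ (-1 : ℝ)) *
        (R ^ (1 * P) * R ^ (2 / s) * R ^ (1 : ℝ)) * E ^ ((1 + δ) * s / t * (2 / s))) := by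
        rw [Real.rpow_one]; ring
    _ = _ := by
        rw [← Real.rpow_add hN, ← Real.rpow_add hN, ← Real.rpow_add hR0, ← Real.rpow_add hR0]
        -- The powers of `R` are `P` from the mass, `2 / s` from the energy and `1` from spreading
        -- the jumps; `P` cancels in their sum.
        have k1 : 2 / s = 1 - P + 2 / ((d : ℝ) - 1) := by
          have := h.one_div_s
          rw [show 2 / s = 2 * (1 / s) by ring, this]; ring
        have hd1 : (d : ℝ) - 1 ≠ 0 := by linarith
        have k2 : ((d : ℝ) - 1) * P + ((d : ℝ) - s - 1) * (2 / s) + -1 = d - 2 := by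
          have : ((d : ℝ) - s - 1) * (2 / s) = (d - 1) * (2 / s) - 2 := by field_simp; ring
          rw [this, k1]; field_simp; ring
        have k3 : 1 * P + 2 / s + 1 = 2 + 2 / ((d : ℝ) - 1) := by rw [k1]; ring
        have k4 : (1 + δ) * s / t * (2 / s) = 2 * (1 + δ) / t := by field_simp
        rw [k2, k3, k4]

/-- Passage from a bound on the weighted Dirichlet energy to a bound on the `t`-energy. -/
theorem sum_grad_le_of_bondEnergy_le (h : IterExponents d P Q δ t s) {A B : ℝ}
    {y : LatticePt d} {n : ℕ} {ω a b : Bond d → ℝ}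
    (hn : 1 ≤ n) (hW : WeightBound P Q A B y n ω a b) {ρ : ℕ} (hρ : ρ ≤ 2 * n)
    {V : LatticePt d → ℝ} {C R k F : ℝ} (hC : 0 ≤ C) (hR : 0 ≤ R) (hF : 0 ≤ F)
    (hV : bondEnergy ω (box y ρ) V ≤ C * (A * (n : ℝ) ^ ((d : ℝ) - 2) * R ^ k * F)) :
    ∑ e ∈ box y ρ ×ˢ (Finset.univ : Finset (Fin d)),
      (if e.1 + Pi.single e.2 1 ∈ box y ρ then |V (e.1 + Pi.single e.2 1) - V e.1| ^ t else 0) ≤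
      (d * 5 ^ d : ℝ) ^ (Q * t / 2) * C ^ (t / 2) *
        ((A * B) ^ (t / 2) * R ^ (k * (t / 2)) * (n : ℝ) ^ ((d : ℝ) - t) * F ^ (t / 2)) := by
  have hN : (0 : ℝ) < n := by exact_mod_cast hn
  have hsub' := box_subset_box y hρ
  have hA := hW.A_pos
  have hB := hW.B_pos
  have ht0 : 0 < t := by linarith [h.one_le_t]
  have h1 := sum_grad_rpow_le (d := d) h.Q_nonneg h.t_eq hB.le hW.pos hW.b_nonneg (box y ρ)
    (fun e he1 he2 => hW.inv_le e (hsub' he1) (hsub' he2))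
    ((bondMass_mono hW.b_nonneg hsub').trans hW.mass_b) V
  refine h1.trans ?_
  have h2 := Real.rpow_le_rpow (bondEnergy_nonneg (fun e => (hW.pos e).le) _ _) hV
    (by positivity : 0 ≤ t / 2)
  have e1 : (C * (A * (n : ℝ) ^ ((d : ℝ) - 2) * R ^ k * F)) ^ (t / 2) =
      C ^ (t / 2) * (A ^ (t / 2) * (n : ℝ) ^ (((d : ℝ) - 2) * (t / 2)) * R ^ (k * (t / 2)) *
        F ^ (t / 2)) := by
    rw [Real.mul_rpow hC (by positivity), Real.mul_rpow (by positivity) hF,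
      mul_rpow_mul_rpow_rpow hA.le hN.le hR]
  rw [e1] at h2
  refine (mul_le_mul_of_nonneg_left (mul_le_mul_of_nonneg_left h2
    (by positivity)) (by positivity)).trans (le_of_eq ?_)
  rw [Real.mul_rpow (x := (d * 5 ^ d : ℝ)) (by positivity) (by positivity), ← Real.rpow_mul hN.le,
    Real.mul_rpow hA.le hB.le]
  have k1 : (n : ℝ) ^ ((d : ℝ) - t) =
      (n : ℝ) ^ ((d : ℝ) * (Q * t / 2)) * (n : ℝ) ^ (((d : ℝ) - 2) * (t / 2)) := by
    rw [← Real.rpow_add hN]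
    congr 1
    have : (1 + Q) * t = 2 := by
      have := h.Q_nonneg
      rw [h.t_eq]; field_simp
    linear_combination (-(d : ℝ) / 2) * this
  rw [k1]
  ring

/-- The zeroth order part of the energy of `v ^ (1 + δ)`. It uses the Sobolev inequality in the full
dimension `d`: the needed exponent `(1 + δ) * t` does not exceed the conjugate `t * d / (d - t)`,
because `t ≥ 1` and `δ * (d - 1) ≤ 1`. -/
theorem exists_sum_div_rpow_le (h : IterExponents d P Q δ t s) :
    ∃ C : ℝ, 0 < C ∧ ∀ (y : LatticePt d) (n : ℕ), 1 ≤ n → ∀ (σ : ℕ), n ≤ σ → σ ≤ 2 * n →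
      ∀ v : LatticePt d → ℝ, (∀ x, 0 ≤ v x) →
      ∑ x ∈ box y σ, (v x ^ (1 + δ) / n) ^ t ≤
        C * ((n : ℝ) ^ ((d : ℝ) - t) * scaledEnergy t n (box y σ) v ^ (1 + δ)) := by
  have hd := h.three_le_cast
  have ht1 := h.one_le_t
  have ht2 := h.t_le_two
  have hδ := h.δ_pos
  have htd : 0 < (d : ℝ) - t := by linarith
  set r : ℝ := t * d / (d - t) with hr
  have hr0 : 0 < r := by positivity
  obtain ⟨C, hC, H⟩ := exists_sum_rpow_le_sobEnergy (Fin d) (by simp; have := h.three_le; omega)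
    (s := t) (r := r) ht1 (by simp; linarith) (by simp [hr])
  set θ : ℝ := (1 + δ) * (d - t) / d with hθ
  have hθ0 : 0 ≤ θ := by positivity
  have hθ1 : θ ≤ 1 := by
    rw [hθ, div_le_one (by linarith)]
    have := h.delta_mul_le
    nlinarith
  have hq : (1 + δ) * t = r * θ := by
    rw [hr, hθ]; field_simp
  refine ⟨5 ^ d * C ^ θ, by positivity, ?_⟩
  intro y n hn σ hnσ hσ v hv
  have hN : (0 : ℝ) < n := by exact_mod_cast hn
  set E := scaledEnergy t n (box y σ) v with hEdef
  have hE : 0 ≤ E := scaledEnergy_nonneg (box y σ) hv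
  have h1 := H (fun i => y i - (σ : ℤ)) (fun i => y i + (σ : ℤ)) n hN (fun j => by
    have : (n : ℝ) ≤ σ := by exact_mod_cast hnσ
    push_cast; linarith) v hv
  have h2 := sum_rpow_le_box hθ0 hθ1 hq y hn hσ hv
  change ∑ x ∈ box y σ, v x ^ r ≤ C * sobEnergy t n (box y σ) v ^ (r / t) at h1
  rw [sobEnergy_eq_mul_scaledEnergy t hn, ← hEdef, Real.mul_rpow (by positivity) hE,
    ← Real.rpow_mul hN.le, ← mul_assoc] at h1
  have h3 := Real.rpow_le_rpow (Finset.sum_nonneg fun x _ => Real.rpow_nonneg (hv x) _) h1 hθ0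
  rw [mul_rpow_mul_rpow_rpow hC.le hN.le hE] at h3
  rw [sum_div_rpow_eq hn _ fun x => Real.rpow_nonneg (hv x) _]
  have e1 : ∀ x, (v x ^ (1 + δ)) ^ t = v x ^ ((1 + δ) * t) := fun x =>
    (Real.rpow_mul (hv x) _ _).symm
  simp only [e1]
  calc _ ≤ (n : ℝ) ^ (-t) * (5 ^ d * (n : ℝ) ^ ((d : ℝ) * (1 - θ)) * (C ^ θ *
        (n : ℝ) ^ (((d : ℝ) - t) * (r / t) * θ) * E ^ (r / t * θ))) := by
        refine mul_le_mul_of_nonneg_left (h2.trans (mul_le_mul_of_nonneg_left h3 (by positivity)))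
          (by positivity)
    _ = 5 ^ d * C ^ θ * (((n : ℝ) ^ (-t) * (n : ℝ) ^ ((d : ℝ) * (1 - θ)) *
        (n : ℝ) ^ (((d : ℝ) - t) * (r / t) * θ)) * E ^ (r / t * θ)) := by ring
    _ = _ := by
        rw [← Real.rpow_add hN, ← Real.rpow_add hN]
        have ht0 : t ≠ 0 := by linarith
        have hdt : (d : ℝ) - t ≠ 0 := htd.ne'
        have k1 : r / t * θ = 1 + δ := by
          rw [div_mul_eq_mul_div, ← hq]; field_simp
        have k2 : -t + (d : ℝ) * (1 - θ) + ((d : ℝ) - t) * (r / t) * θ = d - t := by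
          rw [mul_assoc, k1, hθ]; field_simp; ring
        rw [k1, k2]

/-- One step of Moser's iteration, with `t` kept fixed and the power of `w` raised. The weight
estimates give the gradient part; the Sobolev bound gives the rest and is enlarged by factors at
least `1`, which is why `A * B ≥ 1` is needed. -/
theorem exists_scaledEnergy_step (h : IterExponents d P Q δ t s) :
    ∃ C κ : ℝ, 1 ≤ C ∧ 0 < κ ∧
      ∀ (A B : ℝ) (y : LatticePt d) (n : ℕ) (ω a b : Bond d → ℝ), 1 ≤ n →
      WeightBound P Q A B y n ω a b →
      ∀ w : LatticePt d → ℝ, (∀ x, 0 ≤ w x) →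
      (∀ x, divStar (fun b => ω b * grad w b) x ≤ 0) →
      ∀ (α : ℝ), 1 ≤ α → ∀ (ρ σ : ℕ), n ≤ ρ → ρ < σ → σ ≤ 2 * n →
      scaledEnergy t n (box y ρ) (fun x => (w x ^ α) ^ (1 + δ)) ≤
        C * ((A * B) ^ (t / 2) * ((n : ℝ) / ((σ : ℝ) - ρ)) ^ κ *
          scaledEnergy t n (box y σ) (fun x => w x ^ α) ^ (1 + δ)) := by
  obtain ⟨C1, hC1, H1⟩ := h.exists_bondEnergy_le_scaledEnergy
  obtain ⟨C2, hC2, H2⟩ := h.exists_sum_div_rpow_le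
  have hd := h.three_le_cast
  have ht1 := h.one_le_t
  have hd1 : 0 < (d : ℝ) - 1 := by linarith
  set C3 := (d * 5 ^ d : ℝ) ^ (Q * t / 2) * C1 ^ (t / 2) with hC3
  have hC30 : 0 ≤ C3 := by positivity
  refine ⟨C3 + C2 + 1, (2 + 2 / ((d : ℝ) - 1)) * (t / 2), by linarith, by positivity, ?_⟩
  intro A B y n ω a b hn hW w hw hsub α hα ρ σ hnρ hρσ hσ
  have hN : (0 : ℝ) < n := by exact_mod_cast hn
  have hδ := h.δ_pos
  have hv : ∀ x, 0 ≤ w x ^ α := fun x => Real.rpow_nonneg (hw x) _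
  have hL : 0 < (σ : ℝ) - ρ := sub_pos.2 (by exact_mod_cast hρσ)
  have h1 := H1 A B y n ω a b hn hW w hw hsub α hα ρ σ hnρ hρσ hσ
  have h2 := H2 y n hn σ (by omega) hσ _ hv
  set R : ℝ := (n : ℝ) / ((σ : ℝ) - ρ) with hR
  have hR1 : 1 ≤ R := by
    rw [hR, le_div_iff₀ hL]
    have : (σ : ℝ) ≤ 2 * n := by exact_mod_cast hσ
    have : (n : ℝ) ≤ ρ := by exact_mod_cast hnρ
    linarith
  set E := scaledEnergy t n (box y σ) (fun x => w x ^ α) with hEdef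
  have hE : 0 ≤ E := scaledEnergy_nonneg (box y σ) hv
  have h3 := h.sum_grad_le_of_bondEnergy_le hn hW (hρσ.le.trans hσ) hC1.le
    (by linarith : 0 ≤ R) (by positivity) h1
  rw [← hC3, ← Real.rpow_mul hE, show 2 * (1 + δ) / t * (t / 2) = 1 + δ by field_simp] at h3
  have hAB : 1 ≤ (A * B) ^ (t / 2) := Real.one_le_rpow hW.one_le_mul (by positivity)
  set k := (2 + 2 / ((d : ℝ) - 1)) * (t / 2) with hk
  have hk0 : 0 ≤ k := by positivity
  have hRk : 1 ≤ R ^ k := Real.one_le_rpow hR1 hk0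
  have h4 : ∑ x ∈ box y ρ, ((w x ^ α) ^ (1 + δ) / n) ^ t ≤
      C2 * ((n : ℝ) ^ ((d : ℝ) - t) * E ^ (1 + δ)) := by
    refine le_trans (Finset.sum_le_sum_of_subset_of_nonneg (box_subset_box y hρσ.le)
      fun x _ _ => ?_) h2
    exact Real.rpow_nonneg (div_nonneg (Real.rpow_nonneg (hv x) _) hN.le) _
  have h5 : sobEnergy t n (box y ρ) (fun x => (w x ^ α) ^ (1 + δ)) ≤
      (n : ℝ) ^ ((d : ℝ) - t) * ((C3 + C2) * ((A * B) ^ (t / 2) * R ^ k * E ^ (1 + δ))) := by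
    rw [sobEnergy_eq]
    have hge : (n : ℝ) ^ ((d : ℝ) - t) * E ^ (1 + δ) ≤
        (n : ℝ) ^ ((d : ℝ) - t) * ((A * B) ^ (t / 2) * R ^ k * E ^ (1 + δ)) := by
      refine mul_le_mul_of_nonneg_left (le_mul_of_one_le_left (by positivity) ?_) (by positivity)
      exact one_le_mul_of_one_le_of_one_le hAB hRk
    have h6 := h4.trans (mul_le_mul_of_nonneg_left hge hC2.le)
    refine (add_le_add h3 h6).trans (le_of_eq ?_)
    ring
  rw [scaledEnergy]
  refine (mul_le_mul_of_nonneg_left h5 (by positivity)).trans ?_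
  rw [← mul_assoc, ← Real.rpow_add hN, show t - (d : ℝ) + (d - t) = 0 by ring, Real.rpow_zero,
    one_mul]
  refine mul_le_mul_of_nonneg_right (by linarith) ?_
  have : 0 < A * B := mul_pos hW.A_pos hW.B_pos
  positivity

/-- The recursion presupposes an energy bound. The first one comes from the affine cutoff, which
needs only the `2p'`-average of `w` and no gradient information. -/
theorem exists_scaledEnergy_start (h : IterExponents d P Q δ t s) :
    ∃ C κ : ℝ, 1 ≤ C ∧ 0 < κ ∧
      ∀ (A B : ℝ) (y : LatticePt d) (n : ℕ) (ω a b : Bond d → ℝ), 1 ≤ n →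
      WeightBound P Q A B y n ω a b →
      ∀ w : LatticePt d → ℝ, (∀ x, 0 ≤ w x) →
      (∀ x, divStar (fun b => ω b * grad w b) x ≤ 0) →
      ∀ (ρ σ : ℕ), n ≤ ρ → ρ < σ → σ ≤ 2 * n →
      scaledEnergy t n (box y ρ) w ≤
        C * ((A * B) ^ (t / 2) * ((n : ℝ) / ((σ : ℝ) - ρ)) ^ κ *
          ((n : ℝ) ^ (-(d : ℝ)) * ∑ x ∈ box y σ, w x ^ (2 / (1 - P))) ^ ((1 - P) * t / 2)) := by
  have hd := h.three_le_cast
  have ht1 := h.one_le_t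
  have ht2 := h.t_le_two
  have hP := h.P_nonneg
  have hP1 : 0 < 1 - P := by linarith [h.P_lt]
  set C1 : ℝ := 48 * d * (d * 5 ^ d : ℝ) ^ P with hC1def
  have hC1 : 0 ≤ C1 := by positivity
  set C3 := (d * 5 ^ d : ℝ) ^ (Q * t / 2) * C1 ^ (t / 2) with hC3
  have hC30 : 0 ≤ C3 := by positivity
  refine ⟨C3 + 5 ^ d + 1, 2 * (t / 2), by
    have : (0 : ℝ) ≤ 5 ^ d := by positivity
    linarith, by positivity, ?_⟩
  intro A B y n ω a b hn hW w hw hsub ρ σ hnρ hρσ hσ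
  have hN : (0 : ℝ) < n := by exact_mod_cast hn
  have hsub' := box_subset_box y hσ
  have hL : 0 < (σ : ℝ) - ρ := sub_pos.2 (by exact_mod_cast hρσ)
  have hA := hW.A_pos
  have h1 := bondEnergy_le_of_sum_rpow hP h.P_lt (fun e => (hW.pos e).le) hW.a_nonneg hw hsub y
    hρσ hA.le (fun e he1 he2 => hW.le_upper e (hsub' he1) (hsub' he2))
  set R : ℝ := (n : ℝ) / ((σ : ℝ) - ρ) with hR
  have hR1 : 1 ≤ R := by
    rw [hR, le_div_iff₀ hL]
    have : (σ : ℝ) ≤ 2 * n := by exact_mod_cast hσ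
    have : (n : ℝ) ≤ ρ := by exact_mod_cast hnρ
    linarith
  have hR0 : 0 < R := by linarith
  set Y := ∑ x ∈ box y σ, w x ^ (2 / (1 - P)) with hYdef
  have hY : 0 ≤ Y := Finset.sum_nonneg fun x _ => Real.rpow_nonneg (hw x) _
  set Z := (n : ℝ) ^ (-(d : ℝ)) * Y with hZdef
  have hZ : 0 ≤ Z := by positivity
  have hYZ : Y = (n : ℝ) ^ (d : ℝ) * Z := by
    rw [hZdef, ← mul_assoc, ← Real.rpow_add hN]; simp
  have h2 : bondEnergy ω (box y ρ) w ≤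
      C1 * (A * (n : ℝ) ^ ((d : ℝ) - 2) * R ^ (2 : ℝ) * Z ^ (1 - P)) := by
    refine h1.trans ?_
    have hM := Real.rpow_le_rpow (bondMass_nonneg hW.a_nonneg _)
      ((bondMass_mono hW.a_nonneg hsub').trans hW.mass_a) hP
    rw [Real.mul_rpow (by positivity) (by positivity), ← Real.rpow_mul hN.le] at hM
    have hLR : (((σ : ℝ) - ρ) ^ 2)⁻¹ = R ^ (2 : ℝ) * (n : ℝ) ^ (-2 : ℝ) := by
      rw [hR, Real.rpow_neg hN.le, Real.rpow_two, Real.rpow_two]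
      field_simp
    rw [div_eq_mul_inv, hLR, hYZ, Real.mul_rpow (by positivity) hZ, ← Real.rpow_mul hN.le]
    calc _ ≤ 48 * (d : ℝ) * (A * ((d * 5 ^ d : ℝ) ^ P * (n : ℝ) ^ ((d : ℝ) * P)) *
          ((n : ℝ) ^ ((d : ℝ) * (1 - P)) * Z ^ (1 - P)) * (R ^ (2 : ℝ) * (n : ℝ) ^ (-2 : ℝ))) := by
          gcongr
      _ = C1 * (A * ((n : ℝ) ^ ((d : ℝ) * P) * (n : ℝ) ^ ((d : ℝ) * (1 - P)) *
          (n : ℝ) ^ (-2 : ℝ)) * R ^ (2 : ℝ) * Z ^ (1 - P)) := by rw [hC1def]; ring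
      _ = _ := by
          rw [← Real.rpow_add hN, ← Real.rpow_add hN]
          ring_nf
  have h3 := h.sum_grad_le_of_bondEnergy_le hn hW (hρσ.le.trans hσ) hC1 hR0.le (by positivity) h2
  rw [← hC3, ← Real.rpow_mul hZ, ← mul_div_assoc (1 - P)] at h3
  set θ := (1 - P) * t / 2 with hθ
  have hθ0 : 0 ≤ θ := by positivity
  have hθ1 : θ ≤ 1 := by rw [hθ]; nlinarith
  have hAB : 1 ≤ (A * B) ^ (t / 2) := Real.one_le_rpow hW.one_le_mul (by positivity)
  set k := 2 * (t / 2) with hk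
  have hk0 : 0 ≤ k := by positivity
  have hRk : 1 ≤ R ^ k := Real.one_le_rpow hR1 hk0
  have h4 : ∑ x ∈ box y ρ, (w x / n) ^ t ≤ 5 ^ d * ((n : ℝ) ^ ((d : ℝ) - t) * Z ^ θ) := by
    refine le_trans (Finset.sum_le_sum_of_subset_of_nonneg (box_subset_box y hρσ.le)
      fun x _ _ => Real.rpow_nonneg (div_nonneg (hw x) hN.le) _) ?_
    rw [sum_div_rpow_eq hn _ hw]
    have h5 := sum_rpow_le_box hθ0 hθ1 (q := t) (r := 2 / (1 - P)) (by rw [hθ]; field_simp)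
      y hn hσ hw
    rw [← hYdef, hYZ, Real.mul_rpow (by positivity) hZ, ← Real.rpow_mul hN.le] at h5
    refine (mul_le_mul_of_nonneg_left h5 (by positivity)).trans (le_of_eq ?_)
    have : (n : ℝ) ^ ((d : ℝ) - t) =
        (n : ℝ) ^ (-t) * (n : ℝ) ^ ((d : ℝ) * (1 - θ)) * (n : ℝ) ^ ((d : ℝ) * θ) := by
      rw [← Real.rpow_add hN, ← Real.rpow_add hN]; ring_nf
    rw [this]; ring
  have h5 : sobEnergy t n (box y ρ) w ≤
      (n : ℝ) ^ ((d : ℝ) - t) * ((C3 + 5 ^ d) * ((A * B) ^ (t / 2) * R ^ k * Z ^ θ)) := by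
    rw [sobEnergy_eq]
    have hge : (n : ℝ) ^ ((d : ℝ) - t) * Z ^ θ ≤
        (n : ℝ) ^ ((d : ℝ) - t) * ((A * B) ^ (t / 2) * R ^ k * Z ^ θ) := by
      refine mul_le_mul_of_nonneg_left (le_mul_of_one_le_left (by positivity) ?_) (by positivity)
      exact one_le_mul_of_one_le_of_one_le hAB hRk
    have h6 := h4.trans (mul_le_mul_of_nonneg_left hge (by positivity))
    refine (add_le_add h3 h6).trans (le_of_eq ?_)
    ring
  rw [scaledEnergy]
  refine (mul_le_mul_of_nonneg_left h5 (by positivity)).trans ?_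
  rw [← mul_assoc, ← Real.rpow_add hN, show t - (d : ℝ) + (d - t) = 0 by ring, Real.rpow_zero,
    one_mul]
  refine mul_le_mul_of_nonneg_right (by linarith) ?_
  have : 0 < A * B := mul_pos hW.A_pos hW.B_pos
  positivity

end IterExponents

/-! ### Moser iteration -/

/-- Iterating a superlinear recursion with geometrically growing constants. -/
theorem iterate_superlinear {E : ℕ → ℝ} {D b δ : ℝ} (hE : ∀ k, 0 ≤ E k) (hD : 1 ≤ D) (hb : 1 ≤ b)
    (hδ : 0 < δ) {K : ℕ} (step : ∀ k < K, E (k + 1) ≤ D * b ^ (k : ℝ) * E k ^ (1 + δ)) :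
    ∀ k ≤ K, D ^ (1 / δ) * b ^ (k / δ + 1 / δ ^ 2) * E k ≤
      (D ^ (1 / δ) * b ^ (1 / δ ^ 2) * E 0) ^ ((1 + δ) ^ k) := by
  have hD0 : 0 < D := by linarith
  have hb0 : 0 < b := by linarith
  intro k
  induction k with
  | zero => intro _; simp
  | succ k ih =>
    intro hk
    have h1 := ih (by omega)
    have h2 := step k (by omega)
    have h3 := Real.rpow_le_rpow (mul_nonneg (by positivity) (hE k)) h1
      (by linarith : 0 ≤ 1 + δ)
    have h0 : 0 ≤ D ^ (1 / δ) * b ^ (1 / δ ^ 2) * E 0 := mul_nonneg (by positivity) (hE 0)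
    rw [← Real.rpow_mul h0, ← pow_succ,
      Real.mul_rpow (by positivity) (hE k), Real.mul_rpow (by positivity) (by positivity),
      ← Real.rpow_mul hD0.le, ← Real.rpow_mul hb0.le] at h3
    refine le_trans ?_ h3
    refine (mul_le_mul_of_nonneg_left h2 (by positivity)).trans (le_of_eq ?_)
    -- The prefactors are chosen so that the normalized quantities satisfy `X (k + 1) ≤ X k ^ (1 +
    -- δ)`: raising them to the power `1 + δ` reproduces the next prefactor times exactly `D * b ^
    -- k`.
    have e1 : D ^ (1 / δ * (1 + δ)) = D ^ (1 / δ) * D := by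
      rw [← Real.rpow_add_one hD0.ne']
      congr 1
      field_simp
    have e2 : b ^ ((k / δ + 1 / δ ^ 2) * (1 + δ)) =
        b ^ (((k + 1 : ℕ) : ℝ) / δ + 1 / δ ^ 2) * b ^ (k : ℝ) := by
      rw [← Real.rpow_add hb0]
      congr 1
      push_cast
      field_simp
      ring
    rw [e1, e2]
    ring

theorem half_sub_half_ge {m : ℕ} : (m : ℝ) / 2 ≤ (m : ℝ) - ((m / 2 : ℕ) : ℝ) := by
  have : ((m / 2 : ℕ) : ℝ) ≤ (m : ℝ) / 2 := by exact_mod_cast Nat.cast_div_le (α := ℝ)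
  linarith

/-- Dyadic radii with integer division keep gaps comparable to `L / 2 ^ j` as long as `2 ^ j ≤ L`,
since rounding down then loses at most a factor `2`. -/
theorem div_pow_sub_ge {L j : ℕ} (h : 2 ^ j ≤ L) :
    (L : ℝ) / (4 * 2 ^ j) ≤ ((L / 2 ^ j : ℕ) : ℝ) - ((L / 2 ^ (j + 1) : ℕ) : ℝ) := by
  have h1 : L / 2 ^ (j + 1) = L / 2 ^ j / 2 := by rw [pow_succ, Nat.div_div_eq_div_mul]
  rw [h1]
  have h2 := half_sub_half_ge (m := L / 2 ^ j)
  have h3 : (L : ℝ) ≤ 2 ^ j * (2 * ((L / 2 ^ j : ℕ) : ℝ)) := by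
    have hm : 1 ≤ L / 2 ^ j := (Nat.one_le_div_iff (by positivity)).2 h
    have := Nat.div_add_mod L (2 ^ j)
    have h4 : L % 2 ^ j < 2 ^ j := Nat.mod_lt _ (by positivity)
    have h5 : L ≤ 2 ^ j * (2 * (L / 2 ^ j)) := by nlinarith
    exact_mod_cast h5
  refine le_trans ?_ h2
  rw [div_le_div_iff₀ (by positivity) (by norm_num)]
  nlinarith

namespace IterExponents

variable {d : ℕ} {P Q δ t s : ℝ}

/-- Moser iteration: local boundedness in terms of the `2p'`-average. -/
theorem exists_le_sum_rpow (h : IterExponents d P Q δ t s) :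
    ∃ C κ : ℝ, 1 ≤ C ∧ 0 ≤ κ ∧
      ∀ (A B : ℝ) (y : LatticePt d) (n : ℕ) (ω a b : Bond d → ℝ), 1 ≤ n →
      WeightBound P Q A B y n ω a b →
      ∀ w : LatticePt d → ℝ, (∀ x, 0 ≤ w x) →
      (∀ x, divStar (fun b => ω b * grad w b) x ≤ 0) →
      ∀ (ρ σ : ℕ), n ≤ ρ → ρ < σ → σ ≤ 2 * n → ∀ x ∈ box y ρ,
      w x ≤ C * ((A * B) ^ ((1 + δ) / (2 * δ)) * ((n : ℝ) / ((σ : ℝ) - ρ)) ^ κ *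
          ((n : ℝ) ^ (-(d : ℝ)) * ∑ x ∈ box y σ, w x ^ (2 / (1 - P))) ^ ((1 - P) / 2)) := by
  obtain ⟨C1, κ1, hC1, hκ1, H1⟩ := h.exists_scaledEnergy_step
  obtain ⟨C0, κ0, hC0, hκ0, H0⟩ := h.exists_scaledEnergy_start
  have ht1 := h.one_le_t
  have ht0 : 0 < t := by linarith
  have hδ := h.δ_pos
  have hd := h.three_le_cast
  have hP1 : 0 < 1 - P := by linarith [h.P_lt]
  -- The surplus `d * δ` makes `b ^ (K / δ)` dominate `2 ^ (d * K)`, which absorbs the volume factor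
  -- `n ^ d` in the last step.
  set κ : ℝ := κ1 + d * δ with hκ
  have hκ0' : 0 < κ := by positivity
  set b : ℝ := 2 ^ κ with hb
  have hb1 : 1 ≤ b := Real.one_le_rpow (by norm_num) hκ0'.le
  set C2 : ℝ := C1 * 8 ^ κ with hC2
  have hC21 : 1 ≤ C2 := one_le_mul_of_one_le_of_one_le hC1 (Real.one_le_rpow (by norm_num) hκ0'.le)
  set C3 : ℝ := 2 ^ d * C2 ^ (1 / δ) * b ^ (1 / δ ^ 2) * C0 * 2 ^ κ0 with hC3
  have hC31 : 1 ≤ C3 := by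
    have k1 : (1 : ℝ) ≤ 2 ^ d := one_le_pow₀ (by norm_num)
    have k2 : 1 ≤ C2 ^ (1 / δ) := Real.one_le_rpow hC21 (by positivity)
    have k3 : 1 ≤ b ^ (1 / δ ^ 2) := Real.one_le_rpow hb1 (by positivity)
    have k4 : (1 : ℝ) ≤ 2 ^ κ0 := Real.one_le_rpow (by norm_num) hκ0.le
    exact one_le_mul_of_one_le_of_one_le (one_le_mul_of_one_le_of_one_le
      (one_le_mul_of_one_le_of_one_le (one_le_mul_of_one_le_of_one_le k1 k2) k3) hC0) k4
  refine ⟨C3 ^ (1 / t), (d + κ * (1 / δ) + κ0) * (1 / t), Real.one_le_rpow hC31 (by positivity),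
    by positivity, ?_⟩
  intro A B y n ω a' b' hn hW w hw hsub ρ σ hnρ hρσ hσ x hx
  have hN : (0 : ℝ) < n := by exact_mod_cast hn
  obtain ⟨L, rfl⟩ : ∃ L, σ = ρ + L := ⟨σ - ρ, by omega⟩
  have hL1 : 1 ≤ L := by omega
  have hL0 : (0 : ℝ) < L := by exact_mod_cast hL1
  have eL : ((ρ + L : ℕ) : ℝ) - ρ = L := by push_cast; ring
  rw [eL]
  set R : ℝ := (n : ℝ) / L with hR
  have hLn : (L : ℝ) ≤ n := by
    have : L ≤ n := by omega
    exact_mod_cast this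
  have hR1 : 1 ≤ R := by rw [hR, le_div_iff₀ hL0]; linarith
  have hR0 : 0 < R := by linarith
  set Λ := A * B with hΛ
  have hΛ1 : 1 ≤ Λ := hW.one_le_mul
  have hΛ0 : 0 < Λ := by linarith
  set Z := (n : ℝ) ^ (-(d : ℝ)) * ∑ x ∈ box y (ρ + L), w x ^ (2 / (1 - P)) with hZ
  have hZ0 : 0 ≤ Z := mul_nonneg (by positivity)
    (Finset.sum_nonneg fun x _ => Real.rpow_nonneg (hw x) _)
  -- The number of halvings before the width reaches zero: the radius after `K` steps is exactly
  -- `ρ`.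
  set K := Nat.log 2 L with hK
  have hKle : 2 ^ K ≤ L := Nat.pow_log_le_self 2 (by omega)
  have hKlt : L < 2 ^ (K + 1) := Nat.lt_pow_succ_log_self (by norm_num) L
  let rad : ℕ → ℕ := fun k => ρ + L / 2 ^ (k + 1)
  let E : ℕ → ℝ := fun k => scaledEnergy t n (box y (rad k)) (fun x => w x ^ ((1 + δ) ^ k))
  have hE : ∀ k, 0 ≤ E k := fun k => scaledEnergy_nonneg _ fun x => Real.rpow_nonneg (hw x) _
  set D : ℝ := C2 * (Λ ^ (t / 2) * R ^ κ) with hD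
  have hD1 : 1 ≤ D := one_le_mul_of_one_le_of_one_le hC21 (one_le_mul_of_one_le_of_one_le
    (Real.one_le_rpow hΛ1 (by positivity)) (Real.one_le_rpow hR1 hκ0'.le))
  have step : ∀ k < K, E (k + 1) ≤ D * b ^ (k : ℝ) * E k ^ (1 + δ) := by
    intro k hk
    have hpow : 2 ^ (k + 1) ≤ L := (Nat.pow_le_pow_right (by norm_num) hk).trans hKle
    have hdiff := div_pow_sub_ge hpow
    have hposd : (0 : ℝ) < (L : ℝ) / (4 * 2 ^ (k + 1)) := by positivity
    have hlt : L / 2 ^ (k + 1 + 1) < L / 2 ^ (k + 1) := by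
      have : ((L / 2 ^ (k + 1 + 1) : ℕ) : ℝ) < ((L / 2 ^ (k + 1) : ℕ) : ℝ) := by linarith
      exact_mod_cast this
    have hrad : rad k ≤ 2 * n := by
      have : L / 2 ^ (k + 1) ≤ L := Nat.div_le_self _ _
      simp only [rad]; omega
    have h1 := H1 A B y n ω a' b' hn hW w hw hsub ((1 + δ) ^ k) (one_le_pow₀ (by linarith))
      (rad (k + 1)) (rad k) (hnρ.trans (Nat.le_add_right _ _)) (Nat.add_lt_add_left hlt ρ) hrad
    have e1 : (fun x => (w x ^ ((1 + δ) ^ k)) ^ (1 + δ)) = fun x => w x ^ ((1 + δ) ^ (k + 1)) :=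
      funext fun x => by rw [← Real.rpow_mul (hw x), pow_succ]
    rw [e1] at h1
    refine h1.trans ?_
    have e2 : ((rad k : ℕ) : ℝ) - (rad (k + 1) : ℕ) =
        ((L / 2 ^ (k + 1) : ℕ) : ℝ) - ((L / 2 ^ (k + 1 + 1) : ℕ) : ℝ) := by
      simp only [rad]
      rw [Nat.cast_add, Nat.cast_add]; ring
    rw [e2]
    set Lk := ((L / 2 ^ (k + 1) : ℕ) : ℝ) - ((L / 2 ^ (k + 1 + 1) : ℕ) : ℝ) with hLk
    have hLk0 : 0 < Lk := by linarith
    have hRk : (n : ℝ) / Lk ≤ 8 * R * 2 ^ k := by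
      rw [div_le_iff₀ hLk0, hR]
      calc (n : ℝ) = 8 * (n / L) * 2 ^ k * (L / (4 * 2 ^ (k + 1))) := by
            field_simp; ring
        _ ≤ _ := by gcongr
    have hRk1 : 1 ≤ (n : ℝ) / Lk := by
      rw [le_div_iff₀ hLk0]
      have : ((L / 2 ^ (k + 1) : ℕ) : ℝ) ≤ L := by exact_mod_cast Nat.div_le_self _ _
      have : (0 : ℝ) ≤ ((L / 2 ^ (k + 1 + 1) : ℕ) : ℝ) := by positivity
      linarith
    have hpw : ((n : ℝ) / Lk) ^ κ1 ≤ 8 ^ κ * R ^ κ * b ^ (k : ℝ) := by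
      calc ((n : ℝ) / Lk) ^ κ1 ≤ ((n : ℝ) / Lk) ^ κ :=
            Real.rpow_le_rpow_of_exponent_le hRk1 (by rw [hκ]; nlinarith)
        _ ≤ (8 * R * 2 ^ k) ^ κ := Real.rpow_le_rpow (by positivity) hRk hκ0'.le
        _ = _ := by
            rw [Real.mul_rpow (by positivity) (by positivity), Real.mul_rpow (by norm_num) hR0.le,
              hb, ← Real.rpow_natCast 2 k, ← Real.rpow_mul (by norm_num),
              ← Real.rpow_mul (by norm_num), mul_comm κ]
    have hEk := Real.rpow_nonneg (hE k) (1 + δ)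
    calc _ ≤ C1 * (Λ ^ (t / 2) * (8 ^ κ * R ^ κ * b ^ (k : ℝ)) * E k ^ (1 + δ)) := by gcongr
      _ = _ := by rw [hD, hC2]; ring
  have iter := iterate_superlinear hE hD1 hb1 hδ step K le_rfl
  set Z0 := D ^ (1 / δ) * b ^ (1 / δ ^ 2) * E 0 with hZ0def
  have hZ00 : 0 ≤ Z0 := mul_nonneg (by positivity) (hE 0)
  set χK : ℝ := (1 + δ) ^ K with hχK
  have hχK1 : 1 ≤ χK := one_le_pow₀ (by linarith)
  have hradK : rad K = ρ := by
    simp only [rad]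
    rw [Nat.div_eq_of_lt hKlt, add_zero]
  -- the pointwise bound at the last step
  have hpt : (w x ^ χK) ^ t ≤ (n : ℝ) ^ (d : ℝ) * E K := by
    have h1 := sum_rpow_le_scaledEnergy t hn (box y (rad K))
      (v := fun x => w x ^ χK) (fun x => Real.rpow_nonneg (hw x) _)
    refine le_trans ?_ h1
    exact Finset.single_le_sum (f := fun x => (w x ^ χK) ^ t)
      (fun z _ => Real.rpow_nonneg (Real.rpow_nonneg (hw z) _) _) (by rw [hradK]; exact hx)
  have hbK : (2 : ℝ) ^ ((d : ℝ) * K) ≤ b ^ ((K : ℝ) / δ + 1 / δ ^ 2) := by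
    rw [hb, ← Real.rpow_mul (by norm_num)]
    refine Real.rpow_le_rpow_of_exponent_le (by norm_num) ?_
    have e : (d : ℝ) * K = (d * δ) * (K / δ) := by field_simp
    rw [e]
    refine mul_le_mul (by rw [hκ]; linarith) (by linarith [show 0 ≤ 1 / δ ^ 2 by positivity])
      (by positivity) hκ0'.le
  have hnd : (n : ℝ) ^ (d : ℝ) ≤ (2 * R) ^ d * 2 ^ ((d : ℝ) * K) := by
    have h1 : (n : ℝ) ≤ 2 * R * 2 ^ K := by
      have : (L : ℝ) ≤ 2 ^ (K + 1) := by exact_mod_cast hKlt.le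
      calc (n : ℝ) = R * L := by rw [hR]; field_simp
        _ ≤ R * 2 ^ (K + 1) := by gcongr
        _ = _ := by ring
    rw [mul_comm (d : ℝ), Real.rpow_mul (by norm_num), Real.rpow_natCast, Real.rpow_natCast,
      Real.rpow_natCast, ← mul_pow]
    exact pow_le_pow_left₀ hN.le h1 d
  have hbound : (w x ^ χK) ^ t ≤ ((2 * R) ^ d * Z0) ^ χK := by
    calc (w x ^ χK) ^ t ≤ (n : ℝ) ^ (d : ℝ) * E K := hpt
      _ ≤ (2 * R) ^ d * 2 ^ ((d : ℝ) * K) * E K := mul_le_mul_of_nonneg_right hnd (hE K)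
      _ ≤ (2 * R) ^ d * b ^ ((K : ℝ) / δ + 1 / δ ^ 2) * E K := by
          have := hE K
          gcongr
      _ = (2 * R) ^ d * (1 * b ^ ((K : ℝ) / δ + 1 / δ ^ 2) * E K) := by ring
      _ ≤ (2 * R) ^ d * (D ^ (1 / δ) * b ^ ((K : ℝ) / δ + 1 / δ ^ 2) * E K) := by
          have := hE K
          have : 1 ≤ D ^ (1 / δ) := Real.one_le_rpow hD1 (by positivity)
          gcongr
      _ ≤ (2 * R) ^ d * Z0 ^ χK := by gcongr
      _ ≤ ((2 * R) ^ d) ^ χK * Z0 ^ χK := by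
          refine mul_le_mul_of_nonneg_right ?_ (Real.rpow_nonneg hZ00 _)
          have h1 : 1 ≤ (2 * R) ^ d := one_le_pow₀ (by linarith)
          calc (2 * R) ^ d = ((2 * R) ^ d) ^ (1 : ℝ) := (Real.rpow_one _).symm
            _ ≤ _ := Real.rpow_le_rpow_of_exponent_le h1 hχK1
      _ = _ := (Real.mul_rpow (by positivity) hZ00).symm
  have hwt : w x ^ t ≤ (2 * R) ^ d * Z0 := by
    rw [← Real.rpow_mul (hw x), mul_comm, Real.rpow_mul (hw x)] at hbound
    exact (Real.rpow_le_rpow_iff (Real.rpow_nonneg (hw x) _)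
      (mul_nonneg (by positivity) hZ00) (by linarith)).1 hbound
  -- the first step
  have hE0 : E 0 ≤ C0 * (Λ ^ (t / 2) * (2 * R) ^ κ0 * Z ^ ((1 - P) * t / 2)) := by
    have hhalf := half_sub_half_ge (m := L)
    have hlt : L / 2 < L := Nat.div_lt_self (by omega) (by norm_num)
    have h1 := H0 A B y n ω a' b' hn hW w hw hsub (rad 0) (ρ + L) (by simp only [rad]; omega)
      (by simp only [rad, zero_add, pow_one]; omega) hσ
    have e1 : E 0 = scaledEnergy t n (box y (rad 0)) w := by simp [E]
    rw [e1]
    refine h1.trans ?_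
    have e2 : ((ρ + L : ℕ) : ℝ) - (rad 0 : ℕ) = (L : ℝ) - ((L / 2 : ℕ) : ℝ) := by
      simp only [rad, zero_add, pow_one]
      rw [Nat.cast_add, Nat.cast_add]; ring
    rw [e2]
    have hpos : 0 < (L : ℝ) - ((L / 2 : ℕ) : ℝ) := by linarith
    have h2 : (n : ℝ) / ((L : ℝ) - ((L / 2 : ℕ) : ℝ)) ≤ 2 * R := by
      rw [div_le_iff₀ hpos, hR]
      calc (n : ℝ) = 2 * (n / L) * (L / 2) := by field_simp
        _ ≤ _ := by gcongr
    gcongr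
  have hfin : w x ^ t ≤ C3 * Λ ^ (t / 2 * ((1 + δ) / δ)) * R ^ (d + κ * (1 / δ) + κ0) *
      Z ^ ((1 - P) * t / 2) := by
    refine hwt.trans ?_
    have e1 : D ^ (1 / δ) = C2 ^ (1 / δ) * (Λ ^ (t / 2 * (1 / δ)) * R ^ (κ * (1 / δ))) := by
      rw [hD, Real.mul_rpow (x := C2) (by positivity) (by positivity),
        Real.mul_rpow (x := Λ ^ (t / 2)) (by positivity) (by positivity), ← Real.rpow_mul hΛ0.le,
        ← Real.rpow_mul hR0.le]
    have e2 : Λ ^ (t / 2 * ((1 + δ) / δ)) = Λ ^ (t / 2 * (1 / δ)) * Λ ^ (t / 2) := by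
      rw [← Real.rpow_add hΛ0]
      congr 1
      field_simp
    have e3 : R ^ ((d : ℝ) + κ * (1 / δ) + κ0) = R ^ d * R ^ (κ * (1 / δ)) * R ^ κ0 := by
      rw [Real.rpow_add hR0, Real.rpow_add hR0, Real.rpow_natCast]
    calc (2 * R) ^ d * Z0 ≤ (2 * R) ^ d * (D ^ (1 / δ) * b ^ (1 / δ ^ 2) *
          (C0 * (Λ ^ (t / 2) * (2 * R) ^ κ0 * Z ^ ((1 - P) * t / 2)))) := by
          rw [hZ0def]
          gcongr
      _ = _ := by
          rw [e1, e2, e3, hC3, mul_pow, Real.mul_rpow (by norm_num) hR0.le]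
          ring
  have h6 := Real.rpow_le_rpow (Real.rpow_nonneg (hw x) _) hfin (by positivity : 0 ≤ 1 / t)
  rw [← Real.rpow_mul (hw x), mul_one_div_cancel ht0.ne', Real.rpow_one] at h6
  refine h6.trans (le_of_eq ?_)
  rw [Real.mul_rpow (by positivity) (by positivity), mul_rpow_mul_rpow_rpow (by positivity) hΛ0.le
    hR0.le, ← Real.rpow_mul hZ0]
  have e4 : t / 2 * ((1 + δ) / δ) * (1 / t) = (1 + δ) / (2 * δ) := by field_simp
  have e5 : (1 - P) * t / 2 * (1 / t) = (1 - P) / 2 := by field_simp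
  rw [e4, e5]
  ring

/-! ### From the `2p'`-average to the `L¹`-average -/

/-- Local boundedness in terms of the `L¹`-average. -/
theorem exists_le_sum (h : IterExponents d P Q δ t s) :
    ∃ C : ℝ, 1 ≤ C ∧
      ∀ (A B : ℝ) (y : LatticePt d) (n : ℕ) (ω a b : Bond d → ℝ), 1 ≤ n →
      WeightBound P Q A B y n ω a b →
      ∀ w : LatticePt d → ℝ, (∀ x, 0 ≤ w x) →
      (∀ x, divStar (fun b => ω b * grad w b) x ≤ 0) → ∀ x ∈ box y n,
      w x ≤ C * (A * B) ^ (1 / (1 - P) * ((δ + 1) / δ)) *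
        ((n : ℝ) ^ (-(d : ℝ)) * ∑ x ∈ box y (2 * n), w x) := by
  obtain ⟨C1, κ1, hC1, hκ1, H1⟩ := h.exists_le_sum_rpow
  have hδ := h.δ_pos
  have hP := h.P_nonneg
  have hP1 : 0 < 1 - P := by linarith [h.P_lt]
  set lam : ℝ := (1 - P) / 2 with hlam
  have hlam0 : 0 < lam := by positivity
  have hlam1 : lam ≤ 1 / 2 := by rw [hlam]; linarith
  -- The added `d` makes `μ ^ J` at least `n ^ d`, so that the crude bound on the outermost box can
  -- start the induction.
  set κ : ℝ := κ1 + d with hκ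
  have hκ0 : 0 ≤ κ := by positivity
  set μ : ℝ := 2 ^ (κ / lam) with hμ
  have hμ1 : 1 ≤ μ := Real.one_le_rpow (by norm_num) (by positivity)
  have hμ0 : 0 < μ := by linarith
  set C2 : ℝ := C1 * 4 ^ κ with hC2
  have hC21 : 1 ≤ C2 := one_le_mul_of_one_le_of_one_le hC1 (Real.one_le_rpow (by norm_num) hκ0)
  refine ⟨C2 ^ (1 / lam) * μ ^ ((1 - lam) / lam), one_le_mul_of_one_le_of_one_le
    (Real.one_le_rpow hC21 (by positivity)) (Real.one_le_rpow hμ1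
      (div_nonneg (by linarith) hlam0.le)), ?_⟩
  intro A B y n ω a b hn hW w hw hsub
  have hN : (0 : ℝ) < n := by exact_mod_cast hn
  set Λ := A * B with hΛ
  have hΛ1 : 1 ≤ Λ := hW.one_le_mul
  have hΛ0 : 0 < Λ := by linarith
  set S := (n : ℝ) ^ (-(d : ℝ)) * ∑ x ∈ box y (2 * n), w x with hS
  have hS0 : 0 ≤ S := mul_nonneg (by positivity) (Finset.sum_nonneg fun x _ => hw x)
  set D : ℝ := C2 * Λ ^ ((1 + δ) / (2 * δ)) with hD
  have hD1 : 1 ≤ D := one_le_mul_of_one_le_of_one_le hC21 (Real.one_le_rpow hΛ1 (by positivity))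
  have hD0 : 0 < D := by linarith
  -- The value for which the ansatz `H * μ ^ j` is a fixed point of `M j = D * μ ^ (lam * j) * S ^
  -- lam * M (j + 1) ^ (1 - lam)`.
  set H : ℝ := D ^ (1 / lam) * μ ^ ((1 - lam) / lam) * S with hH
  have hH0 : 0 ≤ H := by positivity
  set J := Nat.log 2 n + 1 with hJ
  have hJlt : n < 2 ^ J := Nat.lt_pow_succ_log_self (by norm_num) n
  let rad : ℕ → ℕ := fun j => 2 * n - n / 2 ^ j
  have hrad : ∀ j, n ≤ rad j ∧ rad j ≤ 2 * n := fun j => by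
    have := Nat.div_le_self n (2 ^ j)
    simp only [rad]
    generalize n / 2 ^ j = q at *
    omega
  -- Induction inwards from the box of radius `2n`, which is `rad J` because `n < 2 ^ J`; there a
  -- point value is bounded by the whole sum.
  have hclaim : ∀ i ≤ J, ∀ x ∈ box y (rad (J - i)), w x ≤ H * μ ^ (((J - i : ℕ)) : ℝ) := by
    intro i
    induction i with
    | zero =>
      intro _ x hx
      have e : rad (J - 0) = 2 * n := by
        simp only [rad, Nat.sub_zero, Nat.div_eq_of_lt hJlt]
      rw [e] at hx
      have h1 : w x ≤ ∑ x ∈ box y (2 * n), w x :=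
        Finset.single_le_sum (f := w) (fun z _ => hw z) hx
      have h2 : ∑ x ∈ box y (2 * n), w x = (n : ℝ) ^ (d : ℝ) * S := by
        rw [hS, ← mul_assoc, ← Real.rpow_add hN]; simp
      have h3 : (n : ℝ) ^ (d : ℝ) ≤ μ ^ (J : ℝ) := by
        have k1 : (n : ℝ) ^ (d : ℝ) ≤ (2 ^ (d : ℝ)) ^ (J : ℝ) := by
          rw [← Real.rpow_mul (by norm_num), mul_comm, Real.rpow_mul (by norm_num)]
          refine Real.rpow_le_rpow hN.le ?_ (by positivity)
          rw [Real.rpow_natCast]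
          exact_mod_cast hJlt.le
        refine k1.trans (Real.rpow_le_rpow (by positivity) ?_ (by positivity))
        refine Real.rpow_le_rpow_of_exponent_le (by norm_num) ?_
        rw [le_div_iff₀ hlam0]
        have : (d : ℝ) * lam ≤ d * 1 := by
          refine mul_le_mul_of_nonneg_left (by linarith) (by positivity)
        linarith
      have h4 : S ≤ H := by
        rw [hH]
        refine le_mul_of_one_le_left hS0 (one_le_mul_of_one_le_of_one_le
          (Real.one_le_rpow hD1 (by positivity)) (Real.one_le_rpow hμ1
            (div_nonneg (by linarith) hlam0.le)))
      rw [Nat.sub_zero]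
      calc w x ≤ (n : ℝ) ^ (d : ℝ) * S := h1.trans h2.le
        _ ≤ μ ^ (J : ℝ) * H := by gcongr
        _ = _ := mul_comm _ _
    | succ i ih =>
      intro hi x hx
      have ih' := ih (by omega)
      obtain ⟨j, hj⟩ : ∃ j, J - (i + 1) = j := ⟨_, rfl⟩
      have hj1 : J - i = j + 1 := by omega
      have hjJ : j < J := by omega
      rw [hj] at hx ⊢
      rw [hj1] at ih'
      have hpow : 2 ^ j ≤ n :=
        (Nat.pow_le_pow_right (by norm_num) (by omega)).trans
          (Nat.pow_log_le_self 2 (by omega))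
      have hdiff := div_pow_sub_ge hpow
      have hposd : (0 : ℝ) < (n : ℝ) / (4 * 2 ^ j) := by positivity
      have hlt : n / 2 ^ (j + 1) < n / 2 ^ j := by
        have : ((n / 2 ^ (j + 1) : ℕ) : ℝ) < ((n / 2 ^ j : ℕ) : ℝ) := by linarith
        exact_mod_cast this
      have hle : n / 2 ^ j ≤ n := Nat.div_le_self _ _
      have h1 := H1 A B y n ω a b hn hW w hw hsub (rad j) (rad (j + 1))
        (hrad j).1 (by simp only [rad]; generalize n / 2 ^ j = q1 at *; omega) (hrad (j + 1)).2 x hx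
      have e2 : ((rad (j + 1) : ℕ) : ℝ) - (rad j : ℕ) =
          ((n / 2 ^ j : ℕ) : ℝ) - ((n / 2 ^ (j + 1) : ℕ) : ℝ) := by
        simp only [rad]
        rw [Nat.cast_sub (by omega), Nat.cast_sub (by omega)]; ring
      rw [e2] at h1
      set Lj := ((n / 2 ^ j : ℕ) : ℝ) - ((n / 2 ^ (j + 1) : ℕ) : ℝ) with hLj
      have hLj0 : 0 < Lj := by linarith
      have hRj : (n : ℝ) / Lj ≤ 4 * 2 ^ j := by
        rw [div_le_iff₀ hLj0]
        calc (n : ℝ) = 4 * 2 ^ j * (n / (4 * 2 ^ j)) := by field_simp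
          _ ≤ _ := by gcongr
      have hRj1 : 1 ≤ (n : ℝ) / Lj := by
        rw [le_div_iff₀ hLj0]
        have : ((n / 2 ^ j : ℕ) : ℝ) ≤ n := by exact_mod_cast hle
        have : (0 : ℝ) ≤ ((n / 2 ^ (j + 1) : ℕ) : ℝ) := by positivity
        linarith
      have hpw : ((n : ℝ) / Lj) ^ κ1 ≤ 4 ^ κ * μ ^ (lam * j) := by
        calc ((n : ℝ) / Lj) ^ κ1 ≤ ((n : ℝ) / Lj) ^ κ :=
              Real.rpow_le_rpow_of_exponent_le hRj1 (by rw [hκ]; simp)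
          _ ≤ (4 * 2 ^ j) ^ κ := Real.rpow_le_rpow (by positivity) hRj hκ0
          _ = _ := by
              rw [Real.mul_rpow (by positivity) (by positivity), hμ, ← Real.rpow_natCast 2 j,
                ← Real.rpow_mul (by norm_num), ← Real.rpow_mul (by norm_num)]
              congr 2
              field_simp
      set G := H * μ ^ ((j + 1 : ℕ) : ℝ) with hG
      have hG0 : 0 ≤ G := by positivity
      -- Interpolation: one power of `w` is kept for the `L^1` average and the remaining `1 / lam -
      -- 1` powers are replaced by the bound `G` on the larger box.
      have hZ : (n : ℝ) ^ (-(d : ℝ)) * ∑ x ∈ box y (rad (j + 1)), w x ^ (2 / (1 - P)) ≤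
          S * G ^ (1 / lam - 1) := by
        rw [hS, mul_assoc, Finset.sum_mul]
        refine mul_le_mul_of_nonneg_left ?_ (by positivity)
        have hq : 2 / (1 - P) = 1 + (1 / lam - 1) := by rw [hlam]; field_simp; ring
        have hq0 : 0 ≤ 1 / lam - 1 := by
          have : 1 ≤ 1 / lam := by rw [le_div_iff₀ hlam0]; linarith
          linarith
        refine (Finset.sum_le_sum fun z hz => ?_).trans (Finset.sum_le_sum_of_subset_of_nonneg
          (box_subset_box y (hrad (j + 1)).2)
          fun z _ _ => mul_nonneg (hw z) (Real.rpow_nonneg hG0 _))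
        rw [hq, Real.rpow_add_of_nonneg (hw z) zero_le_one hq0, Real.rpow_one]
        exact mul_le_mul_of_nonneg_left (Real.rpow_le_rpow (hw z) (ih' z hz) hq0) (hw z)
      have hZnn : 0 ≤ (n : ℝ) ^ (-(d : ℝ)) * ∑ x ∈ box y (rad (j + 1)), w x ^ (2 / (1 - P)) :=
        mul_nonneg (by positivity) (Finset.sum_nonneg fun z _ => Real.rpow_nonneg (hw z) _)
      have hZ'0 := Real.rpow_nonneg hZnn lam
      have hZ' : ((n : ℝ) ^ (-(d : ℝ)) * ∑ x ∈ box y (rad (j + 1)), w x ^ (2 / (1 - P))) ^ lam ≤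
          S ^ lam * G ^ (1 - lam) := by
        refine (Real.rpow_le_rpow hZnn hZ hlam0.le).trans (le_of_eq ?_)
        rw [Real.mul_rpow hS0 (by positivity), ← Real.rpow_mul hG0]
        congr 2
        field_simp
      clear_value G H S D
      calc w x ≤ C1 * (Λ ^ ((1 + δ) / (2 * δ)) * (4 ^ κ * μ ^ (lam * j)) *
            (S ^ lam * G ^ (1 - lam))) := by
            refine h1.trans ?_
            gcongr
        _ = D * μ ^ (lam * j) * (S ^ lam * G ^ (1 - lam)) := by rw [hD, hC2]; ring
        _ = (D * D ^ (1 / lam * (1 - lam))) * (μ ^ (lam * j) *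
            μ ^ ((1 - lam) / lam * (1 - lam)) * μ ^ (((j + 1 : ℕ) : ℝ) * (1 - lam))) *
            (S ^ lam * S ^ (1 - lam)) := by
            rw [hG, hH, Real.mul_rpow (by positivity) (by positivity),
              Real.mul_rpow (by positivity) hS0, Real.mul_rpow (by positivity) (by positivity),
              ← Real.rpow_mul hD0.le, ← Real.rpow_mul hμ0.le, ← Real.rpow_mul hμ0.le]
            ring
        _ = D ^ (1 / lam) * (μ ^ ((1 - lam) / lam) * μ ^ (j : ℝ)) * S := by
            have k1 : D * D ^ (1 / lam * (1 - lam)) = D ^ (1 / lam) := by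
              nth_rw 1 [← Real.rpow_one D]
              rw [← Real.rpow_add hD0]
              congr 1; field_simp; ring
            have k2 : S ^ lam * S ^ (1 - lam) = S := by
              rw [← Real.rpow_add_of_nonneg hS0 hlam0.le (by linarith)]
              simp
            rw [k1, k2, ← Real.rpow_add hμ0, ← Real.rpow_add hμ0, ← Real.rpow_add hμ0]
            congr 3
            push_cast
            field_simp
            ring
        _ = _ := by rw [hH]; ring
  intro x hx
  have hfin := hclaim J le_rfl x (by
    simp only [rad, Nat.sub_self, pow_zero, Nat.div_one]
    rwa [show 2 * n - n = n by omega])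
  rw [Nat.sub_self, Nat.cast_zero, Real.rpow_zero, mul_one] at hfin
  refine hfin.trans (le_of_eq ?_)
  rw [hH, hD, Real.mul_rpow (by positivity) (by positivity), ← Real.rpow_mul hΛ0.le]
  have e : (1 + δ) / (2 * δ) * (1 / lam) = 1 / (1 - P) * ((δ + 1) / δ) := by
    rw [hlam]; field_simp; ring
  rw [e]
  ring

end IterExponents

/-! ### Averaged norms and conclusion -/

theorem bondMass_eq_sum_bondsIn {d : ℕ} (a : Bond d → ℝ) (S : Finset (LatticePt d)) :
    bondMass a S = ∑ e ∈ bondsIn S, a e := by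
  rw [bondMass, bondsIn, Finset.sum_filter]
  rfl

theorem card_bondsIn_le {d : ℕ} (S : Finset (LatticePt d)) : (bondsIn S).card ≤ d * S.card := by
  refine (Finset.card_filter_le _ _).trans (le_of_eq ?_)
  rw [Finset.card_product]
  simp [mul_comm]

/-- A positive function `F` on a finite set is bounded by `‖F‖ₚ a ^ (1/p)` with `a` of average `1`,
uniformly in `p ∈ (0, ∞]`. -/
theorem exists_le_avgNorm_mul_rpow {κ : Type*} {p : ℝ≥0∞} (hp : p ≠ 0) {T : Finset κ}
    (hT : T.Nonempty) {F : κ → ℝ} (hF : ∀ e, 0 < F e) :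
    0 < avgNorm p T F ∧ ∃ a : κ → ℝ, (∀ e, 0 ≤ a e) ∧ ∑ e ∈ T, a e = T.card ∧
      ∀ e ∈ T, F e ≤ avgNorm p T F * a e ^ p⁻¹.toReal := by
  by_cases hpt : p = ∞
  · subst hpt
    have hle : ∀ e ∈ T, F e ≤ avgNorm ∞ T F := by
      intro e he
      rw [avgNorm, if_pos rfl]
      refine (le_abs_self _).trans ?_
      exact le_ciSup (f := fun a : T => |F a|) (Set.finite_range _).bddAbove ⟨e, he⟩
    obtain ⟨e0, he0⟩ := hT
    -- For `p = ∞` the exponent `p⁻¹.toReal` is `0`, so the factor `a ^ 0 = 1` is harmless and `a =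
    -- 1` has the required average.
    refine ⟨(hF e0).trans_le (hle e0 he0), fun _ => 1, fun _ => zero_le_one, by simp, ?_⟩
    simpa using hle
  · have hp0 : 0 < p.toReal := ENNReal.toReal_pos hp hpt
    have hc : (0 : ℝ) < T.card := by exact_mod_cast hT.card_pos
    set m : ℝ := (T.card : ℝ)⁻¹ * ∑ e ∈ T, |F e| ^ p.toReal with hm
    have hFp : ∀ e, 0 < |F e| ^ p.toReal := fun e => Real.rpow_pos_of_pos (abs_pos.2 (hF e).ne') _
    have hm0 : 0 < m := mul_pos (inv_pos.2 hc) (Finset.sum_pos (fun e _ => hFp e) hT)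
    have e1 : avgNorm p T F = m ^ (1 / p.toReal) := by rw [avgNorm, if_neg hpt]
    rw [e1]
    refine ⟨Real.rpow_pos_of_pos hm0 _, fun e => |F e| ^ p.toReal / m,
      fun e => (div_pos (hFp e) hm0).le, ?_, ?_⟩
    · rw [← Finset.sum_div, div_eq_iff hm0.ne', hm]
      field_simp
    · intro e _
      rw [ENNReal.toReal_inv, Real.div_rpow (hFp e).le hm0.le, ← Real.rpow_mul (abs_nonneg _),
        mul_inv_cancel₀ hp0.ne', Real.rpow_one, one_div, mul_div_cancel₀]
      · exact le_abs_self _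
      · exact (Real.rpow_pos_of_pos hm0 _).ne'

theorem bondsIn_box_nonempty {d : ℕ} (hd : 0 < d) (y : LatticePt d) {n : ℕ} (hn : 1 ≤ n) :
    (bondsIn (box y n)).Nonempty := by
  refine ⟨(y, ⟨0, hd⟩), (mem_bondsIn _ _).2 ?_⟩
  have hy : y ∈ box y n := (mem_box _ _ _).2 fun i => by simp
  exact ⟨hy, mem_box_add_single hy (by simp; omega)⟩

/-- The averaged norms of `ω` and `ω⁻¹` give a weight bound. -/
theorem exists_weightBound {d : ℕ} (hd : 0 < d) {p q : ℝ≥0∞} (hp : p ≠ 0) (hq : q ≠ 0)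
    (hpq : p⁻¹.toReal + q⁻¹.toReal ≤ 1) {ω : Bond d → ℝ} (hω : ∀ b, 0 < ω b) (y : LatticePt d)
    {n : ℕ} (hn : 1 ≤ n) :
    ∃ a b, WeightBound p⁻¹.toReal q⁻¹.toReal (avgNorm p (bondsIn (box y (2 * n))) ω)
      (avgNorm q (bondsIn (box y (2 * n))) fun b => (ω b)⁻¹) y n ω a b := by
  set T := bondsIn (box y (2 * n)) with hTdef
  have hT : T.Nonempty := bondsIn_box_nonempty hd y (by omega)
  have hc : (0 : ℝ) < T.card := by exact_mod_cast hT.card_pos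
  obtain ⟨hA, a, ha, hasum, haF⟩ := exists_le_avgNorm_mul_rpow hp hT hω
  obtain ⟨hB, b, hb, hbsum, hbF⟩ := exists_le_avgNorm_mul_rpow hq hT
    (F := fun b => (ω b)⁻¹) (fun e => inv_pos.2 (hω e))
  set A := avgNorm p T ω
  set B := avgNorm q T fun b => (ω b)⁻¹
  set P := p⁻¹.toReal
  set Q := q⁻¹.toReal
  have hP : 0 ≤ P := ENNReal.toReal_nonneg
  have hQ : 0 ≤ Q := ENNReal.toReal_nonneg
  have hcard : (T.card : ℝ) ≤ d * 5 ^ d * (n : ℝ) ^ (d : ℝ) := by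
    have h1 : (T.card : ℝ) ≤ d * (box y (2 * n)).card := by
      exact_mod_cast card_bondsIn_le (box y (2 * n))
    refine h1.trans ?_
    rw [mul_assoc]
    exact mul_le_mul_of_nonneg_left (card_box_le y hn le_rfl) (by positivity)
  -- Pointwise `1 = ω * ω⁻¹ ≤ A * B * a ^ P * b ^ Q * 1 ^ (1 - P - Q)`; the weighted mean inequality
  -- makes this linear in `a` and `b`, whose averages are `1`.
  have hone : 1 ≤ A * B := by
    have hpt : ∀ e ∈ T, 1 ≤ A * B * (P * a e + Q * b e + (1 - P - Q) * 1) := by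
      intro e he
      have h1 := mul_le_mul (haF e he) (hbF e he) (inv_pos.2 (hω e)).le
        (mul_nonneg hA.le (Real.rpow_nonneg (ha e) _))
      rw [mul_inv_cancel₀ (hω e).ne'] at h1
      have h2 := Real.geom_mean_le_arith_mean3_weighted hP hQ (by linarith : 0 ≤ 1 - P - Q)
        (ha e) (hb e) zero_le_one (by ring)
      rw [Real.one_rpow, mul_one] at h2
      calc (1 : ℝ) ≤ A * a e ^ P * (B * b e ^ Q) := h1
        _ = A * B * (a e ^ P * b e ^ Q) := by ring
        _ ≤ _ := mul_le_mul_of_nonneg_left h2 (mul_pos hA hB).le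
    have hs := Finset.sum_le_sum hpt
    rw [← Finset.mul_sum, Finset.sum_add_distrib, Finset.sum_add_distrib, ← Finset.mul_sum,
      ← Finset.mul_sum, hasum, hbsum] at hs
    simp only [Finset.sum_const, nsmul_eq_mul, mul_one] at hs
    have : (T.card : ℝ) ≤ A * B * T.card := by linarith
    nlinarith
  refine ⟨a, b, ⟨hω, ha, hb, hA, hB, hone, fun e h1 h2 => haF e ((mem_bondsIn _ _).2 ⟨h1, h2⟩),
    fun e h1 h2 => hbF e ((mem_bondsIn _ _).2 ⟨h1, h2⟩), ?_, ?_⟩⟩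
  · rw [bondMass_eq_sum_bondsIn, ← hTdef, hasum]; exact hcard
  · rw [bondMass_eq_sum_bondsIn, ← hTdef, hbsum]; exact hcard

theorem toReal_inv_lt_one {p : ℝ≥0∞} (hp : 1 < p) : p⁻¹.toReal < 1 := by
  rw [← ENNReal.toReal_one]
  exact (ENNReal.toReal_lt_toReal (ENNReal.inv_ne_top.2 (zero_lt_one.trans hp).ne')
    ENNReal.one_ne_top).2 (ENNReal.inv_lt_one.2 hp)

theorem dualExp_eq {p : ℝ≥0∞} (hp : 1 < p) : dualExp p = 1 / (1 - p⁻¹.toReal) := by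
  by_cases h : p = ∞
  · subst h; simp [dualExp]
  · have h1 : 1 < p.toReal := by
      rw [← ENNReal.toReal_one]
      exact (ENNReal.toReal_lt_toReal ENNReal.one_ne_top h).2 hp
    have h2 : p.toReal - 1 ≠ 0 := by linarith
    have h3 : p.toReal ≠ 0 := by linarith
    rw [dualExp, if_neg h, ENNReal.toReal_inv]
    field_simp

theorem theorem1p4 (d : ℕ) (hd : 3 ≤ d) (p q : ℝ≥0∞) (hp : 1 < p) (hq : 1 < q)
    (hpq : p⁻¹.toReal + q⁻¹.toReal < 2 / ((d : ℝ) - 1)) :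
    0 < delta d p q ∧
    ∃ c : ℝ, 1 ≤ c ∧
      ∀ ω : Bond d → ℝ, (∀ b, 0 < ω b) →
      ∀ u : LatticePt d → ℝ, (∀ x, divStar (fun b => ω b * grad u b) x = 0) →
      ∀ (y : LatticePt d) (n : ℕ), 1 ≤ n →
      ∀ x ∈ box y n,
        |u x| ≤ c * Lam p q ω (box y (2 * n)) ^ (dualExp p * ((delta d p q + 1) / delta d p q)) *
          avgNorm 1 (box y (2 * n)) u := by
  have hδ : 0 < delta d p q := by
    have : 2 / ((d : ℝ) - 1) = 2 * (1 / ((d : ℝ) - 1)) := by ring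
    rw [delta]; linarith
  have hd3 : (3 : ℝ) ≤ d := by exact_mod_cast hd
  -- For `d ≥ 3` the threshold `2 / (d - 1)` is at most `1`.
  have hpq1 : p⁻¹.toReal + q⁻¹.toReal ≤ 1 := by
    refine hpq.le.trans ?_
    rw [div_le_one (by linarith)]; linarith
  have hI : IterExponents d p⁻¹.toReal q⁻¹.toReal (delta d p q) (2 / (1 + q⁻¹.toReal))
      (2 / (1 + q⁻¹.toReal + 2 * delta d p q)) :=
    ⟨hd, ENNReal.toReal_nonneg, toReal_inv_lt_one hp, ENNReal.toReal_nonneg, toReal_inv_lt_one hq,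
      hδ, rfl, rfl, rfl⟩
  obtain ⟨C, hC, H⟩ := hI.exists_le_sum
  refine ⟨hδ, C * 5 ^ d, one_le_mul_of_one_le_of_one_le hC (one_le_pow₀ (by norm_num)), ?_⟩
  intro ω hω u hu y n hn x hx
  have hN : (0 : ℝ) < n := by exact_mod_cast hn
  obtain ⟨a, b, hW⟩ := exists_weightBound (by omega : 0 < d) (zero_lt_one.trans hp).ne'
    (zero_lt_one.trans hq).ne' hpq1 hω y hn
  have h1 := H _ _ y n ω a b hn hW (fun z => |u z|) (fun z => abs_nonneg _)
    (fun z => divStar_grad_abs_nonpos (fun e => (hω e).le) (hu z)) x hx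
  rw [← dualExp_eq hp] at h1
  change |u x| ≤ C * Lam p q ω (box y (2 * n)) ^ _ * _ at h1
  have hLam : 0 ≤ Lam p q ω (box y (2 * n)) := (mul_pos hW.A_pos hW.B_pos).le
  -- Passing from the normalization by `n ^ d` to that by the number of points of the box accounts
  -- for the factor `5 ^ d` in the constant.
  have havg : (n : ℝ) ^ (-(d : ℝ)) * ∑ x ∈ box y (2 * n), |u x| ≤
      5 ^ d * avgNorm 1 (box y (2 * n)) u := by
    rw [avgNorm, if_neg ENNReal.one_ne_top]
    simp only [ENNReal.toReal_one, Real.rpow_one, div_one]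
    rw [← mul_assoc]
    refine mul_le_mul_of_nonneg_right ?_ (Finset.sum_nonneg fun z _ => abs_nonneg _)
    have hcard := card_box_le y hn (le_refl (2 * n))
    have hpos : (0 : ℝ) < (box y (2 * n)).card := by
      exact_mod_cast Finset.card_pos.2 ⟨y, (mem_box _ _ _).2 fun i => by simp⟩
    rw [Real.rpow_neg hN.le, ← div_eq_mul_inv, le_div_iff₀ hpos, inv_mul_le_iff₀ (by positivity)]
    exact hcard.trans (le_of_eq (mul_comm _ _))
  refine h1.trans ((mul_le_mul_of_nonneg_left havg (by positivity)).trans (le_of_eq ?_))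
  ring
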